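/- Let $p,n\ge 1$ be integers. Let $X\in\mathbb{R}^p$ and $S\in(0,\infty)$ be independent with $X\sim N_p(\theta,\eta^{-1}I)$ and $S\sim\eta^{-1}\chi^2_n$, with densities $$f(x\mid\theta,\eta)=\frac{\eta^{p/2}}{(2\pi)^{p/2}}e^{-\eta\|x-\theta\|^2/2},\qquad f(s\mid\eta)=\frac{\eta^{n/2}s^{n/2-1}}{\Gamma(n/2)2^{n/2}}e^{-\eta s/2},$$ where $\theta\in\mathbb{R}^p$ and $\eta=1/\sigma^2>0$ are both unknown. The loss of an estimator $\delta=\delta(x,s)\in\mathbb{R}^p$ of $\theta$ is $\eta\|\delta-\theta\|^2$, and its risk is the expected loss. For real $a,b$ let $$\pi(g)=\frac{1}{(g+1)^{a+2}}\Bigl(\frac{g}{g+1}\Bigr)^b\ (g>0),\qquad \pi_*(\theta,\eta)=\frac1\eta\int_0^\infty\frac{\eta^{p/2}}{(2\pi)^{p/2}g^{p/2}}\exp\Bigl(-\frac{\eta}{2g}\|\theta\|^2\Bigr)\pi(g)\,dg .$$ Suppose that one of the following holds. - Case I: $p\ge1$, $\max(-p/2-1,-2)<a\le-1$ and $b>-1$.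 - Case II: $p\ge3$, $a=-2$ and $b\ge0$. Then the generalized Bayes estimator under $\pi_*$, $$\delta_*(x,s)=\frac{\int_{\mathbb{R}^p}\int_0^\infty\eta\,\theta\,\pi_*(\theta,\eta)f(x\mid\theta,\eta)f(s\mid\eta)\,d\eta\,d\theta}{\int_{\mathbb{R}^p}\int_0^\infty\eta\,\pi_*(\theta,\eta)f(x\mid\theta,\eta)f(s\mid\eta)\,d\eta\,d\theta},$$ is well defined (for all $x$ and all $s>0$ the integrals converge and the denominator is positive) and is admissible among all estimators: no measurable $\delta:\mathbb{R}^p\times(0,\infty)\to\mathbb{R}^p$ has risk at most that of $\delta_*$ at every $(\theta,\eta)$ and strictly smaller risk at some $(\theta,\eta)$. -/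

import Mathlib

open MeasureTheory Set

/-- Density at `x` of the `p`-variate normal distribution with mean `θ` and covariance `η⁻¹ I`. -/
noncomputable def normalDensity {p : ℕ} (x θ : EuclideanSpace ℝ (Fin p)) (η : ℝ) : ℝ :=
  η ^ ((p : ℝ) / 2) / (2 * Real.pi) ^ ((p : ℝ) / 2) * Real.exp (-(η * ‖x - θ‖ ^ 2 / 2))

/-- Density at `s > 0` of `η⁻¹ χ²_n`. -/
noncomputable def scaleDensity (n : ℕ) (s η : ℝ) : ℝ :=
  η ^ ((n : ℝ) / 2) * s ^ ((n : ℝ) / 2 - 1) / (Real.Gamma ((n : ℝ) / 2) * 2 ^ ((n : ℝ) / 2)) *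
    Real.exp (-(η * s / 2))

/-- Risk at `(θ, η)` of the estimator `δ (x, s)` under the loss `η ‖δ - θ‖²`, for independent
`X ∼ N_p(θ, η⁻¹ I)` and `S ∼ η⁻¹ χ²_n`. Only the values of `δ` with `s > 0` matter. -/
noncomputable def risk (n : ℕ) {p : ℕ}
    (δ : EuclideanSpace ℝ (Fin p) → ℝ → EuclideanSpace ℝ (Fin p))
    (θ : EuclideanSpace ℝ (Fin p)) (η : ℝ) : ENNReal :=
  ∫⁻ x, ∫⁻ s in Ioi (0 : ℝ),
    ENNReal.ofReal (η * ‖δ x s - θ‖ ^ 2 * (normalDensity x θ η * scaleDensity n s η))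

/-- `δ'` dominates `δ`: its risk is nowhere larger, and somewhere smaller. -/
def Dominates (n : ℕ) {p : ℕ}
    (δ' δ : EuclideanSpace ℝ (Fin p) → ℝ → EuclideanSpace ℝ (Fin p)) : Prop :=
  (∀ θ : EuclideanSpace ℝ (Fin p), ∀ η : ℝ, 0 < η → risk n δ' θ η ≤ risk n δ θ η) ∧
    ∃ θ : EuclideanSpace ℝ (Fin p), ∃ η : ℝ, 0 < η ∧ risk n δ' θ η < risk n δ θ η

/-- Admissibility of `δ` among all (measurable) estimators. -/
def IsAdmissible (n : ℕ) {p : ℕ}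
    (δ : EuclideanSpace ℝ (Fin p) → ℝ → EuclideanSpace ℝ (Fin p)) : Prop :=
  Measurable (Function.uncurry δ) ∧
    ¬ ∃ δ' : EuclideanSpace ℝ (Fin p) → ℝ → EuclideanSpace ℝ (Fin p),
      Measurable (Function.uncurry δ') ∧ Dominates n δ' δ

/-- The prior `π(g) = (g + 1)^(-a-2) (g / (g + 1))^b` on the hyperparameter `g > 0`. -/
noncomputable def hyperPrior (a b g : ℝ) : ℝ :=
  (g + 1) ^ (-a - 2) * (g / (g + 1)) ^ b

/-- The density of `N_p(0, (g/η) I)` at `θ`, times `π(g)`. -/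
noncomputable def mixtureIntegrand {p : ℕ} (a b : ℝ) (θ : EuclideanSpace ℝ (Fin p))
    (η g : ℝ) : ℝ :=
  η ^ ((p : ℝ) / 2) / ((2 * Real.pi) ^ ((p : ℝ) / 2) * g ^ ((p : ℝ) / 2)) *
    Real.exp (-(η / (2 * g) * ‖θ‖ ^ 2)) * hyperPrior a b g

/-- The joint (improper) prior density `π_*(θ, η)`: the invariant prior `1/η` on `η` and, given `η`,
the scale mixture of the normals `N_p(0, (g/η) I)` with mixing density `π(g)`. -/
noncomputable def jointPrior {p : ℕ} (a b : ℝ) (θ : EuclideanSpace ℝ (Fin p)) (η : ℝ) : ℝ :=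
  1 / η * ∫ g in Ioi (0 : ℝ), mixtureIntegrand a b θ η g

/-- Lebesgue measure on the parameter space `ℝ^p × (0, ∞)`. -/
noncomputable def paramMeasure (p : ℕ) : Measure (EuclideanSpace ℝ (Fin p) × ℝ) :=
  (volume : Measure (EuclideanSpace ℝ (Fin p))).prod (volume.restrict (Ioi (0 : ℝ)))

/-- The weight `η π(θ, η) f(x ∣ θ, η) f(s ∣ η)` at the parameter `z = (θ, η)`. -/
noncomputable def bayesWeight (n : ℕ) {p : ℕ} (π : EuclideanSpace ℝ (Fin p) → ℝ → ℝ)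
    (x : EuclideanSpace ℝ (Fin p)) (s : ℝ) (z : EuclideanSpace ℝ (Fin p) × ℝ) : ℝ :=
  z.2 * π z.1 z.2 * (normalDensity x z.1 z.2 * scaleDensity n s z.2)

/-- The generalized Bayes estimator `m(η θ π) / m(η π)` under the prior density `π`, for the loss
`η ‖δ - θ‖²`, where `m(ψ)(x, s) = ∬ ψ(θ, η) f(x ∣ θ, η) f(s ∣ η) dθ dη`. -/
noncomputable def genBayes (n : ℕ) {p : ℕ} (π : EuclideanSpace ℝ (Fin p) → ℝ → ℝ)
    (x : EuclideanSpace ℝ (Fin p)) (s : ℝ) : EuclideanSpace ℝ (Fin p) :=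
  (∫ z, bayesWeight n π x s z ∂(paramMeasure p))⁻¹ •
    ∫ z, bayesWeight n π x s z • z.1 ∂(paramMeasure p)

/-- All integrals that define the generalized Bayes estimator under `jointPrior a b` converge, and
its denominator is positive. (At `θ = 0`, a null set, the prior density may be infinite.) -/
def GenBayesWellDefined (n p : ℕ) (a b : ℝ) : Prop :=
  (∀ θ : EuclideanSpace ℝ (Fin p), θ ≠ 0 → ∀ η : ℝ, 0 < η →
    IntegrableOn (mixtureIntegrand a b θ η) (Ioi 0)) ∧
  ∀ x : EuclideanSpace ℝ (Fin p), ∀ s : ℝ, 0 < s →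
    Integrable (bayesWeight n (jointPrior a b) x s) (paramMeasure p) ∧
    Integrable (fun z => bayesWeight n (jointPrior a b) x s z • z.1) (paramMeasure p) ∧
    0 < ∫ z, bayesWeight n (jointPrior a b) x s z ∂(paramMeasure p)

/-!
The proof is Blyth's method, with the mixing parameter `g` treated as a part of the parameter.

Given `(η, g)`, the prior on `θ` is conjugate: the posterior of `θ` given `(x, s, η, g)` is
normal with mean `(1 - u) x`, `u = 1 / (1 + g)`. So the generalized Bayes estimator is `(1 - B)
x`, where `B` is the posterior mean of `u` (`genBayes_eq`), and after `θ` is integrated out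
everything takes place on the quadrant of pairs `(η, g)`.

Multiply the prior by `h²`, where `h = cutoff i` has bounded support and tends to `1` as `i → ∞`.
The reweighted prior is finite and the estimator has finite Bayes risk under it
(`lintegral_cutoffRisk_genBayes_lt_top`). A competitor `δ'` whose risk is nowhere larger has no
larger Bayes risk. On the other hand, at each observation (`blyth_pointwise`) any change `d` of
the estimate raises the reweighted posterior risk by at least `‖d‖² / 2` times the mass of `h²`,
up to an error `‖x‖²` times the oscillation of `h` under the posterior. Hence the integral of
`‖d‖²` against the mass of `h²` is at most a multiple of the total oscillation, and if that tends to `0` along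
`i → ∞`, then `d = 0` almost everywhere and `δ'` has the same risk everywhere.

With `w = ‖x‖² / s`, the posterior of `(η, g)` concentrates, with polynomial tails, near `(1 / s,
w)` (`lintegral_marginalWeight_le`, `le_lintegral_marginalWeight`). In the coordinates `log s`
and `log (1 + w)` the total oscillation is then bounded by the Dirichlet energy of `h` on a half
plane. This is where `a ≥ -2` enters: for `a = -2` the weight is exactly that of the plane, and
the plane is recurrent, so that there are cut-off functions of arbitrarily small energy. The
choice `h = max 0 (1 - L / i)` with `L = log (1 + log ρ)` and `ρ = 1 + log (1 + g) + |log η|`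
works, since `L` is unbounded but has finite energy (`lintegral_energy_lt_top`), so that the
energy of `h` is `O(1 / i²)` (`cutoffOscillation_le`).
-/

section

variable {p : ℕ}

/-! ### Blyth's inequality and the cut-off functions -/

/-- A continuous function of two `[0, 1]`-valued random variables is integrable. -/
theorem integrable_comp_unitInterval {Ω : Type*} [MeasurableSpace Ω] {ν : Measure Ω}
    [IsFiniteMeasure ν] {u h : Ω → ℝ} (hu : Measurable u) (hh : Measurable h)
    (hu01 : ∀ᵐ ω ∂ν, u ω ∈ Icc (0 : ℝ) 1) (hh01 : ∀ᵐ ω ∂ν, h ω ∈ Icc (0 : ℝ) 1)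
    {P : ℝ × ℝ → ℝ} (hP : Continuous P) : Integrable (fun ω => P (u ω, h ω)) ν := by
  obtain ⟨C, hC⟩ := (isCompact_Icc.prod isCompact_Icc :
    IsCompact (Icc (0 : ℝ) 1 ×ˢ Icc (0 : ℝ) 1)).exists_bound_of_continuousOn hP.continuousOn
  refine Integrable.of_bound (hP.measurable.comp (hu.prodMk hh)).aestronglyMeasurable C ?_
  filter_upwards [hu01, hh01] with ω h1 h2
  exact hC _ ⟨h1, h2⟩

theorem integral_linear_combination {Ω : Type*} [MeasurableSpace Ω] {ν : Measure Ω}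
    [IsFiniteMeasure ν] {f₁ f₂ f₃ : Ω → ℝ} (h₁ : Integrable f₁ ν) (h₂ : Integrable f₂ ν)
    (h₃ : Integrable f₃ ν) (r₁ r₂ r₃ r₄ : ℝ) :
    ∫ ω, (r₁ * f₁ ω + r₂ * f₂ ω + r₃ * f₃ ω + r₄) ∂ν
      = r₁ * (∫ ω, f₁ ω ∂ν) + r₂ * (∫ ω, f₂ ω ∂ν) + r₃ * (∫ ω, f₃ ω ∂ν) + ν.real univ * r₄ := by
  have i₁ := h₁.const_mul r₁
  have i₂ := h₂.const_mul r₂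
  have i₃ := h₃.const_mul r₃
  have i₁₂ : Integrable (fun ω => r₁ * f₁ ω + r₂ * f₂ ω) ν := i₁.add i₂
  have i₁₂₃ : Integrable (fun ω => r₁ * f₁ ω + r₂ * f₂ ω + r₃ * f₃ ω) ν := i₁₂.add i₃
  rw [integral_add i₁₂₃ (integrable_const _), integral_add i₁₂ i₃, integral_add i₁ i₂,
    integral_const_mul, integral_const_mul, integral_const_mul]
  simp

/-- Blyth's inequality at one observation. Under the posterior `ν`, `1 - u` is the shrinkage factor
of the conditional mean of `θ`, and `B` is the posterior mean of `u`; the prior is reweighted by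
`h²`. Replacing the estimate `(1 - B) x` by any other `v` lowers the reweighted posterior risk by no
more than the oscillation of `h` around a constant `c`, and a quadratic gain in
`‖v - (1 - B) x‖` is kept. -/
theorem blyth_pointwise {Ω E : Type*} [MeasurableSpace Ω] [NormedAddCommGroup E]
    [InnerProductSpace ℝ E] {ν : Measure Ω} [IsFiniteMeasure ν] {u h : Ω → ℝ}
    (hu : Measurable u) (hh : Measurable h)
    (hu01 : ∀ᵐ ω ∂ν, u ω ∈ Icc (0 : ℝ) 1) (hh01 : ∀ᵐ ω ∂ν, h ω ∈ Icc (0 : ℝ) 1)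
    (hν : 0 < ν.real univ) (c B : ℝ) (hB : B * ν.real univ = ∫ ω, u ω ∂ν) (x v : E) :
    (∫ ω, h ω ^ 2 * ‖(1 - B) • x - (1 - u ω) • x‖ ^ 2 ∂ν)
        + ‖v - (1 - B) • x‖ ^ 2 / 2 * ∫ ω, h ω ^ 2 ∂ν
      ≤ (∫ ω, h ω ^ 2 * ‖v - (1 - u ω) • x‖ ^ 2 ∂ν)
        + 48 * ‖x‖ ^ 2 * ((∫ ω, u ω ^ 2 * (h ω - c) ^ 2 ∂ν)
          + (∫ ω, u ω ^ 2 ∂ν) * (∫ ω, (h ω - c) ^ 2 ∂ν) / ν.real univ) := by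
  have int : ∀ {P : ℝ × ℝ → ℝ}, Continuous P → Integrable (fun ω => P (u ω, h ω)) ν :=
    fun hP => integrable_comp_unitInterval hu hh hu01 hh01 hP
  set m := ν.real univ with hm
  have iconst : ∀ r : ℝ, ∫ _, r ∂ν = m * r := fun r => by simp [hm]
  set d := v - (1 - B) • x with hd
  have iu : Integrable u ν := int (P := fun z => z.1) (by fun_prop)
  have ih : Integrable h ν := int (P := fun z => z.2) (by fun_prop)
  have iu2 : Integrable (fun ω => u ω ^ 2) ν := int (P := fun z => z.1 ^ 2) (by fun_prop)
  have ih2 : Integrable (fun ω => h ω ^ 2) ν := int (P := fun z => z.2 ^ 2) (by fun_prop)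
  have ihc : Integrable (fun ω => (h ω - c) ^ 2) ν :=
    int (P := fun z => (z.2 - c) ^ 2) (by fun_prop)
  have iuhc : Integrable (fun ω => u ω ^ 2 * (h ω - c) ^ 2) ν :=
    int (P := fun z => z.1 ^ 2 * (z.2 - c) ^ 2) (by fun_prop)
  have ih2u : Integrable (fun ω => h ω ^ 2 * (u ω - B)) ν :=
    int (P := fun z => z.2 ^ 2 * (z.1 - B)) (by fun_prop)
  have ih2u2 : Integrable (fun ω => h ω ^ 2 * (u ω - B) ^ 2) ν :=
    int (P := fun z => z.2 ^ 2 * (z.1 - B) ^ 2) (by fun_prop)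
  -- the mean of `h`
  obtain ⟨h₀, hh₀⟩ : ∃ h₀ : ℝ, h₀ * m = ∫ ω, h ω ∂ν := ⟨(∫ ω, h ω ∂ν) / m, by field_simp⟩
  have sq_mean : ∀ (f : Ω → ℝ) (r : ℝ), Integrable f ν → Integrable (fun ω => f ω ^ 2) ν →
      r * m = ∫ ω, f ω ∂ν → r ^ 2 * m ≤ ∫ ω, f ω ^ 2 ∂ν := by
    intro f r hf hf2 hr
    have h0 : 0 ≤ ∫ ω, (f ω - r) ^ 2 ∂ν := integral_nonneg fun ω => sq_nonneg _
    have h1 : ∫ ω, (f ω - r) ^ 2 ∂ν = (∫ ω, f ω ^ 2 ∂ν) - 2 * r * (∫ ω, f ω ∂ν) + m * r ^ 2 := by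
      have := integral_linear_combination hf2 hf hf 1 (-2 * r) 0 (r ^ 2)
      rw [← hm] at this
      rw [show (∫ ω, f ω ^ 2 ∂ν) - 2 * r * (∫ ω, f ω ∂ν) + m * r ^ 2 = 1 * (∫ ω, f ω ^ 2 ∂ν)
        + -2 * r * (∫ ω, f ω ∂ν) + 0 * (∫ ω, f ω ∂ν) + m * r ^ 2 by ring, ← this]
      exact integral_congr_ae (.of_forall fun ω => by simp only; ring)
    rw [h1, ← hr] at h0
    nlinarith
  set I := ∫ ω, h ω ^ 2 ∂ν with hI
  set U := ∫ ω, u ω ^ 2 ∂ν with hU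
  set H := ∫ ω, (h ω - c) ^ 2 ∂ν with hH
  set X := ∫ ω, u ω ^ 2 * (h ω - c) ^ 2 ∂ν with hX
  have e1 : h₀ ^ 2 * m ≤ I := sq_mean h h₀ ih ih2 hh₀
  have e2 : B ^ 2 * m ≤ U := sq_mean u B iu iu2 hB
  have e3 : (h₀ - c) ^ 2 * m ≤ H := by
    refine sq_mean (fun ω => h ω - c) (h₀ - c) (ih.sub (integrable_const _)) ihc ?_
    rw [integral_sub ih (integrable_const _), iconst, ← hh₀]; ring
  have hH0 : 0 ≤ H := integral_nonneg fun ω => sq_nonneg _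
  have hU0 : 0 ≤ U := integral_nonneg fun ω => sq_nonneg _
  have iq : Integrable (fun ω => (h ω + h₀) ^ 2) ν :=
    int (P := fun z => (z.2 + h₀) ^ 2) (by fun_prop)
  have ip : Integrable (fun ω => (u ω - B) ^ 2 * (h ω - h₀) ^ 2) ν :=
    int (P := fun z => (z.1 - B) ^ 2 * (z.2 - h₀) ^ 2) (by fun_prop)
  have ipq : Integrable (fun ω => (u ω - B) * (h ω - h₀) * (h ω + h₀)) ν :=
    int (P := fun z => (z.1 - B) * (z.2 - h₀) * (z.2 + h₀)) (by fun_prop)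
  have Q : ∫ ω, (h ω + h₀) ^ 2 ∂ν ≤ 4 * I := by
    have : ∫ ω, (h ω + h₀) ^ 2 ∂ν = I + 2 * h₀ * (∫ ω, h ω ∂ν) + m * h₀ ^ 2 := by
      have := integral_linear_combination ih2 ih ih 1 (2 * h₀) 0 (h₀ ^ 2)
      rw [← hm, ← hI] at this
      rw [show I + 2 * h₀ * (∫ ω, h ω ∂ν) + m * h₀ ^ 2 = 1 * I
        + 2 * h₀ * (∫ ω, h ω ∂ν) + 0 * (∫ ω, h ω ∂ν) + m * h₀ ^ 2 by ring, ← this]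
      exact integral_congr_ae (.of_forall fun ω => by simp only; ring)
    rw [this, ← hh₀]; nlinarith
  have hu0 : 0 ≤ B := by
    have : 0 ≤ B * m := hB ▸ integral_nonneg_of_ae (hu01.mono fun ω h => h.1)
    exact nonneg_of_mul_nonneg_left this hν
  have P : ∫ ω, (u ω - B) ^ 2 * (h ω - h₀) ^ 2 ∂ν ≤ 2 * X + 6 * (U * H / m) := by
    have l1 : ∫ ω, (u ω - B) ^ 2 * (h ω - h₀) ^ 2 ∂ν ≤
        ∫ ω, (2 * (u ω ^ 2 * (h ω - c) ^ 2) + 2 * (h₀ - c) ^ 2 * u ω ^ 2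
          + 2 * B ^ 2 * (h ω - c) ^ 2 + 2 * B ^ 2 * (h₀ - c) ^ 2) ∂ν := by
      refine integral_mono_ae ip ?_ ?_
      · exact int (P := fun z => 2 * (z.1 ^ 2 * (z.2 - c) ^ 2) + 2 * (h₀ - c) ^ 2 * z.1 ^ 2
          + 2 * B ^ 2 * (z.2 - c) ^ 2 + 2 * B ^ 2 * (h₀ - c) ^ 2) (by fun_prop)
      · filter_upwards [hu01] with ω hω
        have a1 : (u ω - B) ^ 2 ≤ u ω ^ 2 + B ^ 2 := by nlinarith [mul_nonneg hω.1 hu0]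
        have a2 : (h ω - h₀) ^ 2 ≤ 2 * (h ω - c) ^ 2 + 2 * (h₀ - c) ^ 2 := by
          nlinarith [sq_nonneg ((h ω - c) + (h₀ - c))]
        calc (u ω - B) ^ 2 * (h ω - h₀) ^ 2
            ≤ (u ω ^ 2 + B ^ 2) * (2 * (h ω - c) ^ 2 + 2 * (h₀ - c) ^ 2) := by gcongr
          _ = _ := by ring
    rw [integral_linear_combination iuhc iu2 ihc] at l1
    have b1 : (h₀ - c) ^ 2 ≤ H / m := (le_div_iff₀ hν).2 e3
    have b2 : B ^ 2 ≤ U / m := (le_div_iff₀ hν).2 e2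
    have c1 : (h₀ - c) ^ 2 * U ≤ U * H / m :=
      (mul_le_mul_of_nonneg_right b1 hU0).trans_eq (by ring)
    have c2 : B ^ 2 * H ≤ U * H / m := (mul_le_mul_of_nonneg_right b2 hH0).trans_eq (by ring)
    have c3 : m * (B ^ 2 * (h₀ - c) ^ 2) ≤ U * H / m := by
      calc m * (B ^ 2 * (h₀ - c) ^ 2) ≤ m * (U / m * (H / m)) := by gcongr
        _ = U * H / m := by field_simp
    linarith
  -- centring `u` at its mean makes `h²` replaceable by `h² - h₀²`
  have key : ∫ ω, h ω ^ 2 * (u ω - B) ∂ν = ∫ ω, (u ω - B) * (h ω - h₀) * (h ω + h₀) ∂ν := by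
    have z : ∫ ω, (u ω - B) ∂ν = 0 := by
      rw [integral_sub iu (integrable_const _), iconst, ← hB]; ring
    have : ∫ ω, (u ω - B) * (h ω - h₀) * (h ω + h₀) ∂ν
        = (∫ ω, h ω ^ 2 * (u ω - B) ∂ν) - h₀ ^ 2 * ∫ ω, (u ω - B) ∂ν := by
      have i1 : Integrable (fun ω => h₀ ^ 2 * (u ω - B)) ν :=
        (iu.sub (integrable_const _)).const_mul _
      rw [← integral_const_mul, ← integral_sub ih2u i1]
      exact integral_congr_ae (.of_forall fun ω => by simp only; ring)
    rw [this, z]; ring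
  have cross : -(‖d‖ ^ 2 / 8 * (∫ ω, (h ω + h₀) ^ 2 ∂ν)
      + 8 * ‖x‖ ^ 2 * ∫ ω, (u ω - B) ^ 2 * (h ω - h₀) ^ 2 ∂ν)
      ≤ 2 * inner ℝ d x * ∫ ω, h ω ^ 2 * (u ω - B) ∂ν := by
    rw [key, ← integral_const_mul, ← integral_const_mul, ← integral_const_mul,
      ← integral_add (iq.const_mul _) (ip.const_mul _), ← integral_neg]
    refine integral_mono ((iq.const_mul _).add (ip.const_mul _)).neg (ipq.const_mul _) fun ω => ?_
    have cs := abs_real_inner_le_norm d x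
    have t1 : |2 * inner ℝ d x * ((u ω - B) * (h ω - h₀) * (h ω + h₀))|
        ≤ 2 * (‖d‖ * ‖x‖) * (|(u ω - B) * (h ω - h₀)| * |h ω + h₀|) := by
      rw [abs_mul, abs_mul, abs_mul (_ * _) (h ω + h₀), abs_two]
      gcongr
    have t2 := neg_abs_le (2 * inner ℝ d x * ((u ω - B) * (h ω - h₀) * (h ω + h₀)))
    have t3 := sq_nonneg (‖d‖ * |h ω + h₀| - 8 * (‖x‖ * |(u ω - B) * (h ω - h₀)|))
    have t4 := sq_abs (h ω + h₀)
    have t5 := sq_abs ((u ω - B) * (h ω - h₀))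
    have t6 : (‖d‖ * |h ω + h₀| - 8 * (‖x‖ * |(u ω - B) * (h ω - h₀)|)) ^ 2
        = ‖d‖ ^ 2 * (h ω + h₀) ^ 2 + 64 * ‖x‖ ^ 2 * ((u ω - B) ^ 2 * (h ω - h₀) ^ 2)
          - 8 * (2 * (‖d‖ * ‖x‖) * (|(u ω - B) * (h ω - h₀)| * |h ω + h₀|)) := by
      rw [← t4, ← mul_pow (u ω - B), ← t5]; ring
    simp only
    linarith
  have ex : ∫ ω, h ω ^ 2 * ‖v - (1 - u ω) • x‖ ^ 2 ∂ν
      = ‖d‖ ^ 2 * I + 2 * inner ℝ d x * (∫ ω, h ω ^ 2 * (u ω - B) ∂ν)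
        + ‖x‖ ^ 2 * ∫ ω, h ω ^ 2 * (u ω - B) ^ 2 ∂ν := by
    have := integral_linear_combination ih2 ih2u ih2u2 (‖d‖ ^ 2) (2 * inner ℝ d x) (‖x‖ ^ 2) 0
    rw [mul_zero, add_zero] at this
    rw [hI, ← this]
    refine integral_congr_ae (.of_forall fun ω => ?_)
    have : v - (1 - u ω) • x = d + (u ω - B) • x := by rw [hd]; module
    simp only [this]
    rw [norm_add_sq_real, inner_smul_right, norm_smul, mul_pow, Real.norm_eq_abs, sq_abs]
    ring
  have ex0 : ∫ ω, h ω ^ 2 * ‖(1 - B) • x - (1 - u ω) • x‖ ^ 2 ∂ν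
      = ‖x‖ ^ 2 * ∫ ω, h ω ^ 2 * (u ω - B) ^ 2 ∂ν := by
    rw [← integral_const_mul]
    refine integral_congr_ae (.of_forall fun ω => ?_)
    have : (1 - B) • x - (1 - u ω) • x = (u ω - B) • x := by module
    simp only [this]
    rw [norm_smul, mul_pow, Real.norm_eq_abs, sq_abs]; ring
  rw [ex, ex0]
  have hX0 : 0 ≤ X := integral_nonneg fun ω => by positivity
  have d1 : ‖d‖ ^ 2 / 8 * (∫ ω, (h ω + h₀) ^ 2 ∂ν) ≤ ‖d‖ ^ 2 / 8 * (4 * I) := by gcongr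
  have d2 : 8 * ‖x‖ ^ 2 * ∫ ω, (u ω - B) ^ 2 * (h ω - h₀) ^ 2 ∂ν
      ≤ 8 * ‖x‖ ^ 2 * (2 * X + 6 * (U * H / m)) := by gcongr
  have d3 : 0 ≤ ‖x‖ ^ 2 * X := by positivity
  nlinarith

/-- A quantitative form of the concavity of `log` on `[1, ∞)`. -/
theorem abs_log_sub_log_le {x y D : ℝ} (hx : 1 ≤ x) (hy : 1 ≤ y) (h : |x - y| ≤ D) :
    |Real.log x - Real.log y| ≤ D * (1 + D) / y := by
  have hx0 : 0 < x := by linarith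
  have hy0 : 0 < y := by linarith
  have hD : 0 ≤ D := (abs_nonneg _).trans h
  obtain ⟨h1, h2⟩ := abs_le.1 h
  have l1 : Real.log x - Real.log y ≤ D / y := by
    rw [← Real.log_div hx0.ne' hy0.ne']
    refine (Real.log_le_sub_one_of_pos (by positivity)).trans ?_
    rw [div_sub_one hy0.ne']; gcongr
  have l2 : Real.log y - Real.log x ≤ D / x := by
    rw [← Real.log_div hy0.ne' hx0.ne']
    refine (Real.log_le_sub_one_of_pos (by positivity)).trans ?_
    rw [div_sub_one hx0.ne']; gcongr; linarith
  have l3 : D / x ≤ D * (1 + D) / y := by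
    rw [div_le_div_iff₀ hx0 hy0]
    have : y ≤ (1 + D) * x := by nlinarith
    nlinarith
  have l4 : D / y ≤ D * (1 + D) / y := by gcongr; nlinarith
  rw [abs_le]; constructor <;> linarith

/-- The logarithmic distance of `(η, g)` to `(1, 0)`, increased by one. -/
noncomputable def logRadius (η g : ℝ) : ℝ := 1 + Real.log (1 + g) + |Real.log η|

/-- The iterated logarithm of `logRadius`. In the coordinates `log η` and `log (1 + g)` of the plane
it tends to infinity at infinity but has finite Dirichlet energy. -/
noncomputable def iterLog (η g : ℝ) : ℝ := Real.log (1 + Real.log (logRadius η g))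

/-- Cut-off functions on the `(η, g)` quadrant: they have bounded support and increase to `1` as
`i → ∞`. -/
noncomputable def cutoff (i : ℝ) (η g : ℝ) : ℝ := max 0 (1 - iterLog η g / i)

theorem one_le_logRadius {η g : ℝ} (hg : 0 ≤ g) : 1 ≤ logRadius η g := by
  have := Real.log_nonneg (show (1 : ℝ) ≤ 1 + g by linarith)
  have := abs_nonneg (Real.log η)
  unfold logRadius; linarith

theorem iterLog_nonneg {η g : ℝ} (hg : 0 ≤ g) : 0 ≤ iterLog η g := by
  have := Real.log_nonneg (one_le_logRadius (η := η) hg)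
  exact Real.log_nonneg (by linarith)

theorem iterLog_le {η g : ℝ} (hg : 0 ≤ g) : iterLog η g ≤ Real.log (1 + g) + |Real.log η| := by
  have h1 := one_le_logRadius (η := η) hg
  have h2 := Real.log_nonneg h1
  have h3 := Real.log_le_sub_one_of_pos (show 0 < 1 + Real.log (logRadius η g) by linarith)
  have h4 := Real.log_le_sub_one_of_pos (show 0 < logRadius η g by linarith)
  unfold iterLog
  have : logRadius η g - 1 = Real.log (1 + g) + |Real.log η| := by unfold logRadius; ring
  linarith

theorem measurable_cutoff (i : ℝ) : Measurable fun z : ℝ × ℝ => cutoff i z.1 z.2 := by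
  unfold cutoff iterLog logRadius
  fun_prop

theorem cutoff_mem_Icc {i η g : ℝ} (hi : 0 < i) (hg : 0 ≤ g) : cutoff i η g ∈ Icc (0 : ℝ) 1 :=
  ⟨le_max_left _ _, max_le zero_le_one (by
    have := div_nonneg (iterLog_nonneg (η := η) hg) hi.le; linarith)⟩

theorem cutoff_mono {i j η g : ℝ} (hi : 0 < i) (hij : i ≤ j) (hg : 0 ≤ g) :
    cutoff i η g ≤ cutoff j η g := by
  have := iterLog_nonneg (η := η) hg
  unfold cutoff; gcongr

/-- The cut-off functions are supported in bounded sets, bounded away from `η = 0`. -/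
theorem exists_cutoff_eq_zero (i : ℝ) (hi : 0 < i) : ∃ M : ℝ, 0 < M ∧ ∀ η g : ℝ, 0 < η → 0 ≤ g →
    cutoff i η g ≠ 0 → g ≤ Real.exp M ∧ |Real.log η| ≤ M := by
  refine ⟨Real.exp (Real.exp i), Real.exp_pos _, fun η g hη hg h => ?_⟩
  have h1 := one_le_logRadius (η := η) hg
  have h2 := Real.log_nonneg h1
  have hL : iterLog η g < i := by
    by_contra! hc
    apply h
    unfold cutoff
    rw [max_eq_left]
    have := (one_le_div hi).2 hc
    linarith
  have h3 : 1 + Real.log (logRadius η g) < Real.exp i :=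
    (Real.log_lt_iff_lt_exp (by linarith)).1 hL
  have h4 : logRadius η g < Real.exp (Real.exp i) :=
    (Real.log_lt_iff_lt_exp (by linarith)).1 (by linarith)
  have h5 := abs_nonneg (Real.log η)
  have h6 := Real.log_nonneg (show (1 : ℝ) ≤ 1 + g by linarith)
  unfold logRadius at h4
  refine ⟨?_, by linarith⟩
  have : 1 + g < Real.exp (Real.exp (Real.exp i)) :=
    (Real.log_lt_iff_lt_exp (by linarith)).1 (by linarith)
  linarith

/-- The oscillation of the cut-off function between two points at logarithmic distance `D`. -/
theorem abs_cutoff_sub_le {i η g η₀ g₀ D : ℝ} (hi : 0 < i) (hη : 0 < η) (hη₀ : 0 < η₀) (hg : 0 ≤ g)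
    (hg₀ : 0 ≤ g₀) (hD : |Real.log ((1 + g) / (1 + g₀))| + |Real.log (η / η₀)| ≤ D) :
    |cutoff i η g - cutoff i η₀ g₀|
      ≤ (1 + D) ^ 4 / (i * (logRadius η₀ g₀ * (1 + Real.log (logRadius η₀ g₀)))) := by
  have hD0 : 0 ≤ D := (by positivity : (0:ℝ) ≤ _).trans hD
  have h1 := one_le_logRadius (η := η) hg
  have h2 := one_le_logRadius (η := η₀) hg₀
  have h3 := Real.log_nonneg h1
  have h4 := Real.log_nonneg h2
  have d0 : |logRadius η g - logRadius η₀ g₀| ≤ D := by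
    refine le_trans ?_ hD
    rw [Real.log_div (by linarith) (by linarith), Real.log_div hη.ne' hη₀.ne']
    have := abs_abs_sub_abs_le_abs_sub (Real.log η) (Real.log η₀)
    unfold logRadius
    rw [show 1 + Real.log (1 + g) + |Real.log η| - (1 + Real.log (1 + g₀) + |Real.log η₀|)
      = (Real.log (1 + g) - Real.log (1 + g₀)) + (|Real.log η| - |Real.log η₀|) by ring]
    exact (abs_add_le _ _).trans (by gcongr)
  set ρ := logRadius η₀ g₀
  have d1 := abs_log_sub_log_le h1 h2 d0
  have d2 := abs_log_sub_log_le (x := 1 + Real.log (logRadius η g)) (y := 1 + Real.log ρ)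
    (D := D * (1 + D) / ρ) (by linarith) (by linarith) (by rwa [add_sub_add_left_eq_sub])
  have d3 : |iterLog η g - iterLog η₀ g₀| ≤ (1 + D) ^ 4 / (ρ * (1 + Real.log ρ)) := by
    refine d2.trans ?_
    rw [← div_div]
    have hl : 0 < 1 + Real.log ρ := by linarith
    refine (div_le_div_of_nonneg_right ?_ hl.le)
    have e1 : D * (1 + D) / ρ ≤ D * (1 + D) := div_le_self (by positivity) h2
    rw [le_div_iff₀ (by positivity)]
    calc D * (1 + D) / ρ * (1 + D * (1 + D) / ρ) * ρ
        = D * (1 + D) * (1 + D * (1 + D) / ρ) := by field_simp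
      _ ≤ D * (1 + D) * (1 + D * (1 + D)) := by gcongr
      _ ≤ (1 + D) ^ 4 := by nlinarith [pow_nonneg hD0 2, pow_nonneg hD0 3]
  have d4 : |cutoff i η g - cutoff i η₀ g₀| ≤ |iterLog η g - iterLog η₀ g₀| / i := by
    unfold cutoff
    rw [max_comm, max_comm (0 : ℝ)]
    refine (abs_max_sub_max_le_abs _ _ _).trans_eq ?_
    rw [show 1 - iterLog η g / i - (1 - iterLog η₀ g₀ / i)
      = -((iterLog η g - iterLog η₀ g₀) / i) by ring, abs_neg, abs_div, abs_of_pos hi]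
  calc _ ≤ _ := d4
    _ ≤ (1 + D) ^ 4 / (ρ * (1 + Real.log ρ)) / i := by gcongr
    _ = _ := by rw [div_div, mul_comm i]

/-! ### Normal and Gamma densities -/

theorem normalDensity_nonneg (x θ : EuclideanSpace ℝ (Fin p)) {η : ℝ} (hη : 0 ≤ η) :
    0 ≤ normalDensity x θ η := by
  unfold normalDensity; positivity

theorem normalDensity_pos (x θ : EuclideanSpace ℝ (Fin p)) {η : ℝ} (hη : 0 < η) :
    0 < normalDensity x θ η := by
  unfold normalDensity; positivity

theorem measurable_normalDensity : Measurable
    fun z : (EuclideanSpace ℝ (Fin p) × EuclideanSpace ℝ (Fin p)) × ℝ =>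
      normalDensity z.1.1 z.1.2 z.2 := by
  unfold normalDensity; fun_prop

theorem Measurable.normalDensity {α : Type*} [MeasurableSpace α]
    {x θ : α → EuclideanSpace ℝ (Fin p)} {η : α → ℝ} (hx : Measurable x) (hθ : Measurable θ)
    (hη : Measurable η) : Measurable fun z => normalDensity (x z) (θ z) (η z) :=
  measurable_normalDensity.comp ((hx.prodMk hθ).prodMk hη)

theorem Measurable.scaleDensity {α : Type*} [MeasurableSpace α] (n : ℕ)
    {s η : α → ℝ} (hs : Measurable s) (hη : Measurable η) :
    Measurable fun z => scaleDensity n (s z) (η z) := by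
  unfold _root_.scaleDensity; fun_prop

theorem scaleDensity_nonneg (n : ℕ) {s η : ℝ} (hs : 0 ≤ s) (hη : 0 ≤ η) :
    0 ≤ scaleDensity n s η := by
  unfold scaleDensity
  have : 0 ≤ Real.Gamma ((n : ℝ) / 2) := Real.Gamma_nonneg_of_nonneg (by positivity)
  positivity

theorem scaleDensity_pos {n : ℕ} (hn : 1 ≤ n) {s η : ℝ} (hs : 0 < s) (hη : 0 < η) :
    0 < scaleDensity n s η := by
  unfold scaleDensity
  have : 0 < Real.Gamma ((n : ℝ) / 2) := Real.Gamma_pos_of_pos (by positivity)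
  positivity

theorem hyperPrior_nonneg (a b : ℝ) {g : ℝ} (hg : 0 ≤ g) : 0 ≤ hyperPrior a b g := by
  unfold hyperPrior; positivity

theorem hyperPrior_pos (a b : ℝ) {g : ℝ} (hg : 0 < g) : 0 < hyperPrior a b g := by
  unfold hyperPrior; positivity

theorem measurable_hyperPrior (a b : ℝ) : Measurable (hyperPrior a b) := by
  unfold hyperPrior; fun_prop

theorem integrable_gaussian_sub (μ : EuclideanSpace ℝ (Fin p)) {c : ℝ} (hc : 0 < c) :
    Integrable fun y : EuclideanSpace ℝ (Fin p) => Real.exp (-c * ‖y - μ‖ ^ 2) := by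
  have h0 : Integrable fun y : EuclideanSpace ℝ (Fin p) => Real.exp (-c * ‖y‖ ^ 2) := by
    by_contra h
    have := GaussianFourier.integral_rexp_neg_mul_sq_norm (V := EuclideanSpace ℝ (Fin p)) hc
    rw [integral_undef h] at this
    have : 0 < (Real.pi / c) ^ ((Module.finrank ℝ (EuclideanSpace ℝ (Fin p)) : ℝ) / 2) := by
      positivity
    linarith
  exact h0.comp_sub_right μ

theorem integral_gaussian_sub (μ : EuclideanSpace ℝ (Fin p)) {c : ℝ} (hc : 0 < c) :
    ∫ y : EuclideanSpace ℝ (Fin p), Real.exp (-c * ‖y - μ‖ ^ 2)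
      = (Real.pi / c) ^ ((p : ℝ) / 2) := by
  rw [integral_sub_right_eq_self (fun y : EuclideanSpace ℝ (Fin p) => Real.exp (-c * ‖y‖ ^ 2)) μ,
    GaussianFourier.integral_rexp_neg_mul_sq_norm hc]
  simp

theorem normalDensity_eq (y μ : EuclideanSpace ℝ (Fin p)) (τ : ℝ) :
    normalDensity y μ τ = τ ^ ((p : ℝ) / 2) / (2 * Real.pi) ^ ((p : ℝ) / 2)
      * Real.exp (-(τ / 2) * ‖y - μ‖ ^ 2) := by
  unfold normalDensity; congr 2; ring

theorem integrable_normalDensity (μ : EuclideanSpace ℝ (Fin p)) {τ : ℝ} (hτ : 0 < τ) :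
    Integrable fun y => normalDensity y μ τ := by
  simp_rw [normalDensity_eq]
  exact (integrable_gaussian_sub μ (by positivity)).const_mul _

theorem integral_normalDensity (μ : EuclideanSpace ℝ (Fin p)) {τ : ℝ} (hτ : 0 < τ) :
    ∫ y, normalDensity y μ τ = 1 := by
  simp_rw [normalDensity_eq]
  rw [integral_const_mul, integral_gaussian_sub μ (by positivity),
    ← Real.div_rpow (by positivity) (by positivity),
    ← Real.mul_rpow (by positivity) (by positivity)]
  rw [show τ / (2 * Real.pi) * (Real.pi / (τ / 2)) = 1 by field_simp, Real.one_rpow]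

theorem lintegral_normalDensity (μ : EuclideanSpace ℝ (Fin p)) {τ : ℝ} (hτ : 0 < τ) :
    ∫⁻ y, ENNReal.ofReal (normalDensity y μ τ) = 1 := by
  rw [← ofReal_integral_eq_lintegral_ofReal (integrable_normalDensity μ hτ)
    (.of_forall fun y => normalDensity_nonneg y μ hτ.le), integral_normalDensity μ hτ,
    ENNReal.ofReal_one]

/-- The constant `4 * 2 ^ (p / 2)` is not sharp (the integral is `p / τ`), but it is enough. -/
theorem lintegral_sq_mul_normalDensity_le (μ : EuclideanSpace ℝ (Fin p)) {τ : ℝ} (hτ : 0 < τ) :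
    ∫⁻ y, ENNReal.ofReal (‖y - μ‖ ^ 2 * normalDensity y μ τ)
      ≤ ENNReal.ofReal (4 * 2 ^ ((p : ℝ) / 2) / τ) := by
  set K := τ ^ ((p : ℝ) / 2) / (2 * Real.pi) ^ ((p : ℝ) / 2) with hK
  have hK0 : 0 ≤ K := by positivity
  have hle : ∀ y : EuclideanSpace ℝ (Fin p), ‖y - μ‖ ^ 2 * normalDensity y μ τ
      ≤ 4 / τ * K * Real.exp (-(τ / 4) * ‖y - μ‖ ^ 2) := by
    intro y
    rw [normalDensity_eq, ← hK]
    have h1 : ‖y - μ‖ ^ 2 ≤ 4 / τ * Real.exp (τ / 4 * ‖y - μ‖ ^ 2) := by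
      have := Real.add_one_le_exp (τ / 4 * ‖y - μ‖ ^ 2)
      calc ‖y - μ‖ ^ 2 = 4 / τ * (τ / 4 * ‖y - μ‖ ^ 2) := by field_simp
        _ ≤ _ := by gcongr; linarith
    calc ‖y - μ‖ ^ 2 * (K * Real.exp (-(τ / 2) * ‖y - μ‖ ^ 2))
        ≤ 4 / τ * Real.exp (τ / 4 * ‖y - μ‖ ^ 2) * (K * Real.exp (-(τ / 2) * ‖y - μ‖ ^ 2)) := by
          gcongr
      _ = 4 / τ * K * (Real.exp (τ / 4 * ‖y - μ‖ ^ 2) * Real.exp (-(τ / 2) * ‖y - μ‖ ^ 2)) := by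
          ring
      _ = _ := by rw [← Real.exp_add]; congr 2; ring
  refine (lintegral_mono fun y => ENNReal.ofReal_le_ofReal (hle y)).trans ?_
  have hi := (integrable_gaussian_sub μ (show 0 < τ / 4 by positivity)).const_mul (4 / τ * K)
  rw [← ofReal_integral_eq_lintegral_ofReal hi (.of_forall fun y => by positivity),
    integral_const_mul, integral_gaussian_sub μ (by positivity)]
  refine ENNReal.ofReal_le_ofReal (le_of_eq ?_)
  rw [hK, mul_assoc, ← Real.div_rpow (by positivity) (by positivity),
    ← Real.mul_rpow (by positivity) (by positivity),
    show τ / (2 * Real.pi) * (Real.pi / (τ / 4)) = 2 by field_simp; norm_num]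
  ring

theorem integrable_sq_mul_normalDensity (μ : EuclideanSpace ℝ (Fin p)) {τ : ℝ} (hτ : 0 < τ) :
    Integrable fun y => ‖y - μ‖ ^ 2 * normalDensity y μ τ := by
  have hm : Measurable fun y => ‖y - μ‖ ^ 2 * normalDensity y μ τ :=
    (by fun_prop : Measurable fun y => ‖y - μ‖ ^ 2).mul
      (Measurable.normalDensity measurable_id measurable_const measurable_const)
  refine ⟨hm.aestronglyMeasurable, ?_⟩
  rw [hasFiniteIntegral_iff_ofReal
    (.of_forall fun y => mul_nonneg (by positivity) (normalDensity_nonneg y μ hτ.le))]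
  exact (lintegral_sq_mul_normalDensity_le μ hτ).trans_lt ENNReal.ofReal_lt_top

theorem integrable_normalDensity_smul_sub (μ : EuclideanSpace ℝ (Fin p)) {τ : ℝ} (hτ : 0 < τ) :
    Integrable fun y => normalDensity y μ τ • (y - μ) := by
  have hm : Measurable fun y => normalDensity y μ τ • (y - μ) :=
    (Measurable.normalDensity measurable_id measurable_const measurable_const).smul
      (by fun_prop)
  refine ((integrable_normalDensity μ hτ).add (integrable_sq_mul_normalDensity μ hτ)).mono'
    hm.aestronglyMeasurable (.of_forall fun y => ?_)
  have := normalDensity_nonneg y μ hτ.le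
  rw [norm_smul, Real.norm_of_nonneg this]
  simp only [Pi.add_apply]
  nlinarith [sq_nonneg (‖y - μ‖ - 1), norm_nonneg (y - μ),
    mul_nonneg this (sq_nonneg (‖y - μ‖ - 1)),
    mul_nonneg this (norm_nonneg (y - μ))]

theorem integral_normalDensity_smul_sub (μ : EuclideanSpace ℝ (Fin p)) (τ : ℝ) :
    ∫ y, normalDensity y μ τ • (y - μ) = 0 := by
  have h1 : ∫ y : EuclideanSpace ℝ (Fin p), normalDensity y μ τ • (y - μ)
      = ∫ y : EuclideanSpace ℝ (Fin p), normalDensity y 0 τ • y := by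
    rw [← integral_sub_right_eq_self
      (fun y : EuclideanSpace ℝ (Fin p) => normalDensity y 0 τ • y) μ]
    simp [normalDensity]
  have h2 := integral_neg_eq_self (fun y : EuclideanSpace ℝ (Fin p) => normalDensity y 0 τ • y)
    volume
  rw [h1]
  have h3 : ∫ y : EuclideanSpace ℝ (Fin p), normalDensity (-y) 0 τ • (-y)
      = -∫ y : EuclideanSpace ℝ (Fin p), normalDensity y 0 τ • y := by
    rw [← integral_neg]; simp [normalDensity]
  rw [h3] at h2
  have h4 : (2 : ℝ) • ∫ y : EuclideanSpace ℝ (Fin p), normalDensity y 0 τ • y = 0 := by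
    rw [two_smul]; nth_rewrite 1 [← h2]; exact neg_add_cancel _
  exact (smul_eq_zero.1 h4).resolve_left two_ne_zero

theorem integral_normalDensity_smul (μ : EuclideanSpace ℝ (Fin p)) {τ : ℝ} (hτ : 0 < τ) :
    ∫ y, normalDensity y μ τ • y = μ := by
  have h := integral_add (integrable_normalDensity_smul_sub μ hτ)
    ((integrable_normalDensity μ hτ).smul_const μ)
  rw [integral_normalDensity_smul_sub, integral_smul_const, integral_normalDensity μ hτ, zero_add,
    one_smul] at h
  refine Eq.trans (integral_congr_ae (.of_forall fun y => ?_)) h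
  simp [smul_sub]

/-- Bias–variance decomposition for the normal distribution. -/
theorem lintegral_sq_sub_mul_normalDensity (v μ : EuclideanSpace ℝ (Fin p)) {τ : ℝ} (hτ : 0 < τ) :
    ∫⁻ y, ENNReal.ofReal (‖v - y‖ ^ 2 * normalDensity y μ τ)
      = ENNReal.ofReal (‖v - μ‖ ^ 2)
        + ∫⁻ y : EuclideanSpace ℝ (Fin p), ENNReal.ofReal (‖y‖ ^ 2 * normalDensity y 0 τ) := by
  have i1 := (integrable_normalDensity μ hτ).const_mul (‖v - μ‖ ^ 2)
  have i2 := integrable_sq_mul_normalDensity μ hτ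
  have i3 : Integrable fun y => -2 * inner ℝ (v - μ) (normalDensity y μ τ • (y - μ)) :=
    ((integrable_normalDensity_smul_sub μ hτ).const_inner (v - μ)).const_mul (-2)
  have e : ∀ y, ‖v - y‖ ^ 2 * normalDensity y μ τ = ‖v - μ‖ ^ 2 * normalDensity y μ τ
      + -2 * inner ℝ (v - μ) (normalDensity y μ τ • (y - μ))
      + ‖y - μ‖ ^ 2 * normalDensity y μ τ := by
    intro y
    rw [show v - y = (v - μ) - (y - μ) by abel, norm_sub_sq_real, inner_smul_right]; ring
  have i12 : Integrable fun y => ‖v - μ‖ ^ 2 * normalDensity y μ τ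
      + -2 * inner ℝ (v - μ) (normalDensity y μ τ • (y - μ)) := i1.add i3
  have i123 := i12.add i2
  have hv : ∫⁻ y : EuclideanSpace ℝ (Fin p), ENNReal.ofReal (‖y‖ ^ 2 * normalDensity y 0 τ)
      = ENNReal.ofReal (∫ y, ‖y - μ‖ ^ 2 * normalDensity y μ τ) := by
    rw [ofReal_integral_eq_lintegral_ofReal i2
      (.of_forall fun y => mul_nonneg (by positivity) (normalDensity_nonneg y μ hτ.le)),
      ← lintegral_sub_right_eq_self (fun y : EuclideanSpace ℝ (Fin p) =>
        ENNReal.ofReal (‖y‖ ^ 2 * normalDensity y 0 τ)) μ]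
    simp [normalDensity]
  rw [hv, ← ENNReal.ofReal_add (by positivity) (integral_nonneg fun y =>
    mul_nonneg (by positivity) (normalDensity_nonneg y μ hτ.le)),
    ← ofReal_integral_eq_lintegral_ofReal
      (i123.congr (.of_forall fun y => (e y).symm))
      (.of_forall fun y => mul_nonneg (by positivity) (normalDensity_nonneg y μ hτ.le))]
  congr 1
  have h1 : ∫ y, ‖v - y‖ ^ 2 * normalDensity y μ τ
      = ∫ y, ((‖v - μ‖ ^ 2 * normalDensity y μ τ
      + -2 * inner ℝ (v - μ) (normalDensity y μ τ • (y - μ)))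
      + ‖y - μ‖ ^ 2 * normalDensity y μ τ) := integral_congr_ae (.of_forall e)
  rw [h1, integral_add i12 i2, integral_add i1 i3, integral_const_mul, integral_const_mul,
    integral_normalDensity μ hτ, integral_inner (integrable_normalDensity_smul_sub μ hτ),
    integral_normalDensity_smul_sub]
  simp

theorem lintegral_rpow_mul_exp {κ r : ℝ} (hκ : 0 < κ) (hr : 0 < r) :
    ∫⁻ t in Ioi (0 : ℝ), ENNReal.ofReal (t ^ (κ - 1) * Real.exp (-(r * t)))
      = ENNReal.ofReal ((1 / r) ^ κ * Real.Gamma κ) := by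
  have h := Real.integral_rpow_mul_exp_neg_mul_Ioi hκ hr
  rw [← h, ofReal_integral_eq_lintegral_ofReal]
  · by_contra hc
    have h0 : ∫ t in Ioi (0 : ℝ), t ^ (κ - 1) * Real.exp (-(r * t)) = 0 := integral_undef hc
    rw [h0] at h
    have := Real.Gamma_pos_of_pos hκ
    have : 0 < (1 / r) ^ κ * Real.Gamma κ := by positivity
    linarith
  · filter_upwards [ae_restrict_mem measurableSet_Ioi] with t ht
    have : 0 < t := ht
    positivity

theorem lintegral_scaleDensity {n : ℕ} (hn : 1 ≤ n) {η : ℝ} (hη : 0 < η) :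
    ∫⁻ s in Ioi (0 : ℝ), ENNReal.ofReal (scaleDensity n s η) = 1 := by
  have hn' : (0 : ℝ) < (n : ℝ) / 2 := by positivity
  have hG := Real.Gamma_pos_of_pos hn'
  set K := η ^ ((n : ℝ) / 2) / (Real.Gamma ((n : ℝ) / 2) * 2 ^ ((n : ℝ) / 2)) with hK
  have hK0 : 0 ≤ K := by positivity
  have e : ∀ s, ENNReal.ofReal (scaleDensity n s η)
      = ENNReal.ofReal K * ENNReal.ofReal (s ^ ((n : ℝ) / 2 - 1) * Real.exp (-(η / 2 * s))) := by
    intro s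
    rw [← ENNReal.ofReal_mul hK0, hK]
    unfold scaleDensity
    rw [show η * s / 2 = η / 2 * s by ring]
    congr 1; ring
  simp_rw [e]
  rw [lintegral_const_mul' _ _ ENNReal.ofReal_ne_top, lintegral_rpow_mul_exp hn' (by positivity),
    ← ENNReal.ofReal_mul hK0, hK, ← ENNReal.ofReal_one]
  congr 1
  rw [one_div_div, Real.div_rpow (by norm_num) hη.le]
  field_simp

/-- The density of `(x, s)` given `(η, g)`, after `θ ∼ N_p(0, (g/η) I)` is integrated out, times the
hyperprior `π(g)`. -/
noncomputable def marginalWeight (n : ℕ) (a b : ℝ) (x : EuclideanSpace ℝ (Fin p)) (s η g : ℝ) : ℝ :=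
  hyperPrior a b g * normalDensity x 0 (η / (1 + g)) * scaleDensity n s η

theorem marginalWeight_pos {n : ℕ} (hn : 1 ≤ n) (a b : ℝ) (x : EuclideanSpace ℝ (Fin p))
    {s η g : ℝ} (hs : 0 < s) (hη : 0 < η) (hg : 0 < g) : 0 < marginalWeight n a b x s η g :=
  mul_pos (mul_pos (hyperPrior_pos a b hg) (normalDensity_pos _ _ (by positivity)))
    (scaleDensity_pos hn hs hη)

theorem marginalWeight_nonneg (n : ℕ) (a b : ℝ) (x : EuclideanSpace ℝ (Fin p))
    {s η g : ℝ} (hs : 0 ≤ s) (hη : 0 ≤ η) (hg : 0 ≤ g) : 0 ≤ marginalWeight n a b x s η g :=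
  mul_nonneg (mul_nonneg (hyperPrior_nonneg a b hg) (normalDensity_nonneg _ _ (by positivity)))
    (scaleDensity_nonneg n hs hη)

theorem Measurable.marginalWeight {α : Type*} [MeasurableSpace α] (n : ℕ) (a b : ℝ)
    {x : α → EuclideanSpace ℝ (Fin p)} {s η g : α → ℝ} (hx : Measurable x) (hs : Measurable s)
    (hη : Measurable η) (hg : Measurable g) :
    Measurable fun z => marginalWeight n a b (x z) (s z) (η z) (g z) :=
  (((measurable_hyperPrior a b).comp hg).mul
    (hx.normalDensity measurable_const (hη.div (hg.const_add 1)))).mul (hs.scaleDensity n hη)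

/-- The normal prior is conjugate: given `(x, η, g)`, the parameter `θ` is normal with mean
`(g/(g+1)) x` and precision `η (g+1)/g`. -/
theorem mixtureIntegrand_mul_density (n : ℕ) (a b : ℝ) (x θ : EuclideanSpace ℝ (Fin p))
    (s : ℝ) {η g : ℝ} (hη : 0 < η) (hg : 0 < g) :
    mixtureIntegrand a b θ η g * (normalDensity x θ η * scaleDensity n s η)
      = marginalWeight n a b x s η g
        * normalDensity θ ((1 - 1 / (1 + g)) • x) (η * (1 + g) / g) := by
  have hg1 : 0 < 1 + g := by linarith
  have e1 : η / (2 * g) * ‖θ‖ ^ 2 + η * ‖x - θ‖ ^ 2 / 2 = η / (1 + g) * ‖x‖ ^ 2 / 2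
      + η * (1 + g) / g * ‖θ - (1 - 1 / (1 + g)) • x‖ ^ 2 / 2 := by
    rw [norm_sub_sq_real, norm_sub_sq_real, inner_smul_right, norm_smul, mul_pow, Real.norm_eq_abs,
      sq_abs, real_inner_comm]
    field_simp
    ring
  have e2 : Real.exp (-(η / (2 * g) * ‖θ‖ ^ 2)) * Real.exp (-(η * ‖x - θ‖ ^ 2 / 2))
      = Real.exp (-(η / (1 + g) * ‖x‖ ^ 2 / 2))
        * Real.exp (-(η * (1 + g) / g * ‖θ - (1 - 1 / (1 + g)) • x‖ ^ 2 / 2)) := by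
    rw [← Real.exp_add, ← Real.exp_add]; congr 1; linarith
  unfold mixtureIntegrand marginalWeight
  unfold normalDensity
  rw [sub_zero]
  rw [Real.div_rpow hη.le hg1.le, Real.div_rpow (by positivity) hg.le, Real.mul_rpow hη.le hg1.le]
  have hg1p : (1 + g) ^ ((p : ℝ) / 2) ≠ 0 := by positivity
  have hgp : g ^ ((p : ℝ) / 2) ≠ 0 := by positivity
  have hpi : (2 * Real.pi) ^ ((p : ℝ) / 2) ≠ 0 := by positivity
  calc _ = (η ^ ((p : ℝ) / 2) / ((2 * Real.pi) ^ ((p : ℝ) / 2) * g ^ ((p : ℝ) / 2)) *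
      (η ^ ((p : ℝ) / 2) / (2 * Real.pi) ^ ((p : ℝ) / 2)) * hyperPrior a b g * scaleDensity n s η)
      * (Real.exp (-(η / (2 * g) * ‖θ‖ ^ 2)) * Real.exp (-(η * ‖x - θ‖ ^ 2 / 2))) := by ring
    _ = _ := by rw [e2]; field_simp

/-! ### Bounds on the marginal density of the observation -/

/-- The shape of the Gamma distribution of `η` given `(x, s, g)`. -/
noncomputable def gammaShape (p n : ℕ) : ℝ := ((p : ℝ) + n) / 2 + 1

/-- The constant factor of the marginal density. -/
noncomputable def marginalConst (p n : ℕ) : ℝ :=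
  1 / ((2 * Real.pi) ^ ((p : ℝ) / 2) * (Real.Gamma ((n : ℝ) / 2) * 2 ^ ((n : ℝ) / 2)))

theorem marginalConst_pos (p : ℕ) {n : ℕ} (hn : 1 ≤ n) : 0 < marginalConst p n := by
  have : 0 < Real.Gamma ((n : ℝ) / 2) := Real.Gamma_pos_of_pos (by positivity)
  unfold marginalConst; positivity

theorem marginalWeight_eq (n : ℕ) (a b : ℝ) (x : EuclideanSpace ℝ (Fin p)) {s η g : ℝ}
    (hs : 0 < s) (hη : 0 < η) (hg : 0 < g) :
    marginalWeight n a b x s η g = marginalConst p n * s ^ ((n : ℝ) / 2 - 1)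
      * (hyperPrior a b g * (1 + g) ^ (-((p : ℝ) / 2)))
      * (η ^ (gammaShape p n - 1)
        * Real.exp (-(s * (1 + ‖x‖ ^ 2 / s / (1 + g)) / 2 * η))) := by
  have hg1 : 0 < 1 + g := by linarith
  have e1 : η ^ (gammaShape p n - 1) = η ^ ((p : ℝ) / 2) * η ^ ((n : ℝ) / 2) := by
    rw [← Real.rpow_add hη]; unfold gammaShape; congr 1; ring
  have e2 : Real.exp (-(s * (1 + ‖x‖ ^ 2 / s / (1 + g)) / 2 * η))
      = Real.exp (-(η / (1 + g) * ‖x‖ ^ 2 / 2)) * Real.exp (-(η * s / 2)) := by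
    rw [← Real.exp_add]; congr 1; field_simp; ring
  rw [e1, e2]
  unfold marginalWeight normalDensity scaleDensity marginalConst
  rw [Real.div_rpow hη.le hg1.le, Real.rpow_neg hg1.le, sub_zero]
  field_simp

theorem exp_mul_abs_log_le {ε y : ℝ} (hy : 0 < y) :
    Real.exp (ε * |Real.log y|) ≤ y ^ ε + y ^ (-ε) := by
  rw [Real.rpow_def_of_pos hy, Real.rpow_def_of_pos hy]
  rcases abs_cases (Real.log y) with ⟨h, -⟩ | ⟨h, -⟩ <;> rw [h]
  · have := Real.exp_pos (Real.log y * -ε)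
    rw [mul_comm]; linarith
  · have := Real.exp_pos (Real.log y * ε)
    rw [show ε * -Real.log y = Real.log y * -ε by ring]; linarith

theorem lintegral_gamma_exp_log_le {κ ε : ℝ} (hε : 0 ≤ ε) (hκ : ε < κ) :
    ∃ C : ℝ, 0 ≤ C ∧ ∀ s v : ℝ, 0 < s → 1 ≤ v →
      ∫⁻ η in Ioi (0 : ℝ), ENNReal.ofReal
          (η ^ (κ - 1) * Real.exp (-(s * v / 2 * η)) * Real.exp (ε * |Real.log (η * s)|))
        ≤ ENNReal.ofReal (C * (s ^ (-κ) * v ^ (-(κ - ε)))) := by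
  have G1 := Real.Gamma_pos_of_pos (show 0 < κ + ε by linarith)
  have G2 := Real.Gamma_pos_of_pos (show 0 < κ - ε by linarith)
  refine ⟨2 ^ (κ + ε) * Real.Gamma (κ + ε) + 2 ^ (κ - ε) * Real.Gamma (κ - ε), by positivity,
    fun s v hs hv => ?_⟩
  have hv0 : 0 < v := by linarith
  have hr : 0 < s * v / 2 := by positivity
  have step : ∀ η ∈ Ioi (0 : ℝ), ENNReal.ofReal
      (η ^ (κ - 1) * Real.exp (-(s * v / 2 * η)) * Real.exp (ε * |Real.log (η * s)|))
      ≤ ENNReal.ofReal (s ^ ε)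
          * ENNReal.ofReal (η ^ (κ + ε - 1) * Real.exp (-(s * v / 2 * η)))
        + ENNReal.ofReal (s ^ (-ε))
          * ENNReal.ofReal (η ^ (κ - ε - 1) * Real.exp (-(s * v / 2 * η))) := by
    intro η hη
    have hη : 0 < η := hη
    rw [← ENNReal.ofReal_mul (by positivity), ← ENNReal.ofReal_mul (by positivity),
      ← ENNReal.ofReal_add (by positivity) (by positivity)]
    refine ENNReal.ofReal_le_ofReal ?_
    refine (mul_le_mul_of_nonneg_left (exp_mul_abs_log_le (by positivity)) (by positivity)).trans
      (le_of_eq ?_)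
    rw [Real.mul_rpow hη.le hs.le, Real.mul_rpow hη.le hs.le,
      show κ + ε - 1 = (κ - 1) + ε by ring, show κ - ε - 1 = (κ - 1) + -ε by ring,
      Real.rpow_add hη, Real.rpow_add hη]
    ring
  refine (setLIntegral_mono' measurableSet_Ioi step).trans ?_
  rw [lintegral_add_left (by fun_prop), lintegral_const_mul' _ _ ENNReal.ofReal_ne_top,
    lintegral_const_mul' _ _ ENNReal.ofReal_ne_top, lintegral_rpow_mul_exp (by linarith) hr,
    lintegral_rpow_mul_exp (by linarith) hr, ← ENNReal.ofReal_mul (by positivity),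
    ← ENNReal.ofReal_mul (by positivity), ← ENNReal.ofReal_add (by positivity) (by positivity)]
  refine ENNReal.ofReal_le_ofReal ?_
  have pw : ∀ r : ℝ, (1 / (s * v / 2)) ^ r = 2 ^ r * s ^ (-r) * v ^ (-r) := by
    intro r
    rw [one_div_div, Real.div_rpow (by norm_num) (by positivity), Real.mul_rpow hs.le hv0.le,
      Real.rpow_neg hs.le, Real.rpow_neg hv0.le]
    field_simp
  rw [pw, pw]
  have e1 : s ^ ε * s ^ (-(κ + ε)) = s ^ (-κ) := by rw [← Real.rpow_add hs]; congr 1; ring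
  have e2 : s ^ (-ε) * s ^ (-(κ - ε)) = s ^ (-κ) := by rw [← Real.rpow_add hs]; congr 1; ring
  have e3 : v ^ (-(κ + ε)) ≤ v ^ (-(κ - ε)) := Real.rpow_le_rpow_of_exponent_le hv (by linarith)
  calc s ^ ε * (2 ^ (κ + ε) * s ^ (-(κ + ε)) * v ^ (-(κ + ε)) * Real.Gamma (κ + ε))
        + s ^ (-ε) * (2 ^ (κ - ε) * s ^ (-(κ - ε)) * v ^ (-(κ - ε)) * Real.Gamma (κ - ε))
      = 2 ^ (κ + ε) * Real.Gamma (κ + ε) * (s ^ ε * s ^ (-(κ + ε)) * v ^ (-(κ + ε)))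
        + 2 ^ (κ - ε) * Real.Gamma (κ - ε) * (s ^ (-ε) * s ^ (-(κ - ε)) * v ^ (-(κ - ε))) := by
          ring
    _ ≤ 2 ^ (κ + ε) * Real.Gamma (κ + ε) * (s ^ (-κ) * v ^ (-(κ - ε)))
        + 2 ^ (κ - ε) * Real.Gamma (κ - ε) * (s ^ (-κ) * v ^ (-(κ - ε))) := by
          rw [e1, e2]; gcongr
    _ = _ := by ring

theorem hyperPrior_le (a b : ℝ) {g : ℝ} (hg : 0 < g) :
    hyperPrior a b g ≤
      2 ^ |b| * ((1 + g) ^ (-a - 2) * (1 + (Iic (1 : ℝ)).indicator (· ^ b) g)) := by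
  have hy0 : 0 < g / (g + 1) := by positivity
  have hy1 : g / (g + 1) ≤ 1 := (div_le_one (by linarith)).2 (by linarith)
  have key : (g / (g + 1)) ^ b ≤ 2 ^ |b| * (1 + (Iic (1 : ℝ)).indicator (· ^ b) g) := by
    have hi : 0 ≤ (Iic (1 : ℝ)).indicator (· ^ b) g :=
      indicator_apply_nonneg fun _ => by positivity
    have h2 : (1 : ℝ) ≤ 2 ^ |b| := Real.one_le_rpow (by norm_num) (abs_nonneg _)
    rcases le_or_gt 0 b with hb | hb
    · have := Real.rpow_le_one hy0.le hy1 hb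
      nlinarith
    · rw [abs_of_neg hb] at h2 ⊢
      have e2 : ((1 : ℝ) / 2) ^ b = 2 ^ (-b) := by
        rw [one_div, Real.inv_rpow (by norm_num), Real.rpow_neg (by norm_num)]
      rcases le_or_gt g 1 with h1 | h1
      · rw [indicator_of_mem (show g ∈ Iic (1 : ℝ) from h1)]
        have : (g / (g + 1)) ^ b ≤ (1 / 2 * g) ^ b := by
          refine Real.rpow_le_rpow_of_nonpos (by positivity) ?_ hb.le
          rw [le_div_iff₀ (by linarith)]; nlinarith
        rw [Real.mul_rpow (by norm_num) hg.le, e2] at this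
        have : (0 : ℝ) < 2 ^ (-b) := by positivity
        linarith
      · have : (g / (g + 1)) ^ b ≤ (1 / 2) ^ b := by
          refine Real.rpow_le_rpow_of_nonpos (by positivity) ?_ hb.le
          rw [le_div_iff₀ (by linarith)]; linarith
        rw [e2] at this
        nlinarith
  unfold hyperPrior
  calc (g + 1) ^ (-a - 2) * (g / (g + 1)) ^ b
      ≤ (g + 1) ^ (-a - 2) * (2 ^ |b| * (1 + (Iic (1 : ℝ)).indicator (· ^ b) g)) := by gcongr
    _ = _ := by rw [add_comm g 1]; ring

theorem le_hyperPrior (a b : ℝ) {g : ℝ} (hg : 1 ≤ g) :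
    2 ^ (-|b|) * (1 + g) ^ (-a - 2) ≤ hyperPrior a b g := by
  have hy1 : g / (g + 1) ≤ 1 := (div_le_one (by linarith)).2 (by linarith)
  have hy2 : 1 / 2 ≤ g / (g + 1) := by rw [le_div_iff₀ (by linarith)]; linarith
  have key : 2 ^ (-|b|) ≤ (g / (g + 1)) ^ b := by
    rcases le_or_gt 0 b with hb | hb
    · rw [abs_of_nonneg hb, Real.rpow_neg (by norm_num), ← Real.inv_rpow (by norm_num), ← one_div]
      exact Real.rpow_le_rpow (by norm_num) hy2 hb
    · exact (Real.rpow_le_one_of_one_le_of_nonpos (by norm_num) (by simp)).trans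
        (Real.one_le_rpow_of_pos_of_le_one_of_nonpos (by positivity) hy1 hb.le)
  unfold hyperPrior
  rw [mul_comm, add_comm 1 g]
  gcongr

theorem lintegral_Ioc_rpow {r q : ℝ} (hr : -1 < r) (hq : 0 ≤ q) :
    ∫⁻ y in Ioc 0 q, ENNReal.ofReal (y ^ r) = ENNReal.ofReal (q ^ (r + 1) / (r + 1)) := by
  have hi : IntegrableOn (fun y : ℝ => y ^ r) (Ioc 0 q) :=
    (intervalIntegrable_iff_integrableOn_Ioc_of_le hq).1
      (intervalIntegral.intervalIntegrable_rpow' hr)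
  rw [← ofReal_integral_eq_lintegral_ofReal hi, ← intervalIntegral.integral_of_le hq,
    integral_rpow (Or.inl hr), Real.zero_rpow (by linarith), sub_zero]
  filter_upwards [ae_restrict_mem measurableSet_Ioc] with y hy
  exact Real.rpow_nonneg hy.1.le _

theorem lintegral_Ioi_rpow {r q : ℝ} (hr : r < -1) (hq : 0 < q) :
    ∫⁻ y in Ioi q, ENNReal.ofReal (y ^ r) = ENNReal.ofReal (-q ^ (r + 1) / (r + 1)) := by
  rw [← ofReal_integral_eq_lintegral_ofReal (integrableOn_Ioi_rpow_of_lt hr hq),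
    integral_Ioi_rpow_of_lt hr hq]
  filter_upwards [ae_restrict_mem measurableSet_Ioi] with y hy
  exact Real.rpow_nonneg (hq.trans hy).le _

/-- The integral over `g` of a density of order `g^(e - 1)`, damped on both sides of `g = q`, is of
order `q^e`; the singularity of the hyperprior at `0` does not matter. -/
theorem lintegral_hyperPrior_damped_le {a b e ε κ β : ℝ} (hb : -1 < b) (he : e + ε < 0)
    (hε : 0 ≤ ε) (hκ : 0 < e + κ) (hβ : -a - 2 + β = e - 1) :
    ∃ C : ℝ, 0 ≤ C ∧ ∀ q : ℝ, 1 ≤ q →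
      ∫⁻ g in Ioi (0 : ℝ), ENNReal.ofReal (hyperPrior a b g * (1 + g) ^ β
          * min (((1 + g) / q) ^ ε) (((1 + g) / q) ^ κ)) ≤ ENNReal.ofReal (C * q ^ e) := by
  refine ⟨2 ^ |b| * ((1 / (e + κ) + 1 / (-(e + ε))) + 2 ^ κ * (1 / (b + 1))), ?_, fun q hq => ?_⟩
  · have : 0 < -(e + ε) := by linarith
    have : 0 < b + 1 := by linarith
    positivity
  have hq0 : 0 < q := by linarith
  set F : ℝ → ℝ := fun y => y ^ (e - 1) * min ((y / q) ^ ε) ((y / q) ^ κ) with hF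
  have hF0 : ∀ y, 0 < y → 0 ≤ F y := fun y hy => by
    have := Real.rpow_nonneg (show 0 ≤ y / q by positivity) ε
    have := Real.rpow_nonneg (show 0 ≤ y / q by positivity) κ
    exact mul_nonneg (by positivity) (le_min ‹_› ‹_›)
  have hFm : Measurable F := by rw [hF]; fun_prop
  -- the regular part, after the substitution `y = 1 + g`
  have part1 : ∫⁻ g in Ioi (0 : ℝ), ENNReal.ofReal (F (1 + g))
      ≤ ENNReal.ofReal ((1 / (e + κ) + 1 / (-(e + ε))) * q ^ e) := by
    have s1 : ∫⁻ g in Ioi (0 : ℝ), ENNReal.ofReal (F (1 + g))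
        ≤ ∫⁻ y in Ioi (0 : ℝ), ENNReal.ofReal (F y) := by
      rw [← lintegral_indicator measurableSet_Ioi, ← lintegral_indicator measurableSet_Ioi,
        ← lintegral_add_left_eq_self ((Ioi (0 : ℝ)).indicator fun y => ENNReal.ofReal (F y)) 1]
      refine lintegral_mono fun g => ?_
      by_cases hg : 0 < g
      · rw [indicator_of_mem (show g ∈ Ioi (0 : ℝ) from hg),
          indicator_of_mem (show 1 + g ∈ Ioi (0 : ℝ) from by simp only [mem_Ioi]; linarith)]
      · rw [indicator_of_notMem (by simpa using hg)]; exact zero_le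
    refine s1.trans ?_
    rw [← Ioc_union_Ioi_eq_Ioi hq0.le, lintegral_union measurableSet_Ioi (Ioc_disjoint_Ioi le_rfl)]
    have s2 : ∫⁻ y in Ioc 0 q, ENNReal.ofReal (F y) ≤ ENNReal.ofReal (1 / (e + κ) * q ^ e) := by
      have : ∀ y ∈ Ioc 0 q, ENNReal.ofReal (F y)
          ≤ ENNReal.ofReal (q ^ (-κ)) * ENNReal.ofReal (y ^ (e + κ - 1)) := by
        intro y hy
        have hy0 : 0 < y := hy.1
        rw [← ENNReal.ofReal_mul (by positivity)]
        refine ENNReal.ofReal_le_ofReal ?_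
        calc F y ≤ y ^ (e - 1) * (y / q) ^ κ := by
              rw [hF]; exact mul_le_mul_of_nonneg_left (min_le_right _ _) (by positivity)
          _ = _ := by
            rw [Real.div_rpow hy0.le hq0.le, Real.rpow_neg hq0.le,
              show e + κ - 1 = (e - 1) + κ by ring, Real.rpow_add hy0]; field_simp
      refine (setLIntegral_mono' measurableSet_Ioc this).trans ?_
      rw [lintegral_const_mul' _ _ ENNReal.ofReal_ne_top, lintegral_Ioc_rpow (by linarith) hq0.le,
        ← ENNReal.ofReal_mul (by positivity)]
      refine ENNReal.ofReal_le_ofReal (le_of_eq ?_)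
      rw [show e + κ - 1 + 1 = e + κ by ring, Real.rpow_add hq0, Real.rpow_neg hq0.le]
      field_simp
    have s3 : ∫⁻ y in Ioi q, ENNReal.ofReal (F y) ≤ ENNReal.ofReal (1 / (-(e + ε)) * q ^ e) := by
      have : ∀ y ∈ Ioi q, ENNReal.ofReal (F y)
          ≤ ENNReal.ofReal (q ^ (-ε)) * ENNReal.ofReal (y ^ (e + ε - 1)) := by
        intro y hy
        have hy0 : 0 < y := hq0.trans hy
        rw [← ENNReal.ofReal_mul (by positivity)]
        refine ENNReal.ofReal_le_ofReal ?_
        calc F y ≤ y ^ (e - 1) * (y / q) ^ ε := by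
              rw [hF]; exact mul_le_mul_of_nonneg_left (min_le_left _ _) (by positivity)
          _ = _ := by
            rw [Real.div_rpow hy0.le hq0.le, Real.rpow_neg hq0.le,
              show e + ε - 1 = (e - 1) + ε by ring, Real.rpow_add hy0]; field_simp
      refine (setLIntegral_mono' measurableSet_Ioi this).trans ?_
      rw [lintegral_const_mul' _ _ ENNReal.ofReal_ne_top, lintegral_Ioi_rpow (by linarith) hq0,
        ← ENNReal.ofReal_mul (by positivity)]
      refine ENNReal.ofReal_le_ofReal (le_of_eq ?_)
      have : e + ε ≠ 0 := he.ne
      rw [show e + ε - 1 + 1 = e + ε by ring, Real.rpow_add hq0, Real.rpow_neg hq0.le]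
      field_simp
    refine (add_le_add s2 s3).trans (le_of_eq ?_)
    have : 0 < -(e + ε) := by linarith
    rw [← ENNReal.ofReal_add (by positivity) (by positivity), add_mul]
  -- the singularity of the hyperprior at `0`
  have part2 : ∫⁻ g in Ioi (0 : ℝ), ENNReal.ofReal (F (1 + g) * (Iic (1 : ℝ)).indicator (· ^ b) g)
      ≤ ENNReal.ofReal (2 ^ κ * (1 / (b + 1)) * q ^ e) := by
    have : ∀ g ∈ Ioi (0 : ℝ), ENNReal.ofReal (F (1 + g) * (Iic (1 : ℝ)).indicator (· ^ b) g)
        ≤ (Ioc (0 : ℝ) 1).indicator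
          (fun g => ENNReal.ofReal (2 ^ κ * q ^ e) * ENNReal.ofReal (g ^ b)) g := by
      intro g hg
      have hg0 : 0 < g := hg
      by_cases h1 : g ≤ 1
      · rw [indicator_of_mem (show g ∈ Iic (1 : ℝ) from h1),
          indicator_of_mem (show g ∈ Ioc (0 : ℝ) 1 from ⟨hg0, h1⟩),
          ← ENNReal.ofReal_mul (by positivity)]
        refine ENNReal.ofReal_le_ofReal (mul_le_mul_of_nonneg_right ?_ (by positivity))
        have hκ0 : 0 < κ := by linarith
        calc F (1 + g) ≤ 1 * ((1 + g) / q) ^ κ := by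
              refine mul_le_mul ?_ (min_le_right _ _) (le_min (by positivity) (by positivity))
                zero_le_one
              exact Real.rpow_le_one_of_one_le_of_nonpos (by linarith) (by linarith)
          _ ≤ (2 / q) ^ κ := by
              rw [one_mul]
              exact Real.rpow_le_rpow (by positivity) (by gcongr; linarith) hκ0.le
          _ = 2 ^ κ * q ^ (-κ) := by
              rw [Real.div_rpow (by norm_num) hq0.le, Real.rpow_neg hq0.le]; rfl
          _ ≤ 2 ^ κ * q ^ e := by
              exact mul_le_mul_of_nonneg_left
                (Real.rpow_le_rpow_of_exponent_le hq (by linarith)) (by positivity)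
      · rw [indicator_of_notMem (show g ∉ Iic (1 : ℝ) from h1)]; simp
    refine (setLIntegral_mono' measurableSet_Ioi this).trans ?_
    rw [lintegral_indicator measurableSet_Ioc, Measure.restrict_restrict measurableSet_Ioc,
      inter_eq_left.2 (fun y hy => hy.1), lintegral_const_mul' _ _ ENNReal.ofReal_ne_top,
      lintegral_Ioc_rpow hb zero_le_one, ← ENNReal.ofReal_mul (by positivity), Real.one_rpow]
    exact ENNReal.ofReal_le_ofReal (le_of_eq (by ring))
  have hle : ∀ g ∈ Ioi (0 : ℝ), ENNReal.ofReal (hyperPrior a b g * (1 + g) ^ β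
      * min (((1 + g) / q) ^ ε) (((1 + g) / q) ^ κ))
      ≤ ENNReal.ofReal (2 ^ |b|) * (ENNReal.ofReal (F (1 + g))
        + ENNReal.ofReal (F (1 + g) * (Iic (1 : ℝ)).indicator (· ^ b) g)) := by
    intro g hg
    have hg0 : 0 < g := hg
    have hF1 := hF0 (1 + g) (by linarith)
    have hi : 0 ≤ (Iic (1 : ℝ)).indicator (· ^ b) g :=
      indicator_apply_nonneg fun _ => by positivity
    rw [← ENNReal.ofReal_add hF1 (mul_nonneg hF1 hi), ← ENNReal.ofReal_mul (by positivity)]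
    refine ENNReal.ofReal_le_ofReal ?_
    have hm : 0 ≤ min (((1 + g) / q) ^ ε) (((1 + g) / q) ^ κ) :=
      le_min (by positivity) (by positivity)
    have e1 : (1 + g) ^ (e - 1) = (1 + g) ^ (-a - 2) * (1 + g) ^ β := by
      rw [← hβ, Real.rpow_add (by linarith)]
    calc _ ≤ 2 ^ |b| * ((1 + g) ^ (-a - 2) * (1 + (Iic (1 : ℝ)).indicator (· ^ b) g))
          * (1 + g) ^ β * min (((1 + g) / q) ^ ε) (((1 + g) / q) ^ κ) := by
            gcongr
            exact hyperPrior_le a b hg0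
      _ = _ := by rw [hF]; simp only; rw [e1]; ring
  refine (setLIntegral_mono' measurableSet_Ioi hle).trans ?_
  rw [lintegral_const_mul' _ _ ENNReal.ofReal_ne_top,
    lintegral_add_left (by fun_prop)]
  refine (mul_le_mul_right (add_le_add part1 part2) _).trans (le_of_eq ?_)
  have h1 : 0 < -(e + ε) := by linarith
  have h2 : 0 < b + 1 := by linarith
  rw [← ENNReal.ofReal_add (by positivity) (by positivity), ← ENNReal.ofReal_mul (by positivity)]
  congr 1; ring

/-- Lebesgue measure on the quadrant of the pairs `(η, g)`. -/
noncomputable def quadrant : Measure (ℝ × ℝ) :=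
  (volume.restrict (Ioi (0 : ℝ))).prod (volume.restrict (Ioi (0 : ℝ)))

instance : SFinite quadrant := by unfold quadrant; infer_instance

theorem ae_quadrant : ∀ᵐ z ∂quadrant, 0 < z.1 ∧ 0 < z.2 := by
  unfold quadrant
  rw [Measure.prod_restrict]
  exact ae_restrict_mem (measurableSet_Ioi.prod measurableSet_Ioi)

theorem exp_abs_log_mul_rpow_le_min {ε κ t v : ℝ} (hε : 0 ≤ ε) (hκ : 3 * ε ≤ κ) (ht : 0 < t)
    (hv : 1 ≤ v) (hvt : 1 / t ≤ v) :
    Real.exp (ε * |Real.log t|) * v ^ (-(κ - ε)) ≤ min (t ^ ε) (t ^ (κ - 2 * ε)) := by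
  have v1 : v ^ (-(κ - ε)) ≤ 1 := Real.rpow_le_one_of_one_le_of_nonpos hv (by linarith)
  rcases le_or_gt 1 t with h1 | h1
  · have e1 : Real.exp (ε * |Real.log t|) = t ^ ε := by
      rw [abs_of_nonneg (Real.log_nonneg h1), Real.rpow_def_of_pos ht, mul_comm]
    rw [e1]
    have : t ^ ε * v ^ (-(κ - ε)) ≤ t ^ ε := mul_le_of_le_one_right (by positivity) v1
    exact le_min this (this.trans (Real.rpow_le_rpow_of_exponent_le h1 (by linarith)))
  · have e1 : Real.exp (ε * |Real.log t|) = t ^ (-ε) := by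
      rw [abs_of_nonpos (Real.log_nonpos ht.le h1.le), Real.rpow_def_of_pos ht]; ring_nf
    have v2 : v ^ (-(κ - ε)) ≤ t ^ (κ - ε) := by
      refine (Real.rpow_le_rpow_of_nonpos (by positivity) hvt (by linarith)).trans (le_of_eq ?_)
      rw [one_div, Real.inv_rpow ht.le, Real.rpow_neg ht.le, inv_inv]
    have : Real.exp (ε * |Real.log t|) * v ^ (-(κ - ε)) ≤ t ^ (κ - 2 * ε) := by
      rw [e1]
      calc t ^ (-ε) * v ^ (-(κ - ε)) ≤ t ^ (-ε) * t ^ (κ - ε) := by gcongr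
        _ = t ^ (κ - 2 * ε) := by rw [← Real.rpow_add ht]; congr 1; ring
    exact le_min (this.trans (Real.rpow_le_rpow_of_exponent_ge ht h1.le (by linarith))) this

/-- Exponential moments, in logarithmic coordinates, of the unnormalized posterior of `(η, g)`: it
concentrates near `η = 1 / s` and `1 + g = 1 + ‖x‖² / s`. -/
theorem lintegral_marginalWeight_le {n : ℕ} (hn : 1 ≤ n) {a b α ε : ℝ} (hb : -1 < b) (hε : 0 ≤ ε)
    (h1 : -a - 1 - (p : ℝ) / 2 + α + ε < 0)
    (h2 : 0 < -a - 1 - (p : ℝ) / 2 + α + (gammaShape p n - 2 * ε))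
    (h3 : 3 * ε ≤ gammaShape p n) :
    ∃ C : ℝ, 0 ≤ C ∧ ∀ (x : EuclideanSpace ℝ (Fin p)) (s : ℝ), 0 < s →
      ∫⁻ z, ENNReal.ofReal (marginalWeight n a b x s z.1 z.2 * (1 + z.2) ^ α
        * Real.exp (ε * (|Real.log ((1 + z.2) / (1 + ‖x‖ ^ 2 / s))| + |Real.log (z.1 * s)|)))
          ∂quadrant
        ≤ ENNReal.ofReal (C * (s ^ (-((p : ℝ) / 2) - 2)
          * (1 + ‖x‖ ^ 2 / s) ^ (-a - 1 - (p : ℝ) / 2 + α))) := by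
  have hκ : ε < gammaShape p n := by
    rcases hε.eq_or_lt with h | h
    · rw [← h]; unfold gammaShape; positivity
    · linarith
  obtain ⟨C₁, hC₁, H₁⟩ := lintegral_gamma_exp_log_le hε hκ
  obtain ⟨C₂, hC₂, H₂⟩ := lintegral_hyperPrior_damped_le (a := a) (b := b)
    (κ := gammaShape p n - 2 * ε) (β := -((p : ℝ) / 2) + α) hb h1 hε h2 (by ring)
  have hc := marginalConst_pos p hn
  refine ⟨marginalConst p n * C₁ * C₂, by positivity, fun x s hs => ?_⟩
  set q := 1 + ‖x‖ ^ 2 / s with hq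
  have hq1 : 1 ≤ q := by
    have : 0 ≤ ‖x‖ ^ 2 / s := by positivity
    linarith
  unfold quadrant
  rw [lintegral_prod_symm]
  swap
  · have := Measurable.marginalWeight (p := p) n a b (α := ℝ × ℝ) (x := fun _ => x)
      (s := fun _ => s) measurable_const measurable_const measurable_fst measurable_snd
    exact (by fun_prop : Measurable _).aemeasurable
  have inner : ∀ g ∈ Ioi (0 : ℝ), ∫⁻ η in Ioi (0 : ℝ), ENNReal.ofReal
      (marginalWeight n a b x s η g * (1 + g) ^ α
        * Real.exp (ε * (|Real.log ((1 + g) / q)| + |Real.log (η * s)|)))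
      ≤ ENNReal.ofReal (marginalConst p n * s ^ ((n : ℝ) / 2 - 1) * C₁ * s ^ (-gammaShape p n))
        * ENNReal.ofReal (hyperPrior a b g * (1 + g) ^ (-((p : ℝ) / 2) + α)
          * min (((1 + g) / q) ^ ε) (((1 + g) / q) ^ (gammaShape p n - 2 * ε))) := by
    intro g hg
    have hg0 : 0 < g := hg
    have hπ := hyperPrior_nonneg a b hg0.le
    set v := 1 + ‖x‖ ^ 2 / s / (1 + g) with hv
    have hv1 : 1 ≤ v := by
      have : 0 ≤ ‖x‖ ^ 2 / s / (1 + g) := by positivity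
      linarith
    have hvt : 1 / ((1 + g) / q) ≤ v := by
      rw [one_div_div, hv, hq, add_div]
      gcongr
      rw [div_le_one (by linarith)]; linarith
    set A := marginalConst p n * s ^ ((n : ℝ) / 2 - 1) * (hyperPrior a b g
      * (1 + g) ^ (-((p : ℝ) / 2))) * (1 + g) ^ α * Real.exp (ε * |Real.log ((1 + g) / q)|) with hA
    have hA0 : 0 ≤ A := by positivity
    have e1 : ∀ η ∈ Ioi (0 : ℝ), ENNReal.ofReal (marginalWeight n a b x s η g * (1 + g) ^ α
        * Real.exp (ε * (|Real.log ((1 + g) / q)| + |Real.log (η * s)|)))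
        = ENNReal.ofReal A * ENNReal.ofReal (η ^ (gammaShape p n - 1)
          * Real.exp (-(s * v / 2 * η)) * Real.exp (ε * |Real.log (η * s)|)) := by
      intro η hη
      rw [← ENNReal.ofReal_mul hA0, marginalWeight_eq n a b x hs hη hg0,
        mul_add ε |Real.log ((1 + g) / q)|, Real.exp_add]
      congr 1; rw [hA, hv]; ring
    rw [setLIntegral_congr_fun measurableSet_Ioi e1,
      lintegral_const_mul' _ _ ENNReal.ofReal_ne_top]
    refine (mul_le_mul_right (H₁ s v hs hv1) _).trans ?_
    rw [← ENNReal.ofReal_mul hA0, ← ENNReal.ofReal_mul (by positivity)]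
    refine ENNReal.ofReal_le_ofReal ?_
    have hmin := exp_abs_log_mul_rpow_le_min (κ := gammaShape p n) hε h3
      (show 0 < (1 + g) / q by positivity) hv1 hvt
    calc A * (C₁ * (s ^ (-gammaShape p n) * v ^ (-(gammaShape p n - ε))))
        = marginalConst p n * s ^ ((n : ℝ) / 2 - 1) * C₁ * s ^ (-gammaShape p n)
          * (hyperPrior a b g * ((1 + g) ^ (-((p : ℝ) / 2)) * (1 + g) ^ α)
          * (Real.exp (ε * |Real.log ((1 + g) / q)|) * v ^ (-(gammaShape p n - ε)))) := by
            rw [hA]; ring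
      _ ≤ _ := by
          rw [← Real.rpow_add (by linarith)]
          gcongr
  refine (setLIntegral_mono' measurableSet_Ioi inner).trans ?_
  rw [lintegral_const_mul' _ _ ENNReal.ofReal_ne_top]
  refine (mul_le_mul_right (H₂ q hq1) _).trans (le_of_eq ?_)
  rw [← ENNReal.ofReal_mul (by positivity)]
  congr 1
  have e2 : s ^ (-((p : ℝ) / 2) - 2) = s ^ ((n : ℝ) / 2 - 1) * s ^ (-gammaShape p n) := by
    rw [← Real.rpow_add hs]; unfold gammaShape; congr 1; ring
  rw [e2]; ring

theorem le_lintegral_marginalWeight {n : ℕ} (hn : 1 ≤ n) {a b : ℝ}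
    (h1 : -a - 1 - (p : ℝ) / 2 < 0) :
    ∃ c : ℝ, 0 < c ∧ ∀ (x : EuclideanSpace ℝ (Fin p)) (s : ℝ), 0 < s →
      ENNReal.ofReal (c * (s ^ (-((p : ℝ) / 2) - 2)
          * (1 + ‖x‖ ^ 2 / s) ^ (-a - 1 - (p : ℝ) / 2)))
        ≤ ∫⁻ z, ENNReal.ofReal (marginalWeight n a b x s z.1 z.2) ∂quadrant := by
  have hκ : 0 < gammaShape p n := by unfold gammaShape; positivity
  have hΓ := Real.Gamma_pos_of_pos hκ
  have hc := marginalConst_pos p hn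
  refine ⟨marginalConst p n * 2 ^ (-|b|) * 3 ^ (-a - 1 - (p : ℝ) / 2 - 1)
    * Real.Gamma (gammaShape p n), by positivity, fun x s hs => ?_⟩
  set q := 1 + ‖x‖ ^ 2 / s with hq
  have hx : 0 ≤ ‖x‖ ^ 2 / s := by positivity
  have hq1 : 1 ≤ q := by linarith
  have hq0 : 0 < q := by linarith
  set K := marginalConst p n * s ^ ((n : ℝ) / 2 - 1)
    * (2 ^ (-|b|) * (3 * q) ^ (-a - 1 - (p : ℝ) / 2 - 1))
    * (s ^ (-gammaShape p n) * Real.Gamma (gammaShape p n)) with hK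
  unfold quadrant
  rw [lintegral_prod_symm]
  swap
  · exact (Measurable.marginalWeight (p := p) n a b (α := ℝ × ℝ) (x := fun _ => x)
      (s := fun _ => s) measurable_const measurable_const measurable_fst
      measurable_snd).ennreal_ofReal.aemeasurable
  have inner : ∀ g ∈ Ioc q (2 * q), ENNReal.ofReal K ≤
      ∫⁻ η in Ioi (0 : ℝ), ENNReal.ofReal (marginalWeight n a b x s η g) := by
    intro g hg
    have hg1 : 1 ≤ g := hq1.trans hg.1.le
    have hg0 : 0 < g := by linarith
    have hπ := hyperPrior_nonneg a b hg0.le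
    set v := 1 + ‖x‖ ^ 2 / s / (1 + g) with hv
    have hv0 : 0 < v := by positivity
    have hv2 : v ≤ 2 := by
      have : ‖x‖ ^ 2 / s / (1 + g) ≤ 1 := by
        rw [div_le_one (by linarith)]; linarith [hg.1]
      linarith
    have e1 : ∀ η ∈ Ioi (0 : ℝ), ENNReal.ofReal (marginalWeight n a b x s η g)
        = ENNReal.ofReal (marginalConst p n * s ^ ((n : ℝ) / 2 - 1)
          * (hyperPrior a b g * (1 + g) ^ (-((p : ℝ) / 2))))
          * ENNReal.ofReal (η ^ (gammaShape p n - 1) * Real.exp (-(s * v / 2 * η))) := by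
      intro η hη
      rw [← ENNReal.ofReal_mul (by positivity), marginalWeight_eq n a b x hs hη hg0]
    rw [setLIntegral_congr_fun measurableSet_Ioi e1,
      lintegral_const_mul' _ _ ENNReal.ofReal_ne_top,
      lintegral_rpow_mul_exp hκ (by positivity), ← ENNReal.ofReal_mul (by positivity)]
    refine ENNReal.ofReal_le_ofReal ?_
    have l1 : s ^ (-gammaShape p n) ≤ (1 / (s * v / 2)) ^ gammaShape p n := by
      rw [Real.rpow_neg hs.le, ← Real.inv_rpow hs.le]
      refine Real.rpow_le_rpow (by positivity) ?_ hκ.le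
      rw [← one_div]
      refine one_div_le_one_div_of_le (by positivity) ?_
      nlinarith
    have l2 : 2 ^ (-|b|) * (3 * q) ^ (-a - 1 - (p : ℝ) / 2 - 1)
        ≤ hyperPrior a b g * (1 + g) ^ (-((p : ℝ) / 2)) := by
      calc 2 ^ (-|b|) * (3 * q) ^ (-a - 1 - (p : ℝ) / 2 - 1)
          ≤ 2 ^ (-|b|) * (1 + g) ^ (-a - 1 - (p : ℝ) / 2 - 1) := by
            refine mul_le_mul_of_nonneg_left ?_ (by positivity)
            exact Real.rpow_le_rpow_of_nonpos (by linarith) (by linarith [hg.2]) (by linarith)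
        _ = 2 ^ (-|b|) * (1 + g) ^ (-a - 2) * (1 + g) ^ (-((p : ℝ) / 2)) := by
            rw [mul_assoc, ← Real.rpow_add (by linarith)]; congr 2; ring
        _ ≤ _ := by gcongr; exact le_hyperPrior a b hg1
    rw [hK]
    gcongr
  have l3 : ENNReal.ofReal K * ENNReal.ofReal q = ∫⁻ _ in Ioc q (2 * q), ENNReal.ofReal K := by
    rw [setLIntegral_const, Real.volume_Ioc]; congr 2; ring
  have l4 : ENNReal.ofReal (marginalConst p n * 2 ^ (-|b|) * 3 ^ (-a - 1 - (p : ℝ) / 2 - 1)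
      * Real.Gamma (gammaShape p n) * (s ^ (-((p : ℝ) / 2) - 2) * q ^ (-a - 1 - (p : ℝ) / 2)))
      = ENNReal.ofReal K * ENNReal.ofReal q := by
    rw [← ENNReal.ofReal_mul (by positivity)]
    congr 1
    have e2 : s ^ (-((p : ℝ) / 2) - 2) = s ^ ((n : ℝ) / 2 - 1) * s ^ (-gammaShape p n) := by
      rw [← Real.rpow_add hs]; unfold gammaShape; congr 1; ring
    have e3 : q ^ (-a - 1 - (p : ℝ) / 2) = q ^ (-a - 1 - (p : ℝ) / 2 - 1) * q := by
      rw [← Real.rpow_add_one hq0.ne']; congr 1; ring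
    rw [hK, e2, e3, Real.mul_rpow (by norm_num) hq0.le]; ring
  rw [l4, l3]
  refine (setLIntegral_mono' measurableSet_Ioc inner).trans ?_
  exact lintegral_mono_set fun y hy => hq0.trans hy.1

/-! ### Finite Dirichlet energy of the iterated logarithm -/

theorem tendsto_neg_inv_one_add_log :
    Filter.Tendsto (fun t : ℝ => -(1 + Real.log (1 + t))⁻¹) Filter.atTop (nhds 0) := by
  rw [← neg_zero]
  refine (Filter.Tendsto.inv_tendsto_atTop ?_).neg
  exact Filter.tendsto_atTop_add_const_left _ _ (Real.tendsto_log_atTop.comp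
    (Filter.tendsto_atTop_add_const_left _ _ Filter.tendsto_id))

theorem integrable_inv_mul_log_sq_abs :
    Integrable fun t : ℝ => ((1 + |t|) * (1 + Real.log (1 + |t|)) ^ 2)⁻¹ := by
  have hd : ∀ t ∈ Ici (0 : ℝ), HasDerivAt (fun t : ℝ => -(1 + Real.log (1 + t))⁻¹)
      (((1 + t) * (1 + Real.log (1 + t)) ^ 2)⁻¹) t := by
    intro t ht
    have ht : 0 ≤ t := ht
    have h1 : 0 ≤ Real.log (1 + t) := Real.log_nonneg (by linarith)
    have := ((((hasDerivAt_id t).const_add 1).log (by simp; linarith)).const_add 1).inv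
      (by simp; linarith) |>.neg
    refine this.congr_deriv ?_
    simp only [id]
    field_simp
  have hv := integral_Ioi_of_hasDerivAt_of_nonneg' hd (fun t ht => by
    have ht : 0 < t := ht
    have h1 : 0 ≤ Real.log (1 + t) := Real.log_nonneg (by linarith)
    positivity) tendsto_neg_inv_one_add_log
  have := integral_comp_abs (f := fun t : ℝ => ((1 + t) * (1 + Real.log (1 + t)) ^ 2)⁻¹)
  rw [hv] at this
  by_contra h
  rw [integral_undef h] at this
  norm_num at this

theorem lintegral_inv_mul_log_sq_lt_top :
    ∫⁻ s in Ioi (0 : ℝ), ENNReal.ofReal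
      (s⁻¹ * ((1 + |Real.log s|) * (1 + Real.log (1 + |Real.log s|)) ^ 2)⁻¹) < ⊤ := by
  have h := (integrableOn_image_iff_integrableOn_abs_deriv_smul (s := univ) (f := Real.exp)
    (f' := Real.exp) MeasurableSet.univ (fun x _ => (Real.hasDerivAt_exp x).hasDerivWithinAt)
    Real.exp_injective.injOn
    (fun s => s⁻¹ * ((1 + |Real.log s|) * (1 + Real.log (1 + |Real.log s|)) ^ 2)⁻¹)).2 (by
      rw [integrableOn_univ]
      refine integrable_inv_mul_log_sq_abs.congr (.of_forall fun t => ?_)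
      simp only [Real.abs_exp, Real.log_exp, smul_eq_mul]
      rw [mul_inv_cancel_left₀ (Real.exp_pos t).ne'])
  rw [image_univ, Real.range_exp] at h
  refine lt_of_le_of_lt (lintegral_mono fun s => ?_) h.2
  exact Real.ofReal_le_enorm _

/-- For fixed `s`, the inner integrand is the derivative of `-1 / (2 * logRadius)`. -/
theorem integral_deriv_inv_logRadius {s : ℝ} (hs : 0 < s) :
    IntegrableOn (fun r : ℝ => r / (s + r ^ 2) * (logRadius (1 / s) (r ^ 2 / s) ^ 2)⁻¹) (Ioi 0) ∧
    ∫ r in Ioi (0 : ℝ), r / (s + r ^ 2) * (logRadius (1 / s) (r ^ 2 / s) ^ 2)⁻¹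
      = (2 * (1 + |Real.log s|))⁻¹ := by
  have habs : |Real.log (1 / s)| = |Real.log s| := by rw [one_div, Real.log_inv, abs_neg]
  have hd : ∀ r ∈ Ici (0 : ℝ), HasDerivAt (fun r : ℝ => -(2 * logRadius (1 / s) (r ^ 2 / s))⁻¹)
      (r / (s + r ^ 2) * (logRadius (1 / s) (r ^ 2 / s) ^ 2)⁻¹) r := by
    intro r hr
    have h0 : 0 ≤ r ^ 2 / s := by positivity
    have h1 := one_le_logRadius (η := 1 / s) h0
    have h3 : HasDerivAt (fun r : ℝ => logRadius (1 / s) (r ^ 2 / s))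
        (2 * r / s / (1 + r ^ 2 / s)) r := by
      unfold logRadius
      have := (((((hasDerivAt_pow 2 r).div_const s).const_add 1).log (by positivity)).const_add
        1).add_const |Real.log (1 / s)|
      refine this.congr_deriv (by norm_num)
    refine ((h3.const_mul 2).inv (by positivity)).neg.congr_deriv ?_
    have : 0 < logRadius (1 / s) (r ^ 2 / s) := by linarith
    field_simp
  have hpos : ∀ r ∈ Ioi (0 : ℝ),
      0 ≤ r / (s + r ^ 2) * (logRadius (1 / s) (r ^ 2 / s) ^ 2)⁻¹ := fun r hr => by
    have : 0 < r := hr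
    positivity
  have ht : Filter.Tendsto (fun r : ℝ => -(2 * logRadius (1 / s) (r ^ 2 / s))⁻¹) Filter.atTop
      (nhds 0) := by
    rw [← neg_zero]
    refine (Filter.Tendsto.inv_tendsto_atTop ?_).neg
    refine Filter.Tendsto.const_mul_atTop two_pos ?_
    unfold logRadius
    refine Filter.tendsto_atTop_add_const_right _ _ (Filter.tendsto_atTop_add_const_left _ _
      (Real.tendsto_log_atTop.comp (Filter.tendsto_atTop_add_const_left _ _ ?_)))
    exact (Filter.tendsto_pow_atTop two_ne_zero).atTop_div_const hs
  refine ⟨integrableOn_Ioi_deriv_of_nonneg' hd hpos ht, ?_⟩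
  rw [integral_Ioi_of_hasDerivAt_of_nonneg' hd hpos ht]
  unfold logRadius
  rw [habs]
  simp

/-- The Dirichlet energy of `iterLog` is finite: in polar coordinates for `x`, both integrations
reduce to integrals of explicit derivatives. -/
theorem lintegral_energy_lt_top (hp : 1 ≤ p) :
    ∫⁻ x : EuclideanSpace ℝ (Fin p), ∫⁻ s in Ioi (0 : ℝ), ENNReal.ofReal
      (‖x‖ ^ 2 * (s ^ (-((p : ℝ) / 2) - 2) * (1 + ‖x‖ ^ 2 / s) ^ (-1 - (p : ℝ) / 2))
        * ((logRadius (1 / s) (‖x‖ ^ 2 / s)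
          * (1 + Real.log (logRadius (1 / s) (‖x‖ ^ 2 / s)))) ^ 2)⁻¹) < ⊤ := by
  have : NeZero p := ⟨by omega⟩
  rw [lintegral_lintegral_swap (by unfold Function.uncurry logRadius; fun_prop)]
  set V : ℝ := p * volume.real (Metric.ball (0 : EuclideanSpace ℝ (Fin p)) 1) with hV
  have hV0 : 0 ≤ V := by positivity
  have key : ∀ s ∈ Ioi (0 : ℝ), ∫⁻ x : EuclideanSpace ℝ (Fin p), ENNReal.ofReal
      (‖x‖ ^ 2 * (s ^ (-((p : ℝ) / 2) - 2) * (1 + ‖x‖ ^ 2 / s) ^ (-1 - (p : ℝ) / 2))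
        * ((logRadius (1 / s) (‖x‖ ^ 2 / s)
          * (1 + Real.log (logRadius (1 / s) (‖x‖ ^ 2 / s)))) ^ 2)⁻¹)
      ≤ ENNReal.ofReal V * ENNReal.ofReal
        (s⁻¹ * ((1 + |Real.log s|) * (1 + Real.log (1 + |Real.log s|)) ^ 2)⁻¹) := by
    intro s hs
    have hs : 0 < s := hs
    set f : ℝ → ℝ := fun r => r ^ 2 * (s ^ (-((p : ℝ) / 2) - 2)
      * (1 + r ^ 2 / s) ^ (-1 - (p : ℝ) / 2)) * ((logRadius (1 / s) (r ^ 2 / s)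
          * (1 + Real.log (logRadius (1 / s) (r ^ 2 / s)))) ^ 2)⁻¹ with hf
    have hf0 : ∀ r, 0 ≤ f r := fun r => by positivity
    have hfm : Measurable f := by rw [hf]; unfold logRadius; fun_prop
    set L := 1 + Real.log (1 + |Real.log s|) with hL
    have hL1 : 1 ≤ L := by
      have := Real.log_nonneg (show 1 ≤ 1 + |Real.log s| by
        have := abs_nonneg (Real.log s); linarith)
      linarith
    have habs : |Real.log (1 / s)| = |Real.log s| := by rw [one_div, Real.log_inv, abs_neg]
    have bound : ∀ r ∈ Ioi (0 : ℝ), r ^ (p - 1) * f r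
        ≤ (s * L ^ 2)⁻¹ * (r / (s + r ^ 2) * (logRadius (1 / s) (r ^ 2 / s) ^ 2)⁻¹) := by
      intro r hr
      have hr : 0 < r := hr
      have h0 : 0 ≤ r ^ 2 / s := by positivity
      have h1 := one_le_logRadius (η := 1 / s) h0
      set ρ := logRadius (1 / s) (r ^ 2 / s) with hρ
      have hρ0 : 0 < ρ := by linarith
      have h2 : 1 + |Real.log s| ≤ ρ := by
        have := Real.log_nonneg (show 1 ≤ 1 + r ^ 2 / s by linarith)
        rw [hρ]; unfold logRadius; rw [habs]; linarith
      have h3 : L ≤ 1 + Real.log ρ := by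
        have := abs_nonneg (Real.log s)
        have := Real.log_le_log (by linarith) h2
        linarith
      have hs2 : 0 < s + r ^ 2 := by positivity
      have e1 : s ^ (-((p : ℝ) / 2) - 2) * (1 + r ^ 2 / s) ^ (-1 - (p : ℝ) / 2)
          = s⁻¹ * ((s + r ^ 2)⁻¹ * (s + r ^ 2) ^ (-((p : ℝ) / 2))) := by
        rw [show 1 + r ^ 2 / s = (s + r ^ 2) / s by field_simp, Real.div_rpow hs2.le hs.le,
          show -((p : ℝ) / 2) - 2 = (-1 - (p : ℝ) / 2) + -1 by ring, Real.rpow_add hs,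
          Real.rpow_neg_one, sub_eq_add_neg (-1 : ℝ), Real.rpow_add hs2, Real.rpow_neg_one]
        field_simp
      have e2 : r ^ (p - 1) * r ^ 2 = r * r ^ p := by
        rw [← pow_add, ← pow_succ']; congr 1; omega
      have e3 : r ^ p * (s + r ^ 2) ^ (-((p : ℝ) / 2)) ≤ 1 := by
        rw [Real.rpow_neg hs2.le, ← div_eq_mul_inv, div_le_one (by positivity),
          show r ^ p = (r ^ 2) ^ ((p : ℝ) / 2) by
            rw [← Real.rpow_natCast r 2, ← Real.rpow_mul hr.le, Nat.cast_ofNat,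
              mul_div_cancel₀ _ (two_ne_zero), Real.rpow_natCast]]
        exact Real.rpow_le_rpow (by positivity) (by linarith) (by positivity)
      calc r ^ (p - 1) * f r = (r ^ (p - 1) * r ^ 2) * (s ^ (-((p : ℝ) / 2) - 2)
              * (1 + r ^ 2 / s) ^ (-1 - (p : ℝ) / 2)) * ((ρ * (1 + Real.log ρ)) ^ 2)⁻¹ := by
            rw [hf]; ring
        _ = (r ^ p * (s + r ^ 2) ^ (-((p : ℝ) / 2))) * (r * (s⁻¹ * (s + r ^ 2)⁻¹))
              * ((ρ * (1 + Real.log ρ)) ^ 2)⁻¹ := by rw [e1, e2]; ring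
        _ ≤ 1 * (r * (s⁻¹ * (s + r ^ 2)⁻¹)) * ((ρ * L) ^ 2)⁻¹ := by gcongr
        _ = _ := by field_simp
    obtain ⟨hi, hv⟩ := integral_deriv_inv_logRadius hs
    have hint : IntegrableOn (fun r : ℝ => r ^ (p - 1) * f r) (Ioi 0) := by
      refine (hi.const_mul (s * L ^ 2)⁻¹).mono' (by fun_prop) ?_
      filter_upwards [ae_restrict_mem measurableSet_Ioi] with r hr
      have : 0 < r := hr
      rw [Real.norm_of_nonneg (mul_nonneg (by positivity) (hf0 r))]
      exact bound r hr
    have hint' : Integrable (fun x : EuclideanSpace ℝ (Fin p) => f ‖x‖) := by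
      rw [integrable_fun_norm_addHaar]
      simpa using hint
    change ∫⁻ x : EuclideanSpace ℝ (Fin p), ENNReal.ofReal (f ‖x‖) ≤ _
    rw [← ofReal_integral_eq_lintegral_ofReal hint' (.of_forall fun x => hf0 _),
      integral_fun_norm_addHaar, ← ENNReal.ofReal_mul hV0]
    refine ENNReal.ofReal_le_ofReal ?_
    simp only [finrank_euclideanSpace, Fintype.card_fin, smul_eq_mul, nsmul_eq_mul]
    rw [← mul_assoc, ← hV]
    refine mul_le_mul_of_nonneg_left ?_ hV0
    refine (setIntegral_mono_on hint (hi.const_mul _) measurableSet_Ioi bound).trans ?_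
    rw [integral_const_mul, hv, mul_inv, mul_inv, mul_inv]
    have : 0 ≤ s⁻¹ * ((1 + |Real.log s|)⁻¹ * (L ^ 2)⁻¹) := by positivity
    linarith
  refine (setLIntegral_mono' measurableSet_Ioi key).trans_lt ?_
  rw [lintegral_const_mul' _ _ ENNReal.ofReal_ne_top]
  exact ENNReal.mul_lt_top ENNReal.ofReal_lt_top lintegral_inv_mul_log_sq_lt_top

/-! ### The posterior and the generalized Bayes estimator -/

theorem lintegral_hyperPrior_lt_top {a b : ℝ} (hb : -1 < b) (h1 : -a - 1 - (p : ℝ) / 2 < 0) :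
    ∫⁻ g in Ioi (0 : ℝ), ENNReal.ofReal (hyperPrior a b g * (1 + g) ^ (-((p : ℝ) / 2))) < ⊤ := by
  obtain ⟨C, -, H⟩ := lintegral_hyperPrior_damped_le (a := a) (b := b) (ε := 0)
    (e := -a - 1 - (p : ℝ) / 2) (κ := 1 - (-a - 1 - (p : ℝ) / 2)) (β := -((p : ℝ) / 2)) hb
    (by linarith) le_rfl (by linarith) (by ring)
  refine lt_of_le_of_lt (setLIntegral_mono' measurableSet_Ioi fun g hg => ?_)
    ((H 1 le_rfl).trans_lt ENNReal.ofReal_lt_top)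
  have hg : 0 < g := hg
  have hπ := hyperPrior_nonneg a b hg.le
  rw [div_one, Real.rpow_zero, min_eq_left (Real.one_le_rpow (by linarith) (by linarith)), mul_one]

theorem mixtureIntegrand_nonneg (a b : ℝ) (θ : EuclideanSpace ℝ (Fin p)) {η g : ℝ} (hη : 0 ≤ η)
    (hg : 0 ≤ g) : 0 ≤ mixtureIntegrand a b θ η g := by
  have := hyperPrior_nonneg a b hg
  unfold mixtureIntegrand; positivity

theorem Measurable.mixtureIntegrand {α : Type*} [MeasurableSpace α] (a b : ℝ)
    {θ : α → EuclideanSpace ℝ (Fin p)} {η g : α → ℝ} (hθ : Measurable θ) (hη : Measurable η)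
    (hg : Measurable g) : Measurable fun z => mixtureIntegrand a b (θ z) (η z) (g z) := by
  have := (measurable_hyperPrior a b).comp hg
  unfold _root_.mixtureIntegrand
  exact Measurable.mul (by fun_prop) this

theorem one_add_rpow_mul_exp_bounded {m c : ℝ} (hm : 0 ≤ m) (hc : 0 < c) :
    ∃ C : ℝ, 0 ≤ C ∧ ∀ t : ℝ, 0 ≤ t → (1 + t) ^ m * Real.exp (-(c * t)) ≤ C := by
  set δ := min 1 (c / (m + 1)) with hδ
  have hδ0 : 0 < δ := lt_min one_pos (by positivity)
  have hδ1 : δ ≤ 1 := min_le_left _ _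
  have hδc : m * δ ≤ c := by
    have h := min_le_right 1 (c / (m + 1))
    rw [← hδ, le_div_iff₀ (by linarith)] at h
    nlinarith
  refine ⟨(1 / δ) ^ m, by positivity, fun t ht => ?_⟩
  have h1 : 1 + t ≤ 1 / δ * Real.exp (δ * t) := by
    have := Real.add_one_le_exp (δ * t)
    rw [div_mul_eq_mul_div, one_mul, le_div_iff₀ hδ0]
    nlinarith
  calc (1 + t) ^ m * Real.exp (-(c * t))
      ≤ (1 / δ * Real.exp (δ * t)) ^ m * Real.exp (-(c * t)) := by gcongr
    _ = (1 / δ) ^ m * Real.exp (δ * t * m + -(c * t)) := by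
        rw [Real.mul_rpow (by positivity) (by positivity), ← Real.exp_mul, mul_assoc, Real.exp_add]
    _ ≤ (1 / δ) ^ m * 1 := by
        gcongr
        rw [Real.exp_le_one_iff]
        nlinarith
    _ = _ := mul_one _

theorem integrableOn_mixtureIntegrand {a b : ℝ} (hb : -1 < b) (h1 : -a - 1 - (p : ℝ) / 2 < 0)
    {θ : EuclideanSpace ℝ (Fin p)} (hθ : θ ≠ 0) {η : ℝ} (hη : 0 < η) :
    IntegrableOn (mixtureIntegrand a b θ η) (Ioi 0) := by
  have hθ0 : 0 < ‖θ‖ := norm_pos_iff.2 hθ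
  obtain ⟨C, hC, H⟩ := one_add_rpow_mul_exp_bounded (m := (p : ℝ) / 2) (c := η / 2 * ‖θ‖ ^ 2)
    (by positivity) (by positivity)
  set K := η ^ ((p : ℝ) / 2) / (2 * Real.pi) ^ ((p : ℝ) / 2) with hK
  have hm : Measurable (mixtureIntegrand a b θ η) :=
    Measurable.mixtureIntegrand a b measurable_const measurable_const measurable_id
  refine ⟨hm.aestronglyMeasurable, ?_⟩
  rw [hasFiniteIntegral_iff_ofReal]
  swap
  · filter_upwards [ae_restrict_mem measurableSet_Ioi] with g hg
    exact mixtureIntegrand_nonneg a b θ hη.le (le_of_lt hg)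
  have hle : ∀ g ∈ Ioi (0 : ℝ), ENNReal.ofReal (mixtureIntegrand a b θ η g)
      ≤ ENNReal.ofReal (K * C)
        * ENNReal.ofReal (hyperPrior a b g * (1 + g) ^ (-((p : ℝ) / 2))) := by
    intro g hg
    have hg : 0 < g := hg
    have hπ := hyperPrior_nonneg a b hg.le
    rw [← ENNReal.ofReal_mul (by positivity)]
    refine ENNReal.ofReal_le_ofReal ?_
    have h2 := H (1 / g) (by positivity)
    rw [show 1 + 1 / g = (1 + g) / g by field_simp; ring, Real.div_rpow (by linarith) hg.le,
      show η / 2 * ‖θ‖ ^ 2 * (1 / g) = η / (2 * g) * ‖θ‖ ^ 2 by field_simp] at h2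
    have hg1 : 0 < (1 + g) ^ ((p : ℝ) / 2) := by positivity
    calc mixtureIntegrand a b θ η g
        = K * ((1 + g) ^ ((p : ℝ) / 2) / g ^ ((p : ℝ) / 2)
          * Real.exp (-(η / (2 * g) * ‖θ‖ ^ 2)))
          * (hyperPrior a b g * (1 + g) ^ (-((p : ℝ) / 2))) := by
          rw [Real.rpow_neg (by linarith)]
          unfold mixtureIntegrand
          rw [hK]; field_simp
      _ ≤ K * C * (hyperPrior a b g * (1 + g) ^ (-((p : ℝ) / 2))) := by gcongr
  refine (setLIntegral_mono' measurableSet_Ioi hle).trans_lt ?_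
  rw [lintegral_const_mul' _ _ ENNReal.ofReal_ne_top]
  exact ENNReal.mul_lt_top ENNReal.ofReal_lt_top (lintegral_hyperPrior_lt_top hb h1)

theorem lintegral_marginalWeight_mul_rpow_lt_top {n : ℕ} (hn : 1 ≤ n) {a b : ℝ} (hb : -1 < b)
    (h1 : -a - 1 - (p : ℝ) / 2 < 0) {β : ℝ} (hβ : 0 < gammaShape p n - β)
    (x : EuclideanSpace ℝ (Fin p)) {s : ℝ} (hs : 0 < s) :
    ∫⁻ z, ENNReal.ofReal (marginalWeight n a b x s z.1 z.2 * z.1 ^ (-β)) ∂quadrant < ⊤ := by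
  have hc := marginalConst_pos p hn
  have hΓ := Real.Gamma_pos_of_pos hβ
  unfold quadrant
  rw [lintegral_prod_symm]
  swap
  · have := Measurable.marginalWeight (p := p) n a b (α := ℝ × ℝ) (x := fun _ => x)
      (s := fun _ => s) measurable_const measurable_const measurable_fst measurable_snd
    exact (by fun_prop : Measurable _).aemeasurable
  set K := marginalConst p n * s ^ ((n : ℝ) / 2 - 1)
    * ((1 / (s / 2)) ^ (gammaShape p n - β) * Real.Gamma (gammaShape p n - β)) with hK
  have hle : ∀ g ∈ Ioi (0 : ℝ), ∫⁻ η in Ioi (0 : ℝ),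
      ENNReal.ofReal (marginalWeight n a b x s η g * η ^ (-β))
      ≤ ENNReal.ofReal K * ENNReal.ofReal (hyperPrior a b g * (1 + g) ^ (-((p : ℝ) / 2))) := by
    intro g hg
    have hg : 0 < g := hg
    have hπ := hyperPrior_nonneg a b hg.le
    set v := 1 + ‖x‖ ^ 2 / s / (1 + g) with hv
    have hv1 : 1 ≤ v := by
      have : 0 ≤ ‖x‖ ^ 2 / s / (1 + g) := by positivity
      linarith
    have hv0 : 0 < v := by linarith
    have e1 : ∀ η ∈ Ioi (0 : ℝ), ENNReal.ofReal (marginalWeight n a b x s η g * η ^ (-β))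
        = ENNReal.ofReal (marginalConst p n * s ^ ((n : ℝ) / 2 - 1)
          * (hyperPrior a b g * (1 + g) ^ (-((p : ℝ) / 2))))
          * ENNReal.ofReal (η ^ (gammaShape p n - β - 1) * Real.exp (-(s * v / 2 * η))) := by
      intro η hη
      have hη : 0 < η := hη
      rw [← ENNReal.ofReal_mul (by positivity), marginalWeight_eq n a b x hs hη hg,
        show gammaShape p n - β - 1 = (gammaShape p n - 1) + -β by ring, Real.rpow_add hη]
      congr 1; ring
    rw [setLIntegral_congr_fun measurableSet_Ioi e1,
      lintegral_const_mul' _ _ ENNReal.ofReal_ne_top,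
      lintegral_rpow_mul_exp hβ (by positivity), ← ENNReal.ofReal_mul (by positivity),
      ← ENNReal.ofReal_mul (by positivity)]
    refine ENNReal.ofReal_le_ofReal ?_
    have l1 : (1 / (s * v / 2)) ^ (gammaShape p n - β) ≤ (1 / (s / 2)) ^ (gammaShape p n - β) := by
      refine Real.rpow_le_rpow (by positivity) ?_ hβ.le
      refine one_div_le_one_div_of_le (by positivity) ?_
      nlinarith
    calc _ ≤ marginalConst p n * s ^ ((n : ℝ) / 2 - 1)
          * (hyperPrior a b g * (1 + g) ^ (-((p : ℝ) / 2)))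
          * ((1 / (s / 2)) ^ (gammaShape p n - β) * Real.Gamma (gammaShape p n - β)) := by gcongr
      _ = _ := by rw [hK]; ring
  refine (setLIntegral_mono' measurableSet_Ioi hle).trans_lt ?_
  rw [lintegral_const_mul' _ _ ENNReal.ofReal_ne_top]
  exact ENNReal.mul_lt_top ENNReal.ofReal_lt_top (lintegral_hyperPrior_lt_top hb h1)

/-- The unnormalized posterior of `(η, g)` at the observation `(x, s)`, weighted by the factor `η`
of the loss, which cancels the factor `1 / η` of the prior. -/
noncomputable def posterior (n : ℕ) (a b : ℝ) (x : EuclideanSpace ℝ (Fin p)) (s : ℝ) :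
    Measure (ℝ × ℝ) :=
  quadrant.withDensity fun z => ENNReal.ofReal (marginalWeight n a b x s z.1 z.2)

theorem measurable_marginalWeight_right (n : ℕ) (a b : ℝ) (x : EuclideanSpace ℝ (Fin p)) (s : ℝ) :
    Measurable fun z : ℝ × ℝ => marginalWeight n a b x s z.1 z.2 :=
  Measurable.marginalWeight n a b measurable_const measurable_const measurable_fst measurable_snd

theorem ae_posterior (n : ℕ) (a b : ℝ) (x : EuclideanSpace ℝ (Fin p)) (s : ℝ) :
    ∀ᵐ z ∂posterior n a b x s, 0 < z.1 ∧ 0 < z.2 :=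
  (withDensity_absolutelyContinuous _ _).ae_le ae_quadrant

theorem lintegral_posterior (n : ℕ) (a b : ℝ) (x : EuclideanSpace ℝ (Fin p)) (s : ℝ)
    {f : ℝ × ℝ → ENNReal} (hf : Measurable f) :
    ∫⁻ z, f z ∂posterior n a b x s
      = ∫⁻ z, ENNReal.ofReal (marginalWeight n a b x s z.1 z.2) * f z ∂quadrant :=
  lintegral_withDensity_eq_lintegral_mul _
    (measurable_marginalWeight_right n a b x s).ennreal_ofReal hf

theorem integral_posterior (n : ℕ) (a b : ℝ) (x : EuclideanSpace ℝ (Fin p)) {s : ℝ} (hs : 0 < s)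
    (f : ℝ × ℝ → ℝ) :
    ∫ z, f z ∂posterior n a b x s = ∫ z, marginalWeight n a b x s z.1 z.2 * f z ∂quadrant := by
  unfold posterior
  rw [integral_withDensity_eq_integral_toReal_smul
    (measurable_marginalWeight_right n a b x s).ennreal_ofReal
    (.of_forall fun _ => ENNReal.ofReal_lt_top)]
  refine integral_congr_ae ?_
  filter_upwards [ae_quadrant] with z hz
  rw [ENNReal.toReal_ofReal (marginalWeight_nonneg n a b x hs.le hz.1.le hz.2.le), smul_eq_mul]

theorem isFiniteMeasure_posterior {n : ℕ} (hn : 1 ≤ n) {a b : ℝ} (hb : -1 < b)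
    (h1 : -a - 1 - (p : ℝ) / 2 < 0) (x : EuclideanSpace ℝ (Fin p)) {s : ℝ} (hs : 0 < s) :
    IsFiniteMeasure (posterior n a b x s) := by
  refine isFiniteMeasure_withDensity ?_
  have := lintegral_marginalWeight_mul_rpow_lt_top hn hb h1 (β := 0)
    (by unfold gammaShape; rw [sub_zero]; positivity) x hs
  simpa using this.ne

theorem posterior_real_pos {n : ℕ} (hn : 1 ≤ n) {a b : ℝ} (hb : -1 < b)
    (h1 : -a - 1 - (p : ℝ) / 2 < 0) (x : EuclideanSpace ℝ (Fin p)) {s : ℝ} (hs : 0 < s) :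
    0 < (posterior n a b x s).real univ := by
  have := isFiniteMeasure_posterior hn hb h1 x hs
  obtain ⟨c, hc, H⟩ := le_lintegral_marginalWeight (p := p) hn (b := b) h1
  refine ENNReal.toReal_pos (fun h => ?_) (measure_ne_top _ _)
  have h2 := H x s hs
  unfold posterior at h
  rw [withDensity_apply _ MeasurableSet.univ, Measure.restrict_univ] at h
  rw [h, nonpos_iff_eq_zero, ENNReal.ofReal_eq_zero] at h2
  have : 0 < c * (s ^ (-((p : ℝ) / 2) - 2) * (1 + ‖x‖ ^ 2 / s) ^ (-a - 1 - (p : ℝ) / 2)) := by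
    positivity
  linarith

/-- The joint density of `(x, s, θ)` given `(η, g)`, times the hyperprior. -/
noncomputable def jointWeight (n : ℕ) (a b : ℝ) (x : EuclideanSpace ℝ (Fin p)) (s : ℝ)
    (θ : EuclideanSpace ℝ (Fin p)) (z : ℝ × ℝ) : ℝ :=
  mixtureIntegrand a b θ z.1 z.2 * (normalDensity x θ z.1 * scaleDensity n s z.1)

theorem Measurable.jointWeight {α : Type*} [MeasurableSpace α] (n : ℕ) (a b : ℝ)
    {x θ : α → EuclideanSpace ℝ (Fin p)} {s : α → ℝ} {z : α → ℝ × ℝ} (hx : Measurable x)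
    (hs : Measurable s) (hθ : Measurable θ) (hz : Measurable z) :
    Measurable fun w => jointWeight n a b (x w) (s w) (θ w) (z w) :=
  (Measurable.mixtureIntegrand a b hθ hz.fst hz.snd).mul
    ((hx.normalDensity hθ hz.fst).mul (hs.scaleDensity n hz.fst))

theorem jointWeight_nonneg (n : ℕ) (a b : ℝ) (x : EuclideanSpace ℝ (Fin p)) {s : ℝ} (hs : 0 ≤ s)
    (θ : EuclideanSpace ℝ (Fin p)) {z : ℝ × ℝ} (hz : 0 < z.1 ∧ 0 < z.2) :
    0 ≤ jointWeight n a b x s θ z :=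
  mul_nonneg (mixtureIntegrand_nonneg a b θ hz.1.le hz.2.le)
    (mul_nonneg (normalDensity_nonneg x θ hz.1.le) (scaleDensity_nonneg n hs hz.1.le))

/-- The factor by which the conditional mean of `θ` given `(x, η, g)` shrinks `x`, subtracted from
one. -/
noncomputable def shrink (z : ℝ × ℝ) : ℝ := 1 / (1 + z.2)

theorem measurable_shrink : Measurable shrink := by unfold shrink; fun_prop

theorem shrink_mem_Icc {z : ℝ × ℝ} (hz : 0 < z.2) : shrink z ∈ Icc (0 : ℝ) 1 := by
  unfold shrink
  exact ⟨by positivity, (div_le_one (by linarith)).2 (by linarith)⟩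

/-- The precision of `θ` given `(x, η, g)`. -/
noncomputable def condPrecision (z : ℝ × ℝ) : ℝ := z.1 * (1 + z.2) / z.2

theorem condPrecision_pos {z : ℝ × ℝ} (hz : 0 < z.1 ∧ 0 < z.2) : 0 < condPrecision z := by
  have := hz.1
  have := hz.2
  unfold condPrecision; positivity

theorem jointWeight_eq (n : ℕ) (a b : ℝ) (x : EuclideanSpace ℝ (Fin p)) (s : ℝ)
    (θ : EuclideanSpace ℝ (Fin p)) {z : ℝ × ℝ} (hz : 0 < z.1 ∧ 0 < z.2) :
    jointWeight n a b x s θ z = marginalWeight n a b x s z.1 z.2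
      * normalDensity θ ((1 - shrink z) • x) (condPrecision z) :=
  mixtureIntegrand_mul_density n a b x θ s hz.1 hz.2

/-- The posterior has a first moment in `θ`. -/
theorem lintegral_jointWeight_mul_lt_top {n : ℕ} (hn : 1 ≤ n) {a b : ℝ} (hb : -1 < b)
    (h1 : -a - 1 - (p : ℝ) / 2 < 0) (x : EuclideanSpace ℝ (Fin p)) {s : ℝ} (hs : 0 < s) :
    ∫⁻ w, ENNReal.ofReal (jointWeight n a b x s w.1 w.2 * (1 + ‖w.1‖))
      ∂((volume : Measure (EuclideanSpace ℝ (Fin p))).prod quadrant) < ⊤ := by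
  rw [lintegral_prod_symm]
  swap
  · have := Measurable.jointWeight (p := p) n a b (α := EuclideanSpace ℝ (Fin p) × (ℝ × ℝ))
      (x := fun _ => x) (s := fun _ => s) measurable_const measurable_const measurable_fst
      measurable_snd
    exact (by fun_prop : Measurable _).aemeasurable
  have hle : ∀ᵐ z ∂quadrant,
      ∫⁻ θ, ENNReal.ofReal (jointWeight n a b x s θ z * (1 + ‖θ‖))
      ≤ ENNReal.ofReal (2 + ‖x‖)
          * ENNReal.ofReal (marginalWeight n a b x s z.1 z.2 * z.1 ^ (-0 : ℝ))
        + ENNReal.ofReal (4 * 2 ^ ((p : ℝ) / 2))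
          * ENNReal.ofReal (marginalWeight n a b x s z.1 z.2 * z.1 ^ (-1 : ℝ)) := by
    filter_upwards [ae_quadrant] with z hz
    have hm := marginalWeight_nonneg n a b x hs.le hz.1.le hz.2.le
    have hτ := condPrecision_pos hz
    have hz1 := hz.1
    have hz2 := hz.2
    have hu := shrink_mem_Icc hz.2
    set μ := (1 - shrink z) • x with hμ
    have hμx : ‖μ‖ ≤ ‖x‖ := by
      rw [hμ, norm_smul, Real.norm_of_nonneg (by linarith [hu.2])]
      exact mul_le_of_le_one_left (norm_nonneg _) (by linarith [hu.1])
    have pt : ∀ θ, ENNReal.ofReal (jointWeight n a b x s θ z * (1 + ‖θ‖))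
        ≤ ENNReal.ofReal (marginalWeight n a b x s z.1 z.2) *
          (ENNReal.ofReal (2 + ‖x‖) * ENNReal.ofReal (normalDensity θ μ (condPrecision z))
          + ENNReal.ofReal (‖θ - μ‖ ^ 2 * normalDensity θ μ (condPrecision z))) := by
      intro θ
      have hd := normalDensity_nonneg θ μ hτ.le
      rw [← ENNReal.ofReal_mul (by positivity),
        ← ENNReal.ofReal_add (by positivity) (by positivity),
        ← ENNReal.ofReal_mul hm, jointWeight_eq n a b x s θ hz, mul_assoc]
      refine ENNReal.ofReal_le_ofReal (mul_le_mul_of_nonneg_left ?_ hm)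
      have : ‖θ‖ ≤ ‖x‖ + (1 + ‖θ - μ‖ ^ 2) := by
        have e : θ = μ + (θ - μ) := by abel
        calc ‖θ‖ ≤ ‖μ‖ + ‖θ - μ‖ := by nth_rewrite 1 [e]; exact norm_add_le _ _
          _ ≤ _ := by nlinarith [sq_nonneg (‖θ - μ‖ - 1), norm_nonneg (θ - μ)]
      calc normalDensity θ μ (condPrecision z) * (1 + ‖θ‖)
          ≤ normalDensity θ μ (condPrecision z) * (2 + ‖x‖ + ‖θ - μ‖ ^ 2) :=
            mul_le_mul_of_nonneg_left (by linarith) hd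
        _ = _ := by ring
    have nm : Measurable fun θ => normalDensity θ μ (condPrecision z) :=
      Measurable.normalDensity measurable_id measurable_const measurable_const
    refine (lintegral_mono pt).trans ?_
    rw [lintegral_const_mul' _ _ ENNReal.ofReal_ne_top, lintegral_add_left (by fun_prop),
      lintegral_const_mul' _ _ ENNReal.ofReal_ne_top, lintegral_normalDensity μ hτ, mul_one]
    refine (mul_le_mul_right (add_le_add le_rfl
      (lintegral_sq_mul_normalDensity_le μ hτ)) _).trans ?_
    rw [mul_add, ← ENNReal.ofReal_mul hm, ← ENNReal.ofReal_mul hm,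
      ← ENNReal.ofReal_mul (by positivity), ← ENNReal.ofReal_mul (by positivity), neg_zero,
      Real.rpow_zero, mul_one, Real.rpow_neg_one]
    refine add_le_add (le_of_eq (by rw [mul_comm])) (ENNReal.ofReal_le_ofReal ?_)
    have : 1 / condPrecision z ≤ z.1⁻¹ := by
      unfold condPrecision
      rw [one_div_div, inv_eq_one_div, div_le_div_iff₀ (by positivity) hz1]
      nlinarith
    calc marginalWeight n a b x s z.1 z.2 * (4 * 2 ^ ((p : ℝ) / 2) / condPrecision z)
        = 4 * 2 ^ ((p : ℝ) / 2) * (marginalWeight n a b x s z.1 z.2 * (1 / condPrecision z)) := by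
          ring
      _ ≤ _ := by gcongr
  refine (lintegral_mono_ae hle).trans_lt ?_
  have m0 := measurable_marginalWeight_right n a b x s
  rw [lintegral_add_left (by fun_prop), lintegral_const_mul' _ _ ENNReal.ofReal_ne_top,
    lintegral_const_mul' _ _ ENNReal.ofReal_ne_top]
  have hκ : 1 < gammaShape p n := by
    have : (0 : ℝ) < n := by positivity
    have : (0 : ℝ) ≤ p := by positivity
    unfold gammaShape
    linarith
  exact ENNReal.add_lt_top.2 ⟨ENNReal.mul_lt_top ENNReal.ofReal_lt_top
    (lintegral_marginalWeight_mul_rpow_lt_top hn hb h1 (by linarith) x hs),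
    ENNReal.mul_lt_top ENNReal.ofReal_lt_top
    (lintegral_marginalWeight_mul_rpow_lt_top hn hb h1 (by linarith) x hs)⟩

theorem measurable_jointWeight_right (n : ℕ) (a b : ℝ) (x : EuclideanSpace ℝ (Fin p)) (s : ℝ) :
    Measurable fun w : EuclideanSpace ℝ (Fin p) × (ℝ × ℝ) => jointWeight n a b x s w.1 w.2 :=
  Measurable.jointWeight n a b measurable_const measurable_const measurable_fst measurable_snd

theorem ae_prod_quadrant : ∀ᵐ w ∂((volume : Measure (EuclideanSpace ℝ (Fin p))).prod quadrant),
    0 < w.2.1 ∧ 0 < w.2.2 :=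
  Measure.quasiMeasurePreserving_snd.ae ae_quadrant

theorem integrable_jointWeight {n : ℕ} (hn : 1 ≤ n) {a b : ℝ} (hb : -1 < b)
    (h1 : -a - 1 - (p : ℝ) / 2 < 0) (x : EuclideanSpace ℝ (Fin p)) {s : ℝ} (hs : 0 < s) :
    Integrable (fun w => jointWeight n a b x s w.1 w.2)
      ((volume : Measure (EuclideanSpace ℝ (Fin p))).prod quadrant) := by
  refine ⟨(measurable_jointWeight_right n a b x s).aestronglyMeasurable, ?_⟩
  refine lt_of_le_of_lt (lintegral_mono_ae ?_) (lintegral_jointWeight_mul_lt_top hn hb h1 x hs)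
  filter_upwards [ae_prod_quadrant] with w hw
  have := jointWeight_nonneg n a b x hs.le w.1 hw
  rw [Real.enorm_of_nonneg this]
  exact ENNReal.ofReal_le_ofReal (le_mul_of_one_le_right this (by linarith [norm_nonneg w.1]))

theorem integrable_jointWeight_smul {n : ℕ} (hn : 1 ≤ n) {a b : ℝ} (hb : -1 < b)
    (h1 : -a - 1 - (p : ℝ) / 2 < 0) (x : EuclideanSpace ℝ (Fin p)) {s : ℝ} (hs : 0 < s) :
    Integrable (fun w => jointWeight n a b x s w.1 w.2 • w.1)
      ((volume : Measure (EuclideanSpace ℝ (Fin p))).prod quadrant) := by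
  refine ⟨((measurable_jointWeight_right n a b x s).smul measurable_fst).aestronglyMeasurable, ?_⟩
  refine lt_of_le_of_lt (lintegral_mono_ae ?_) (lintegral_jointWeight_mul_lt_top hn hb h1 x hs)
  filter_upwards [ae_prod_quadrant] with w hw
  have := jointWeight_nonneg n a b x hs.le w.1 hw
  rw [enorm_smul, Real.enorm_of_nonneg this, ← ofReal_norm, ← ENNReal.ofReal_mul this]
  exact ENNReal.ofReal_le_ofReal (mul_le_mul_of_nonneg_left (by linarith) this)

theorem integral_jointWeight {n : ℕ} (hn : 1 ≤ n) {a b : ℝ} (hb : -1 < b)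
    (h1 : -a - 1 - (p : ℝ) / 2 < 0) (x : EuclideanSpace ℝ (Fin p)) {s : ℝ} (hs : 0 < s) :
    ∫ w, jointWeight n a b x s w.1 w.2
      ∂((volume : Measure (EuclideanSpace ℝ (Fin p))).prod quadrant)
      = (posterior n a b x s).real univ := by
  have h2 : (posterior n a b x s).real univ = ∫ _, 1 ∂posterior n a b x s := by simp
  rw [integral_prod_symm _ (integrable_jointWeight hn hb h1 x hs), h2,
    integral_posterior n a b x hs]
  refine integral_congr_ae ?_
  filter_upwards [ae_quadrant] with z hz
  simp_rw [jointWeight_eq n a b x s _ hz]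
  rw [integral_const_mul, integral_normalDensity _ (condPrecision_pos hz)]

theorem integral_jointWeight_smul {n : ℕ} (hn : 1 ≤ n) {a b : ℝ} (hb : -1 < b)
    (h1 : -a - 1 - (p : ℝ) / 2 < 0) (x : EuclideanSpace ℝ (Fin p)) {s : ℝ} (hs : 0 < s) :
    ∫ w, jointWeight n a b x s w.1 w.2 • w.1
      ∂((volume : Measure (EuclideanSpace ℝ (Fin p))).prod quadrant)
      = (∫ z, (1 - shrink z) ∂posterior n a b x s) • x := by
  rw [integral_prod_symm _ (integrable_jointWeight_smul hn hb h1 x hs),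
    integral_posterior n a b x hs, ← integral_smul_const]
  refine integral_congr_ae ?_
  filter_upwards [ae_quadrant] with z hz
  simp_rw [jointWeight_eq n a b x s _ hz, mul_smul]
  rw [integral_smul, integral_normalDensity_smul _ (condPrecision_pos hz)]

theorem bayesWeight_jointPrior (n : ℕ) (a b : ℝ) (x : EuclideanSpace ℝ (Fin p)) (s : ℝ)
    (θ : EuclideanSpace ℝ (Fin p)) {η : ℝ} (hη : 0 < η) :
    bayesWeight n (jointPrior a b) x s (θ, η)
      = ∫ g in Ioi (0 : ℝ), jointWeight n a b x s θ (η, g) := by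
  unfold bayesWeight jointPrior jointWeight
  simp only
  rw [integral_mul_const, ← mul_assoc η, mul_one_div_cancel hη.ne', one_mul]

instance : SFinite (paramMeasure p) := by unfold paramMeasure; infer_instance

theorem ae_paramMeasure : ∀ᵐ z ∂paramMeasure p, 0 < z.2 :=
  Measure.quasiMeasurePreserving_snd.ae (ae_restrict_mem measurableSet_Ioi)

theorem measurePreserving_assoc_paramMeasure : MeasurePreserving MeasurableEquiv.prodAssoc
    ((paramMeasure p).prod (volume.restrict (Ioi (0 : ℝ))))
    ((volume : Measure (EuclideanSpace ℝ (Fin p))).prod quadrant) :=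
  measurePreserving_prodAssoc _ _ _

/-- Both integrals in the generalized Bayes estimator, written through the joint density of
`(θ, η, g)`. -/
theorem bayesWeight_integrals {n : ℕ} (hn : 1 ≤ n) {a b : ℝ} (hb : -1 < b)
    (h1 : -a - 1 - (p : ℝ) / 2 < 0) (x : EuclideanSpace ℝ (Fin p)) {s : ℝ} (hs : 0 < s) :
    (Integrable (bayesWeight n (jointPrior a b) x s) (paramMeasure p) ∧
      ∫ z, bayesWeight n (jointPrior a b) x s z ∂paramMeasure p
        = (posterior n a b x s).real univ) ∧
    (Integrable (fun z => bayesWeight n (jointPrior a b) x s z • z.1) (paramMeasure p) ∧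
      ∫ z, bayesWeight n (jointPrior a b) x s z • z.1 ∂paramMeasure p
        = (∫ z, (1 - shrink z) ∂posterior n a b x s) • x) := by
  have mp := measurePreserving_assoc_paramMeasure (p := p)
  have me : MeasurableEmbedding (MeasurableEquiv.prodAssoc :
    (EuclideanSpace ℝ (Fin p) × ℝ) × ℝ ≃ᵐ _) := MeasurableEquiv.measurableEmbedding _
  have c1 : ∀ᵐ z ∂paramMeasure p, ∫ g in Ioi (0 : ℝ), jointWeight n a b x s z.1 (z.2, g)
      = bayesWeight n (jointPrior a b) x s z := by
    filter_upwards [ae_paramMeasure] with z hz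
    exact (bayesWeight_jointPrior n a b x s z.1 hz).symm
  have c2 : ∀ᵐ z ∂paramMeasure p, ∫ g in Ioi (0 : ℝ), jointWeight n a b x s z.1 (z.2, g) • z.1
      = bayesWeight n (jointPrior a b) x s z • z.1 := by
    filter_upwards [c1] with z hz
    rw [integral_smul_const, hz]
  have i1 := (mp.integrable_comp_emb me).2 (integrable_jointWeight hn hb h1 x hs)
  have i2 := (mp.integrable_comp_emb me).2 (integrable_jointWeight_smul hn hb h1 x hs)
  refine ⟨⟨i1.integral_prod_left.congr c1, ?_⟩, ⟨i2.integral_prod_left.congr c2, ?_⟩⟩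
  · rw [← integral_congr_ae c1, ← integral_jointWeight hn hb h1 x hs, ← mp.integral_comp me]
    exact (integral_prod _ i1).symm
  · rw [← integral_congr_ae c2, ← integral_jointWeight_smul hn hb h1 x hs, ← mp.integral_comp me]
    exact (integral_prod _ i2).symm

theorem genBayesWellDefined {n : ℕ} (hn : 1 ≤ n) {a b : ℝ} (hb : -1 < b)
    (h1 : -a - 1 - (p : ℝ) / 2 < 0) : GenBayesWellDefined n p a b := by
  refine ⟨fun θ hθ η hη => integrableOn_mixtureIntegrand hb h1 hθ hη, fun x s hs => ?_⟩
  obtain ⟨⟨i1, e1⟩, ⟨i2, -⟩⟩ := bayesWeight_integrals hn hb h1 x hs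
  exact ⟨i1, i2, e1 ▸ posterior_real_pos hn hb h1 x hs⟩

/-- The generalized Bayes estimator shrinks `x` by the posterior mean of `g / (g + 1)`. -/
theorem genBayes_eq {n : ℕ} (hn : 1 ≤ n) {a b : ℝ} (hb : -1 < b)
    (h1 : -a - 1 - (p : ℝ) / 2 < 0) (x : EuclideanSpace ℝ (Fin p)) {s : ℝ} (hs : 0 < s) :
    ∃ B : ℝ, B ∈ Icc (0 : ℝ) 1 ∧
      B * (posterior n a b x s).real univ = ∫ z, shrink z ∂posterior n a b x s ∧
      genBayes n (jointPrior a b) x s = (1 - B) • x := by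
  have := isFiniteMeasure_posterior hn hb h1 x hs
  have hm := posterior_real_pos hn hb h1 x hs
  obtain ⟨⟨-, e1⟩, ⟨-, e2⟩⟩ := bayesWeight_integrals hn hb h1 x hs
  have h01 : ∀ᵐ z ∂posterior n a b x s, shrink z ∈ Icc (0 : ℝ) 1 :=
    (ae_posterior n a b x s).mono fun z hz => shrink_mem_Icc hz.2
  have hi : Integrable shrink (posterior n a b x s) :=
    Integrable.of_bound measurable_shrink.aestronglyMeasurable 1 (h01.mono fun z hz => by
      rw [Real.norm_of_nonneg hz.1]; exact hz.2)
  refine ⟨(∫ z, shrink z ∂posterior n a b x s) / (posterior n a b x s).real univ, ⟨?_, ?_⟩, ?_, ?_⟩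
  · exact div_nonneg (integral_nonneg_of_ae (h01.mono fun z hz => hz.1)) hm.le
  · rw [div_le_one hm]
    calc ∫ z, shrink z ∂posterior n a b x s ≤ ∫ _, (1 : ℝ) ∂posterior n a b x s :=
          integral_mono_ae hi (integrable_const _) (h01.mono fun z hz => hz.2)
      _ = _ := by simp
  · exact div_mul_cancel₀ _ hm.ne'
  · unfold genBayes
    rw [e1, e2, smul_smul, integral_sub (integrable_const _) hi]
    congr 1
    simp only [integral_const, smul_eq_mul, mul_one]
    field_simp

theorem measurable_genBayes (n : ℕ) (a b : ℝ) :
    Measurable (Function.uncurry (genBayes n (jointPrior (p := p) a b))) := by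
  have m1 : StronglyMeasurable fun z : EuclideanSpace ℝ (Fin p) × ℝ =>
      jointPrior a b z.1 z.2 := by
    unfold jointPrior
    refine StronglyMeasurable.mul (by fun_prop : Measurable _).stronglyMeasurable ?_
    exact (Measurable.mixtureIntegrand a b (α := (EuclideanSpace ℝ (Fin p) × ℝ) × ℝ)
      (measurable_fst.fst) (measurable_fst.snd) measurable_snd).stronglyMeasurable
      |>.integral_prod_right'
  have m2 : Measurable fun w : (EuclideanSpace ℝ (Fin p) × ℝ) × (EuclideanSpace ℝ (Fin p) × ℝ) =>
      bayesWeight n (jointPrior a b) w.1.1 w.1.2 w.2 := by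
    unfold bayesWeight
    exact (measurable_snd.snd.mul (m1.measurable.comp measurable_snd)).mul
      ((Measurable.normalDensity measurable_fst.fst measurable_snd.fst measurable_snd.snd).mul
        (Measurable.scaleDensity n measurable_fst.snd measurable_snd.snd))
  exact (m2.stronglyMeasurable.integral_prod_right' (ν := paramMeasure p)).measurable.inv.smul
    ((m2.smul measurable_snd.fst).stronglyMeasurable.integral_prod_right'
      (ν := paramMeasure p)).measurable

/-! ### Oscillation of the cut-off functions under the posterior -/

theorem integral_posterior_le {n : ℕ} {a b : ℝ} {x : EuclideanSpace ℝ (Fin p)} {s : ℝ}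
    (hs : 0 < s) {f F : ℝ × ℝ → ℝ} (hf : Measurable f) {k R : ℝ} (hk : 0 ≤ k) (hR : 0 ≤ R)
    (hF : ∀ z : ℝ × ℝ, 0 < z.1 → 0 < z.2 → 0 ≤ f z ∧ f z ≤ k * F z)
    (h : ∫⁻ z, ENNReal.ofReal (marginalWeight n a b x s z.1 z.2 * F z) ∂quadrant
      ≤ ENNReal.ofReal R) : ∫ z, f z ∂posterior n a b x s ≤ k * R := by
  rw [integral_eq_lintegral_of_nonneg_ae ((ae_posterior n a b x s).mono fun z hz =>
    (hF z hz.1 hz.2).1) hf.aestronglyMeasurable, lintegral_posterior n a b x s hf.ennreal_ofReal]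
  refine ENNReal.toReal_le_of_le_ofReal (by positivity) ?_
  rw [ENNReal.ofReal_mul hk]
  refine le_trans ?_ (mul_le_mul_right h _)
  rw [← lintegral_const_mul' _ _ ENNReal.ofReal_ne_top]
  refine lintegral_mono_ae ?_
  filter_upwards [ae_quadrant] with z hz
  have hN := marginalWeight_nonneg n a b x hs.le hz.1.le hz.2.le
  rw [← ENNReal.ofReal_mul hN, ← ENNReal.ofReal_mul hk]
  refine ENNReal.ofReal_le_ofReal ?_
  calc _ ≤ marginalWeight n a b x s z.1 z.2 * (k * F z) := by
        gcongr; exact (hF z hz.1 hz.2).2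
    _ = _ := by ring

theorem one_add_pow_le_exp {ε D : ℝ} (hε : 0 < ε) (hε8 : ε ≤ 8) (hD : 0 ≤ D) :
    (1 + D) ^ 8 ≤ (8 / ε) ^ 8 * Real.exp (ε * D) := by
  have h1 : 1 + D ≤ 8 / ε * Real.exp (ε * D / 8) := by
    have := Real.add_one_le_exp (ε * D / 8)
    rw [div_mul_eq_mul_div, le_div_iff₀ hε]
    nlinarith
  calc (1 + D) ^ 8 ≤ (8 / ε * Real.exp (ε * D / 8)) ^ 8 := by gcongr
    _ = _ := by
      rw [mul_pow, ← Real.exp_nat_mul]; congr 2; push_cast; ring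

/-- The oscillation of the cut-off function under the posterior, as it enters `blyth_pointwise`. -/
noncomputable def cutoffOscillation (n : ℕ) (a b i : ℝ) (x : EuclideanSpace ℝ (Fin p)) (s : ℝ) :
    ℝ :=
  (∫ z, shrink z ^ 2 * (cutoff i z.1 z.2 - cutoff i (1 / s) (‖x‖ ^ 2 / s)) ^ 2
      ∂posterior n a b x s)
    + (∫ z, shrink z ^ 2 ∂posterior n a b x s)
      * (∫ z, (cutoff i z.1 z.2 - cutoff i (1 / s) (‖x‖ ^ 2 / s)) ^ 2 ∂posterior n a b x s)
      / (posterior n a b x s).real univ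

/-- The posterior concentrates where the cut-off function is close to its value at
`(1 / s, ‖x‖² / s)`; the oscillation is bounded by a multiple of the squared gradient of `iterLog`.
For `-2 ≤ a` the square of `shrink` is at most `(1 + g)^a`, and this is the power for which the
resulting bound does not depend on `a`. -/
theorem cutoffOscillation_le {n : ℕ} (hn : 1 ≤ n) {a b : ℝ} (hb : -1 < b)
    (h1 : -a - 1 - (p : ℝ) / 2 < 0) (ha : -2 ≤ a) (ha' : a ≤ -1) :
    ∃ C : ℝ, 0 ≤ C ∧ ∀ (i : ℝ) (x : EuclideanSpace ℝ (Fin p)) (s : ℝ), 0 < i → 0 < s →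
      cutoffOscillation n a b i x s ≤ C / i ^ 2 *
        ((s ^ (-((p : ℝ) / 2) - 2) * (1 + ‖x‖ ^ 2 / s) ^ (-1 - (p : ℝ) / 2))
        * ((logRadius (1 / s) (‖x‖ ^ 2 / s)
          * (1 + Real.log (logRadius (1 / s) (‖x‖ ^ 2 / s)))) ^ 2)⁻¹) := by
  set ε := min (1 / 8) ((a + 1 + (p : ℝ) / 2) / 2) with hε
  have hε0 : 0 < ε := lt_min (by norm_num) (by linarith)
  have hε1 : ε ≤ 1 / 8 := min_le_left _ _
  have hε2 : ε ≤ (a + 1 + (p : ℝ) / 2) / 2 := min_le_right _ _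
  have hn' : (1 : ℝ) ≤ n := by exact_mod_cast hn
  have hp' : (0 : ℝ) ≤ p := by positivity
  have hκ : gammaShape p n = ((p : ℝ) + n) / 2 + 1 := rfl
  obtain ⟨C₁, hC₁, H₁⟩ := lintegral_marginalWeight_le (p := p) hn (a := a) (α := a) hb hε0.le
    (by linarith) (by rw [hκ]; linarith) (by rw [hκ]; linarith)
  obtain ⟨C₂, hC₂, H₂⟩ := lintegral_marginalWeight_le (p := p) hn (a := a) (α := 0) hb hε0.le
    (by linarith) (by rw [hκ]; linarith) (by rw [hκ]; linarith)
  obtain ⟨c, hc, H₃⟩ := le_lintegral_marginalWeight (p := p) hn (b := b) h1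
  set M : ℝ := (8 / ε) ^ 8 with hM
  have hM0 : 0 < M := by positivity
  refine ⟨M * C₁ * (1 + C₂ / c), by positivity, fun i x s hi hs => ?_⟩
  have hfin := isFiniteMeasure_posterior hn hb h1 x hs
  have hw : 0 ≤ ‖x‖ ^ 2 / s := by positivity
  set q := 1 + ‖x‖ ^ 2 / s with hq
  have hq0 : 0 < q := by linarith
  set S := s ^ (-((p : ℝ) / 2) - 2) with hS
  have hS0 : 0 < S := by positivity
  have hρ1 := one_le_logRadius (η := 1 / s) hw
  set ρ := logRadius (1 / s) (‖x‖ ^ 2 / s) with hρ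
  have hlog := Real.log_nonneg hρ1
  set R := ρ * (1 + Real.log ρ) with hR
  have hR0 : 0 < R := by positivity
  set c₀ := cutoff i (1 / s) (‖x‖ ^ 2 / s) with hc₀
  set k := M / (i * R) ^ 2 with hk
  have hk0 : 0 ≤ k := by positivity
  have G₁ := H₁ x s hs
  have G₂ := H₂ x s hs
  rw [show -a - 1 - (p : ℝ) / 2 + a = -1 - (p : ℝ) / 2 by ring] at G₁
  rw [add_zero] at G₂
  simp only [← hq, ← hS, Real.rpow_zero, mul_one, mul_assoc] at G₁ G₂
  have hcut : ∀ z : ℝ × ℝ, 0 < z.1 → 0 < z.2 → (cutoff i z.1 z.2 - c₀) ^ 2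
      ≤ k * Real.exp (ε * (|Real.log ((1 + z.2) / q)| + |Real.log (z.1 * s)|)) := by
    intro z hz1 hz2
    set D := |Real.log ((1 + z.2) / q)| + |Real.log (z.1 * s)| with hD
    have hD0 : 0 ≤ D := by positivity
    have h2 := abs_cutoff_sub_le (D := D) hi hz1 (show 0 < 1 / s by positivity) hz2.le hw
      (by rw [hD, div_div_eq_mul_div, div_one])
    calc (cutoff i z.1 z.2 - c₀) ^ 2 = |cutoff i z.1 z.2 - c₀| ^ 2 := (sq_abs _).symm
      _ ≤ ((1 + D) ^ 4 / (i * R)) ^ 2 := by gcongr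
      _ = (1 + D) ^ 8 / (i * R) ^ 2 := by rw [div_pow, ← pow_mul]
      _ ≤ M * Real.exp (ε * D) / (i * R) ^ 2 := by
          gcongr; exact one_add_pow_le_exp hε0 (by linarith) hD0
      _ = _ := by rw [hk]; ring
  have hsh : ∀ z : ℝ × ℝ, 0 < z.2 → shrink z ^ 2 ≤ (1 + z.2) ^ a := by
    intro z hz2
    have : shrink z ^ 2 = (1 + z.2) ^ (-2 : ℝ) := by
      unfold shrink
      rw [Real.rpow_neg (by linarith), one_div, inv_pow]; norm_num
    rw [this]
    exact Real.rpow_le_rpow_of_exponent_le (by linarith) ha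
  have hmc := measurable_cutoff i
  have hms := measurable_shrink
  have X₁ : ∫ z, shrink z ^ 2 * (cutoff i z.1 z.2 - c₀) ^ 2 ∂posterior n a b x s
      ≤ k * (C₁ * (S * q ^ (-1 - (p : ℝ) / 2))) := by
    refine integral_posterior_le hs (by fun_prop) hk0 (by positivity)
      (fun z hz1 hz2 => ⟨by positivity, ?_⟩) G₁
    calc _ ≤ (1 + z.2) ^ a
          * (k * Real.exp (ε * (|Real.log ((1 + z.2) / q)| + |Real.log (z.1 * s)|))) :=
          mul_le_mul (hsh z hz2) (hcut z hz1 hz2) (by positivity) (by positivity)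
      _ = _ := by ring
  have X₂ : ∫ z, shrink z ^ 2 ∂posterior n a b x s ≤ 1 * (C₁ * (S * q ^ (-1 - (p : ℝ) / 2))) := by
    refine integral_posterior_le hs (by fun_prop) zero_le_one (by positivity)
      (fun z hz1 hz2 => ⟨by positivity, ?_⟩) G₁
    rw [one_mul]
    exact (hsh z hz2).trans (le_mul_of_one_le_right (by positivity)
      (Real.one_le_exp (by positivity)))
  have X₃ : ∫ z, (cutoff i z.1 z.2 - c₀) ^ 2 ∂posterior n a b x s
      ≤ k * (C₂ * (S * q ^ (-a - 1 - (p : ℝ) / 2))) :=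
    integral_posterior_le hs (by fun_prop) hk0 (by positivity)
      (fun z hz1 hz2 => ⟨by positivity, hcut z hz1 hz2⟩) G₂
  have X₄ : c * (S * q ^ (-a - 1 - (p : ℝ) / 2)) ≤ (posterior n a b x s).real univ := by
    refine (ENNReal.ofReal_le_iff_le_toReal (measure_ne_top _ _)).1 ?_
    unfold posterior
    rw [withDensity_apply _ MeasurableSet.univ, Measure.restrict_univ]
    exact H₃ x s hs
  have hP : 0 < S * q ^ (-a - 1 - (p : ℝ) / 2) := by positivity
  unfold cutoffOscillation
  calc _ ≤ k * (C₁ * (S * q ^ (-1 - (p : ℝ) / 2)))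
        + (1 * (C₁ * (S * q ^ (-1 - (p : ℝ) / 2))))
          * (k * (C₂ * (S * q ^ (-a - 1 - (p : ℝ) / 2))))
          / (c * (S * q ^ (-a - 1 - (p : ℝ) / 2))) := by
        have n1 : 0 ≤ ∫ z, shrink z ^ 2 ∂posterior n a b x s :=
          integral_nonneg fun z => by positivity
        have n2 : 0 ≤ ∫ z, (cutoff i z.1 z.2 - c₀) ^ 2 ∂posterior n a b x s :=
          integral_nonneg fun z => by positivity
        gcongr
    _ = _ := by
        rw [hk]; field_simp

/-! ### Bayes risks and admissibility -/

/-- The unnormalized posterior risk at `(x, s)` of the estimate `v` under the prior reweighted by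
the square of the cut-off function; its integral over `(x, s)` is a Bayes risk. -/
noncomputable def cutoffRisk (n : ℕ) (a b i : ℝ) (v x : EuclideanSpace ℝ (Fin p)) (s : ℝ) :
    ENNReal :=
  ∫⁻ z, (∫⁻ θ, ENNReal.ofReal (cutoff i z.1 z.2 ^ 2
    * (‖v - θ‖ ^ 2 * jointWeight n a b x s θ z))) ∂quadrant

/-- The total mass at `(x, s)` of the reweighted posterior. -/
noncomputable def cutoffMass (n : ℕ) (a b i : ℝ) (x : EuclideanSpace ℝ (Fin p)) (s : ℝ) : ENNReal :=
  ∫⁻ z, ENNReal.ofReal (cutoff i z.1 z.2 ^ 2) ∂posterior n a b x s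

/-- The total variance of `θ` given `(x, η, g)`. -/
noncomputable def condVariance (p : ℕ) (z : ℝ × ℝ) : ENNReal :=
  ∫⁻ y : EuclideanSpace ℝ (Fin p), ENNReal.ofReal (‖y‖ ^ 2 * normalDensity y 0 (condPrecision z))

theorem measurable_condVariance : Measurable (condVariance p) := by
  have : Measurable condPrecision := by unfold condPrecision; fun_prop
  have h : Measurable fun w : (ℝ × ℝ) × EuclideanSpace ℝ (Fin p) =>
      normalDensity w.2 0 (condPrecision w.1) :=
    Measurable.normalDensity measurable_snd measurable_const (this.comp measurable_fst)
  exact Measurable.lintegral_prod_right' (f := fun w : (ℝ × ℝ) × EuclideanSpace ℝ (Fin p) =>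
    ENNReal.ofReal (‖w.2‖ ^ 2 * normalDensity w.2 0 (condPrecision w.1))) (by fun_prop)

theorem condVariance_le {z : ℝ × ℝ} (hz : 0 < z.1 ∧ 0 < z.2) :
    condVariance p z ≤ ENNReal.ofReal (4 * 2 ^ ((p : ℝ) / 2) / z.1) := by
  have h := lintegral_sq_mul_normalDensity_le (0 : EuclideanSpace ℝ (Fin p)) (condPrecision_pos hz)
  simp only [sub_zero] at h
  refine h.trans (ENNReal.ofReal_le_ofReal ?_)
  have hz1 := hz.1
  have hz2 := hz.2
  have : z.1 ≤ condPrecision z := by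
    unfold condPrecision
    rw [le_div_iff₀ hz2]; nlinarith
  gcongr

/-- Given `(η, g)` the parameter `θ` integrates out by the bias–variance decomposition. -/
theorem lintegral_sq_sub_mul_jointWeight (n : ℕ) (a b : ℝ) (v x : EuclideanSpace ℝ (Fin p)) {s : ℝ}
    (hs : 0 < s) {r : ℝ} (hr : 0 ≤ r) {z : ℝ × ℝ} (hz : 0 < z.1 ∧ 0 < z.2) :
    ∫⁻ θ, ENNReal.ofReal (r * (‖v - θ‖ ^ 2 * jointWeight n a b x s θ z))
      = ENNReal.ofReal (marginalWeight n a b x s z.1 z.2)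
        * (ENNReal.ofReal (r * ‖v - (1 - shrink z) • x‖ ^ 2)
          + ENNReal.ofReal r * condVariance p z) := by
  have hN := marginalWeight_nonneg n a b x hs.le hz.1.le hz.2.le
  have e : ∀ θ, ENNReal.ofReal (r * (‖v - θ‖ ^ 2 * jointWeight n a b x s θ z))
      = ENNReal.ofReal (marginalWeight n a b x s z.1 z.2 * r) * ENNReal.ofReal (‖v - θ‖ ^ 2
        * normalDensity θ ((1 - shrink z) • x) (condPrecision z)) := by
    intro θ
    rw [← ENNReal.ofReal_mul (by positivity), jointWeight_eq n a b x s θ hz]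
    congr 1; ring
  simp_rw [e]
  rw [lintegral_const_mul' _ _ ENNReal.ofReal_ne_top,
    lintegral_sq_sub_mul_normalDensity v _ (condPrecision_pos hz), ENNReal.ofReal_mul hN,
    ENNReal.ofReal_mul hr, mul_assoc, mul_add]
  rfl

theorem cutoffRisk_eq (n : ℕ) (a b i : ℝ) (v x : EuclideanSpace ℝ (Fin p)) {s : ℝ} (hs : 0 < s) :
    cutoffRisk n a b i v x s
      = (∫⁻ z, ENNReal.ofReal (cutoff i z.1 z.2 ^ 2 * ‖v - (1 - shrink z) • x‖ ^ 2)
          ∂posterior n a b x s)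
        + ∫⁻ z, ENNReal.ofReal (cutoff i z.1 z.2 ^ 2) * condVariance p z ∂posterior n a b x s := by
  have hmc := measurable_cutoff i
  have hms := measurable_shrink
  have hmv := measurable_condVariance (p := p)
  have m1 : Measurable fun z : ℝ × ℝ =>
      ENNReal.ofReal (cutoff i z.1 z.2 ^ 2 * ‖v - (1 - shrink z) • x‖ ^ 2) := by fun_prop
  rw [← lintegral_add_left m1, lintegral_posterior n a b x s (by fun_prop)]
  refine lintegral_congr_ae ?_
  filter_upwards [ae_quadrant] with z hz
  exact lintegral_sq_sub_mul_jointWeight n a b v x hs (by positivity) hz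

/-- Blyth's inequality for the posterior under the reweighted prior. -/
theorem cutoffRisk_genBayes_add_le {n : ℕ} (hn : 1 ≤ n) {a b : ℝ} (hb : -1 < b)
    (h1 : -a - 1 - (p : ℝ) / 2 < 0) {i : ℝ} (hi : 0 < i) (v x : EuclideanSpace ℝ (Fin p)) {s : ℝ}
    (hs : 0 < s) :
    cutoffRisk n a b i (genBayes n (jointPrior a b) x s) x s
        + ENNReal.ofReal (‖v - genBayes n (jointPrior a b) x s‖ ^ 2 / 2) * cutoffMass n a b i x s
      ≤ cutoffRisk n a b i v x s
        + ENNReal.ofReal (48 * ‖x‖ ^ 2 * cutoffOscillation n a b i x s) := by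
  have hfin := isFiniteMeasure_posterior hn hb h1 x hs
  have hpos := posterior_real_pos hn hb h1 x hs
  obtain ⟨B, -, hB, hg⟩ := genBayes_eq hn hb h1 x hs
  have hmc := measurable_cutoff i
  have hms := measurable_shrink
  have hu01 : ∀ᵐ z ∂posterior n a b x s, shrink z ∈ Icc (0 : ℝ) 1 :=
    (ae_posterior n a b x s).mono fun z hz => shrink_mem_Icc hz.2
  have hh01 : ∀ᵐ z ∂posterior n a b x s, cutoff i z.1 z.2 ∈ Icc (0 : ℝ) 1 :=
    (ae_posterior n a b x s).mono fun z hz => cutoff_mem_Icc hi hz.2.le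
  have main := blyth_pointwise hms hmc hu01 hh01 hpos (cutoff i (1 / s) (‖x‖ ^ 2 / s)) B hB x v
  have toR : ∀ w : EuclideanSpace ℝ (Fin p),
      ∫⁻ z, ENNReal.ofReal (cutoff i z.1 z.2 ^ 2 * ‖w - (1 - shrink z) • x‖ ^ 2)
        ∂posterior n a b x s
      = ENNReal.ofReal (∫ z, cutoff i z.1 z.2 ^ 2 * ‖w - (1 - shrink z) • x‖ ^ 2
        ∂posterior n a b x s) := by
    intro w
    rw [ofReal_integral_eq_lintegral_ofReal _ (.of_forall fun z => by positivity)]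
    exact integrable_comp_unitInterval hms hmc hu01 hh01
      (P := fun y => y.2 ^ 2 * ‖w - (1 - y.1) • x‖ ^ 2) (by fun_prop)
  have massR : cutoffMass n a b i x s
      = ENNReal.ofReal (∫ z, cutoff i z.1 z.2 ^ 2 ∂posterior n a b x s) := by
    unfold cutoffMass
    rw [ofReal_integral_eq_lintegral_ofReal _ (.of_forall fun z => by positivity)]
    exact integrable_comp_unitInterval hms hmc hu01 hh01 (P := fun y => y.2 ^ 2) (by fun_prop)
  have n0 : ∀ w : EuclideanSpace ℝ (Fin p), 0 ≤ ∫ z, cutoff i z.1 z.2 ^ 2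
      * ‖w - (1 - shrink z) • x‖ ^ 2 ∂posterior n a b x s :=
    fun w => integral_nonneg fun z => by positivity
  have n1 : 0 ≤ ∫ z, cutoff i z.1 z.2 ^ 2 ∂posterior n a b x s :=
    integral_nonneg fun z => by positivity
  have n2 : 0 ≤ cutoffOscillation n a b i x s := by
    refine add_nonneg (integral_nonneg fun z => by positivity) (div_nonneg (mul_nonneg
      (integral_nonneg fun z => by positivity) (integral_nonneg fun z => by positivity)) hpos.le)
  rw [cutoffRisk_eq n a b i _ x hs, cutoffRisk_eq n a b i v x hs, hg, massR, toR, toR,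
    ← ENNReal.ofReal_mul (by positivity), add_right_comm, add_right_comm _ _ (ENNReal.ofReal _),
    ← ENNReal.ofReal_add (n0 _) (by positivity), ← ENNReal.ofReal_add (n0 _) (by positivity)]
  exact add_le_add (ENNReal.ofReal_le_ofReal main) le_rfl

/-- Lebesgue measure on the sample space `ℝ^p × (0, ∞)`. -/
noncomputable def obsMeasure (p : ℕ) : Measure (EuclideanSpace ℝ (Fin p) × ℝ) :=
  (volume : Measure (EuclideanSpace ℝ (Fin p))).prod (volume.restrict (Ioi (0 : ℝ)))

instance : SFinite (obsMeasure p) := by unfold obsMeasure; infer_instance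

theorem ae_obsMeasure : ∀ᵐ o ∂obsMeasure p, 0 < o.2 :=
  Measure.quasiMeasurePreserving_snd.ae (ae_restrict_mem measurableSet_Ioi)

theorem measurable_cutoffRisk (n : ℕ) (a b i : ℝ)
    {δ : EuclideanSpace ℝ (Fin p) → ℝ → EuclideanSpace ℝ (Fin p)}
    (hδ : Measurable (Function.uncurry δ)) :
    Measurable fun w : ((EuclideanSpace ℝ (Fin p) × ℝ) × (ℝ × ℝ)) × EuclideanSpace ℝ (Fin p) =>
      ENNReal.ofReal (cutoff i w.1.2.1 w.1.2.2 ^ 2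
        * (‖δ w.1.1.1 w.1.1.2 - w.2‖ ^ 2 * jointWeight n a b w.1.1.1 w.1.1.2 w.2 w.1.2)) := by
  have m1 : Measurable
      fun w : ((EuclideanSpace ℝ (Fin p) × ℝ) × (ℝ × ℝ)) × EuclideanSpace ℝ (Fin p) =>
      δ w.1.1.1 w.1.1.2 := hδ.comp measurable_fst.fst
  have m2 : Measurable
      fun w : ((EuclideanSpace ℝ (Fin p) × ℝ) × (ℝ × ℝ)) × EuclideanSpace ℝ (Fin p) =>
      jointWeight n a b w.1.1.1 w.1.1.2 w.2 w.1.2 :=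
    Measurable.jointWeight n a b measurable_fst.fst.fst measurable_fst.fst.snd measurable_snd
      measurable_fst.snd
  have m3 : Measurable
      fun w : ((EuclideanSpace ℝ (Fin p) × ℝ) × (ℝ × ℝ)) × EuclideanSpace ℝ (Fin p) =>
      cutoff i w.1.2.1 w.1.2.2 := (measurable_cutoff i).comp measurable_fst.snd
  fun_prop

theorem measurable_risk_integrand (n : ℕ)
    {δ : EuclideanSpace ℝ (Fin p) → ℝ → EuclideanSpace ℝ (Fin p)}
    (hδ : Measurable (Function.uncurry δ)) (θ : EuclideanSpace ℝ (Fin p)) (η : ℝ) :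
    Measurable fun o : EuclideanSpace ℝ (Fin p) × ℝ => ENNReal.ofReal
      (η * ‖δ o.1 o.2 - θ‖ ^ 2 * (normalDensity o.1 θ η * scaleDensity n o.2 η)) := by
  have m1 : Measurable fun o : EuclideanSpace ℝ (Fin p) × ℝ => δ o.1 o.2 := hδ
  have m2 : Measurable fun o : EuclideanSpace ℝ (Fin p) × ℝ => normalDensity o.1 θ η :=
    Measurable.normalDensity measurable_fst measurable_const measurable_const
  have m3 : Measurable fun o : EuclideanSpace ℝ (Fin p) × ℝ => scaleDensity n o.2 η :=
    Measurable.scaleDensity n measurable_snd measurable_const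
  fun_prop

/-- The Bayes risk under the reweighted prior, integrated in both orders. -/
theorem lintegral_cutoffRisk (n : ℕ) (a b i : ℝ)
    {δ : EuclideanSpace ℝ (Fin p) → ℝ → EuclideanSpace ℝ (Fin p)}
    (hδ : Measurable (Function.uncurry δ)) :
    ∫⁻ o, cutoffRisk n a b i (δ o.1 o.2) o.1 o.2 ∂obsMeasure p
      = ∫⁻ z, (∫⁻ θ, ENNReal.ofReal (cutoff i z.1 z.2 ^ 2
          * (mixtureIntegrand a b θ z.1 z.2 / z.1)) * risk n δ θ z.1) ∂quadrant := by
  have hm := measurable_cutoffRisk n a b i hδ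
  unfold cutoffRisk
  rw [lintegral_lintegral_swap]
  swap
  · exact (Measurable.lintegral_prod_right' hm).aemeasurable
  refine lintegral_congr_ae ?_
  filter_upwards [ae_quadrant] with z hz
  rw [lintegral_lintegral_swap]
  swap
  · exact (hm.comp (by fun_prop : Measurable
      fun w : (EuclideanSpace ℝ (Fin p) × ℝ) × EuclideanSpace ℝ (Fin p) =>
        ((w.1, z), w.2))).aemeasurable
  refine lintegral_congr fun θ => ?_
  have hz1 := hz.1
  have hmix := mixtureIntegrand_nonneg a b θ hz.1.le hz.2.le
  unfold risk
  rw [← lintegral_prod (f := fun o : EuclideanSpace ℝ (Fin p) × ℝ => ENNReal.ofReal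
    (z.1 * ‖δ o.1 o.2 - θ‖ ^ 2 * (normalDensity o.1 θ z.1 * scaleDensity n o.2 z.1)))
    (measurable_risk_integrand n hδ θ z.1).aemeasurable,
    ← lintegral_const_mul' _ _ ENNReal.ofReal_ne_top]
  refine lintegral_congr fun o => ?_
  rw [← ENNReal.ofReal_mul (by positivity)]
  congr 1
  unfold jointWeight
  field_simp

/-- The reweighted prior is finite, with finite second moments, so that the generalized Bayes
estimator has finite Bayes risk under it. -/
theorem lintegral_cutoffRisk_genBayes_lt_top {n : ℕ} (hn : 1 ≤ n) {a b : ℝ} (hb : -1 < b)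
    (h1 : -a - 1 - (p : ℝ) / 2 < 0) {i : ℝ} (hi : 0 < i) :
    ∫⁻ o, cutoffRisk n a b i (genBayes n (jointPrior a b) o.1 o.2) o.1 o.2 ∂obsMeasure p < ⊤ := by
  obtain ⟨M, hM, hsupp⟩ := exists_cutoff_eq_zero i hi
  set C : ℝ := 4 * 2 ^ ((p : ℝ) / 2) with hC
  have hC0 : 0 < C := by positivity
  have hmc := measurable_cutoff i
  -- bound for a fixed observation
  have step1 : ∀ᵐ o ∂obsMeasure p,
      cutoffRisk n a b i (genBayes n (jointPrior a b) o.1 o.2) o.1 o.2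
      ≤ ∫⁻ z, ENNReal.ofReal (marginalWeight n a b o.1 o.2 z.1 z.2
          * (cutoff i z.1 z.2 ^ 2 * (‖o.1‖ ^ 2 + C / z.1))) ∂quadrant := by
    filter_upwards [ae_obsMeasure] with o ho
    obtain ⟨B, hB01, -, hg⟩ := genBayes_eq hn hb h1 o.1 ho
    refine lintegral_mono_ae ?_
    filter_upwards [ae_quadrant] with z hz
    have hN := marginalWeight_nonneg n a b o.1 ho.le hz.1.le hz.2.le
    have hz1 := hz.1
    rw [lintegral_sq_sub_mul_jointWeight n a b _ o.1 ho (by positivity) hz, ENNReal.ofReal_mul hN]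
    refine mul_le_mul_right ?_ _
    rw [mul_add, ENNReal.ofReal_add (by positivity) (by positivity)]
    refine add_le_add (ENNReal.ofReal_le_ofReal ?_) ?_
    · refine mul_le_mul_of_nonneg_left ?_ (by positivity)
      have hu := shrink_mem_Icc hz.2
      rw [hg, show (1 - B) • o.1 - (1 - shrink z) • o.1 = (shrink z - B) • o.1 by module, norm_smul,
        mul_pow]
      refine mul_le_of_le_one_left (by positivity) ?_
      rw [Real.norm_eq_abs, sq_abs, sq_le_one_iff_abs_le_one, abs_le]
      constructor <;> linarith [hu.1, hu.2, hB01.1, hB01.2]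
    · rw [ENNReal.ofReal_mul (by positivity)]
      exact mul_le_mul_right (condVariance_le hz) _
  refine (lintegral_mono_ae step1).trans_lt ?_
  rw [lintegral_lintegral_swap]
  swap
  · have m1 : Measurable fun w : (EuclideanSpace ℝ (Fin p) × ℝ) × (ℝ × ℝ) =>
        marginalWeight n a b w.1.1 w.1.2 w.2.1 w.2.2 :=
      Measurable.marginalWeight n a b measurable_fst.fst measurable_fst.snd measurable_snd.fst
        measurable_snd.snd
    have m2 : Measurable fun w : (EuclideanSpace ℝ (Fin p) × ℝ) × (ℝ × ℝ) =>
        cutoff i w.2.1 w.2.2 := hmc.comp measurable_snd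
    exact (by fun_prop : Measurable _).aemeasurable
  -- the integral over all observations at fixed `(η, g)`
  have step2 : ∀ᵐ z ∂quadrant, ∫⁻ o, ENNReal.ofReal (marginalWeight n a b o.1 o.2 z.1 z.2
          * (cutoff i z.1 z.2 ^ 2 * (‖o.1‖ ^ 2 + C / z.1))) ∂obsMeasure p
      ≤ (Icc (Real.exp (-M)) (Real.exp M)).indicator (fun _ => 1) z.1 *
        (ENNReal.ofReal (C * (2 + Real.exp M) * Real.exp M * (1 + Real.exp M) ^ ((p : ℝ) / 2))
          * ENNReal.ofReal (hyperPrior a b z.2 * (1 + z.2) ^ (-((p : ℝ) / 2)))) := by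
    filter_upwards [ae_quadrant] with z hz
    have hz1 := hz.1
    have hz2 := hz.2
    have hπ := hyperPrior_nonneg a b hz2.le
    by_cases hc : cutoff i z.1 z.2 = 0
    · simp [hc]
    obtain ⟨hgM, hηM⟩ := hsupp z.1 z.2 hz1 hz2.le hc
    have hη := abs_le.1 hηM
    have hη1 : Real.exp (-M) ≤ z.1 := (Real.le_log_iff_exp_le hz1).1 hη.1
    have hη2 : z.1 ≤ Real.exp M := (Real.log_le_iff_le_exp hz1).1 hη.2
    rw [indicator_of_mem (show z.1 ∈ Icc (Real.exp (-M)) (Real.exp M) from ⟨hη1, hη2⟩), one_mul]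
    have hτ : 0 < z.1 / (1 + z.2) := by positivity
    have hcut := cutoff_mem_Icc (η := z.1) hi hz2.le
    have e : ∀ᵐ o ∂obsMeasure p, ENNReal.ofReal (marginalWeight n a b o.1 o.2 z.1 z.2
          * (cutoff i z.1 z.2 ^ 2 * (‖o.1‖ ^ 2 + C / z.1)))
        ≤ ENNReal.ofReal (hyperPrior a b z.2)
          * ((ENNReal.ofReal (‖o.1‖ ^ 2 * normalDensity o.1 0 (z.1 / (1 + z.2)))
            + ENNReal.ofReal (C / z.1) * ENNReal.ofReal (normalDensity o.1 0 (z.1 / (1 + z.2))))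
          * ENNReal.ofReal (scaleDensity n o.2 z.1)) := by
      filter_upwards [ae_obsMeasure] with o ho
      have hd := normalDensity_nonneg o.1 0 hτ.le
      have hs := scaleDensity_nonneg n ho.le hz1.le
      rw [← ENNReal.ofReal_mul (by positivity),
        ← ENNReal.ofReal_add (by positivity) (by positivity),
        ← ENNReal.ofReal_mul (by positivity), ← ENNReal.ofReal_mul (by positivity)]
      refine ENNReal.ofReal_le_ofReal ?_
      have hc2 : cutoff i z.1 z.2 ^ 2 ≤ 1 := pow_le_one₀ hcut.1 hcut.2
      unfold marginalWeight
      calc _ ≤ hyperPrior a b z.2 * normalDensity o.1 0 (z.1 / (1 + z.2)) * scaleDensity n o.2 z.1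
            * (1 * (‖o.1‖ ^ 2 + C / z.1)) := by gcongr
        _ = _ := by ring
    have mn : Measurable fun x : EuclideanSpace ℝ (Fin p) =>
        normalDensity x 0 (z.1 / (1 + z.2)) :=
      Measurable.normalDensity measurable_id measurable_const measurable_const
    have msc : Measurable fun s : ℝ => scaleDensity n s z.1 :=
      Measurable.scaleDensity n measurable_id measurable_const
    refine (lintegral_mono_ae e).trans ?_
    rw [lintegral_const_mul' _ _ ENNReal.ofReal_ne_top]
    unfold obsMeasure
    rw [lintegral_prod_mul (f := fun x : EuclideanSpace ℝ (Fin p) =>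
      ENNReal.ofReal (‖x‖ ^ 2 * normalDensity x 0 (z.1 / (1 + z.2)))
        + ENNReal.ofReal (C / z.1) * ENNReal.ofReal (normalDensity x 0 (z.1 / (1 + z.2))))
      (g := fun s => ENNReal.ofReal (scaleDensity n s z.1)) (by fun_prop) (by fun_prop),
      lintegral_scaleDensity hn hz1, mul_one, lintegral_add_left (by fun_prop),
      lintegral_const_mul' _ _ ENNReal.ofReal_ne_top, lintegral_normalDensity _ hτ, mul_one]
    have hsq := lintegral_sq_mul_normalDensity_le (0 : EuclideanSpace ℝ (Fin p)) hτ
    simp only [sub_zero] at hsq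
    refine (mul_le_mul_right (add_le_add hsq le_rfl) _).trans ?_
    rw [← ENNReal.ofReal_add (by positivity) (by positivity), ← ENNReal.ofReal_mul hπ,
      ← ENNReal.ofReal_mul (by positivity)]
    refine ENNReal.ofReal_le_ofReal ?_
    have hinv : 1 / z.1 ≤ Real.exp M := by
      rw [div_le_iff₀ hz1]
      calc (1 : ℝ) = Real.exp M * Real.exp (-M) := by rw [← Real.exp_add]; simp
        _ ≤ _ := by gcongr
    have hpow : 1 ≤ (1 + Real.exp M) ^ ((p : ℝ) / 2) * (1 + z.2) ^ (-((p : ℝ) / 2)) := by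
      rw [Real.rpow_neg (by positivity), ← div_eq_mul_inv, one_le_div (by positivity)]
      gcongr
    calc hyperPrior a b z.2 * (4 * 2 ^ ((p : ℝ) / 2) / (z.1 / (1 + z.2)) + C / z.1)
        = C * (2 + z.2) * (1 / z.1) * hyperPrior a b z.2 * 1 := by rw [hC]; field_simp; ring
      _ ≤ C * (2 + Real.exp M) * Real.exp M * hyperPrior a b z.2
          * ((1 + Real.exp M) ^ ((p : ℝ) / 2) * (1 + z.2) ^ (-((p : ℝ) / 2))) := by gcongr
      _ = _ := by ring
  refine (lintegral_mono_ae step2).trans_lt ?_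
  have mh := measurable_hyperPrior a b
  unfold quadrant
  rw [lintegral_prod_mul (f := (Icc (Real.exp (-M)) (Real.exp M)).indicator fun _ => 1)
    (g := fun g => ENNReal.ofReal (C * (2 + Real.exp M) * Real.exp M
      * (1 + Real.exp M) ^ ((p : ℝ) / 2))
      * ENNReal.ofReal (hyperPrior a b g * (1 + g) ^ (-((p : ℝ) / 2))))
    (measurable_const.indicator measurableSet_Icc).aemeasurable (by fun_prop),
    lintegral_const_mul' _ _ ENNReal.ofReal_ne_top]
  refine ENNReal.mul_lt_top ?_ (ENNReal.mul_lt_top ENNReal.ofReal_lt_top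
    (lintegral_hyperPrior_lt_top hb h1))
  refine (setLIntegral_le_lintegral _ _).trans_lt ?_
  rw [lintegral_indicator measurableSet_Icc, setLIntegral_const, one_mul]
  exact measure_Icc_lt_top

theorem cutoffMass_pos {n : ℕ} (hn : 1 ≤ n) (a b : ℝ) (x : EuclideanSpace ℝ (Fin p)) {s : ℝ}
    (hs : 0 < s) : 0 < cutoffMass n a b 1 x s := by
  have hmc := measurable_cutoff 1
  unfold cutoffMass
  rw [lintegral_posterior n a b x s (by fun_prop)]
  have hm := (measurable_marginalWeight_right n a b x s)
  rw [lintegral_pos_iff_support (by fun_prop)]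
  -- on this rectangle `iterLog ≤ log (5 / 4) + log 2 < 1`
  have hsub : Ioo (1 : ℝ) 2 ×ˢ Ioo (0 : ℝ) (1 / 4) ⊆ Function.support fun z : ℝ × ℝ =>
      ENNReal.ofReal (marginalWeight n a b x s z.1 z.2)
        * ENNReal.ofReal (cutoff 1 z.1 z.2 ^ 2) := by
    rintro ⟨η, g⟩ ⟨⟨hη1, hη2⟩, ⟨hg1, hg2⟩⟩
    simp only at hη1 hη2 hg1 hg2
    have h1 := iterLog_le (η := η) hg1.le
    have h2 : Real.log (1 + g) ≤ 1 / 4 := by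
      have := Real.log_le_sub_one_of_pos (show 0 < 1 + g by linarith)
      linarith
    have h3 : |Real.log η| ≤ 0.6931471808 := by
      rw [abs_of_nonneg (Real.log_nonneg hη1.le)]
      exact (Real.log_le_log (by linarith) hη2.le).trans Real.log_two_lt_d9.le
    have hc : 0 < cutoff 1 η g := by
      unfold cutoff
      refine lt_max_of_lt_right ?_
      rw [div_one]; linarith
    have hw := marginalWeight_pos hn a b x hs (show 0 < η by linarith) hg1
    simp only [Function.mem_support, ne_eq, mul_eq_zero, ENNReal.ofReal_eq_zero, not_or, not_le]
    exact ⟨hw, by positivity⟩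
  refine lt_of_lt_of_le ?_ (measure_mono hsub)
  unfold quadrant
  rw [Measure.prod_prod, Measure.restrict_apply measurableSet_Ioo,
    Measure.restrict_apply measurableSet_Ioo, inter_eq_left.2 fun y hy => ?_,
    inter_eq_left.2 fun y hy => hy.1, Real.volume_Ioo, Real.volume_Ioo]
  · norm_num
  · exact lt_trans one_pos hy.1

theorem measurable_cutoffMass (n : ℕ) (a b i : ℝ) :
    Measurable fun o : EuclideanSpace ℝ (Fin p) × ℝ => cutoffMass n a b i o.1 o.2 := by
  have hmc := measurable_cutoff i
  have m1 : Measurable fun w : (EuclideanSpace ℝ (Fin p) × ℝ) × (ℝ × ℝ) =>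
      marginalWeight n a b w.1.1 w.1.2 w.2.1 w.2.2 :=
    Measurable.marginalWeight n a b measurable_fst.fst measurable_fst.snd measurable_snd.fst
      measurable_snd.snd
  have m2 : Measurable fun w : (EuclideanSpace ℝ (Fin p) × ℝ) × (ℝ × ℝ) =>
      cutoff i w.2.1 w.2.2 := hmc.comp measurable_snd
  have e : (fun o : EuclideanSpace ℝ (Fin p) × ℝ => cutoffMass n a b i o.1 o.2)
      = fun o => ∫⁻ z, ENNReal.ofReal (marginalWeight n a b o.1 o.2 z.1 z.2)
        * ENNReal.ofReal (cutoff i z.1 z.2 ^ 2) ∂quadrant :=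
    funext fun o => lintegral_posterior n a b o.1 o.2 (by fun_prop)
  rw [e]
  exact Measurable.lintegral_prod_right' (f := fun w : (EuclideanSpace ℝ (Fin p) × ℝ) × (ℝ × ℝ) =>
    ENNReal.ofReal (marginalWeight n a b w.1.1 w.1.2 w.2.1 w.2.2)
        * ENNReal.ofReal (cutoff i w.2.1 w.2.2 ^ 2)) (by fun_prop)

/-- An estimator whose risk is nowhere larger than that of the generalized Bayes estimator is almost
everywhere equal to it. -/
theorem ae_eq_genBayes_of_risk_le (hp : 1 ≤ p) {n : ℕ} (hn : 1 ≤ n) {a b : ℝ} (hb : -1 < b)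
    (h1 : -a - 1 - (p : ℝ) / 2 < 0) (ha : -2 ≤ a) (ha' : a ≤ -1)
    {δ : EuclideanSpace ℝ (Fin p) → ℝ → EuclideanSpace ℝ (Fin p)}
    (hδ : Measurable (Function.uncurry δ))
    (hle : ∀ θ : EuclideanSpace ℝ (Fin p), ∀ η : ℝ, 0 < η →
      risk n δ θ η ≤ risk n (genBayes n (jointPrior a b)) θ η) :
    ∀ᵐ o ∂obsMeasure p, δ o.1 o.2 = genBayes n (jointPrior a b) o.1 o.2 := by
  set δ₀ := genBayes n (jointPrior (p := p) a b) with hδ₀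
  have hδ₀m : Measurable (Function.uncurry δ₀) := measurable_genBayes n a b
  obtain ⟨C, hC, hosc⟩ := cutoffOscillation_le (p := p) hn hb h1 ha ha'
  set energy : EuclideanSpace ℝ (Fin p) × ℝ → ENNReal := fun o => ENNReal.ofReal
      (‖o.1‖ ^ 2 * (o.2 ^ (-((p : ℝ) / 2) - 2) * (1 + ‖o.1‖ ^ 2 / o.2) ^ (-1 - (p : ℝ) / 2))
        * ((logRadius (1 / o.2) (‖o.1‖ ^ 2 / o.2)
          * (1 + Real.log (logRadius (1 / o.2) (‖o.1‖ ^ 2 / o.2)))) ^ 2)⁻¹) with henergy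
  have hem : Measurable energy := by rw [henergy]; unfold logRadius; fun_prop
  have hE : ∫⁻ o, energy o ∂obsMeasure p < ⊤ := by
    unfold obsMeasure
    rw [lintegral_prod _ hem.aemeasurable]
    exact lintegral_energy_lt_top hp
  have md : Measurable fun o : EuclideanSpace ℝ (Fin p) × ℝ => δ o.1 o.2 := hδ
  have md₀ : Measurable fun o : EuclideanSpace ℝ (Fin p) × ℝ => δ₀ o.1 o.2 := hδ₀m
  have gap_m : ∀ i, Measurable fun o : EuclideanSpace ℝ (Fin p) × ℝ =>
      ENNReal.ofReal (‖δ o.1 o.2 - δ₀ o.1 o.2‖ ^ 2 / 2) * cutoffMass n a b i o.1 o.2 := fun i => by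
    have := measurable_cutoffMass (p := p) n a b i
    fun_prop
  have mono : ∀ i, ∫⁻ o, cutoffRisk n a b i (δ o.1 o.2) o.1 o.2 ∂obsMeasure p
      ≤ ∫⁻ o, cutoffRisk n a b i (δ₀ o.1 o.2) o.1 o.2 ∂obsMeasure p := by
    intro i
    rw [lintegral_cutoffRisk n a b i hδ, lintegral_cutoffRisk n a b i hδ₀m]
    refine lintegral_mono_ae ?_
    filter_upwards [ae_quadrant] with z hz
    exact lintegral_mono fun θ => mul_le_mul_right (hle θ z.1 hz.1) _
  have rm : ∀ i, ∀ {d : EuclideanSpace ℝ (Fin p) → ℝ → EuclideanSpace ℝ (Fin p)},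
      Measurable (Function.uncurry d) →
      Measurable fun o : EuclideanSpace ℝ (Fin p) × ℝ =>
        cutoffRisk n a b i (d o.1 o.2) o.1 o.2 := fun i d hd =>
    ((measurable_cutoffRisk n a b i hd).lintegral_prod_right').lintegral_prod_right'
  have gap_le : ∀ i : ℝ, 0 < i → ∫⁻ o, ENNReal.ofReal (‖δ o.1 o.2 - δ₀ o.1 o.2‖ ^ 2 / 2)
      * cutoffMass n a b i o.1 o.2 ∂obsMeasure p
      ≤ ENNReal.ofReal (48 * C / i ^ 2) * ∫⁻ o, energy o ∂obsMeasure p := by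
    intro i hi
    have pt : ∀ᵐ o ∂obsMeasure p, cutoffRisk n a b i (δ₀ o.1 o.2) o.1 o.2
        + ENNReal.ofReal (‖δ o.1 o.2 - δ₀ o.1 o.2‖ ^ 2 / 2) * cutoffMass n a b i o.1 o.2
        ≤ cutoffRisk n a b i (δ o.1 o.2) o.1 o.2 + ENNReal.ofReal (48 * C / i ^ 2) * energy o := by
      filter_upwards [ae_obsMeasure] with o ho
      refine (cutoffRisk_genBayes_add_le hn hb h1 hi (δ o.1 o.2) o.1 ho).trans
        (add_le_add le_rfl ?_)
      rw [henergy, ← ENNReal.ofReal_mul (by positivity)]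
      refine ENNReal.ofReal_le_ofReal ?_
      refine (mul_le_mul_of_nonneg_left (hosc i o.1 o.2 hi ho) (by positivity)).trans (le_of_eq ?_)
      ring
    have tot := lintegral_mono_ae pt
    rw [lintegral_add_left (rm i hδ₀m), lintegral_add_left (rm i hδ),
      lintegral_const_mul' _ _ ENNReal.ofReal_ne_top] at tot
    have fin := lintegral_cutoffRisk_genBayes_lt_top (p := p) hn hb h1 hi
    exact (ENNReal.add_le_add_iff_left fin.ne).1 (tot.trans (add_le_add (mono i) le_rfl))
  have gap_zero : ∫⁻ o, ENNReal.ofReal (‖δ o.1 o.2 - δ₀ o.1 o.2‖ ^ 2 / 2)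
      * cutoffMass n a b 1 o.1 o.2 ∂obsMeasure p = 0 := by
    have all : ∀ i : ℝ, 1 ≤ i → ∫⁻ o, ENNReal.ofReal (‖δ o.1 o.2 - δ₀ o.1 o.2‖ ^ 2 / 2)
        * cutoffMass n a b 1 o.1 o.2 ∂obsMeasure p
        ≤ ENNReal.ofReal (48 * C / i ^ 2) * ∫⁻ o, energy o ∂obsMeasure p := by
      intro i hi
      refine le_trans (lintegral_mono fun o => mul_le_mul_right ?_ _) (gap_le i (by linarith))
      refine lintegral_mono_ae ((ae_posterior n a b o.1 o.2).mono fun z hz => ?_)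
      have := (cutoff_mem_Icc (η := z.1) one_pos hz.2.le).1
      have := cutoff_mono (η := z.1) one_pos hi hz.2.le
      exact ENNReal.ofReal_le_ofReal (by gcongr)
    have lim : Filter.Tendsto (fun i : ℝ => ENNReal.ofReal (48 * C / i ^ 2)
        * ∫⁻ o, energy o ∂obsMeasure p) Filter.atTop (nhds 0) := by
      rw [← zero_mul (∫⁻ o, energy o ∂obsMeasure p)]
      refine ENNReal.Tendsto.mul_const ?_ (Or.inr hE.ne)
      rw [← ENNReal.ofReal_zero]
      refine ENNReal.tendsto_ofReal ?_
      exact tendsto_const_nhds.div_atTop (Filter.tendsto_pow_atTop two_ne_zero)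
    refine le_antisymm (ge_of_tendsto lim ?_) zero_le
    filter_upwards [Filter.eventually_ge_atTop 1] with i hi using all i hi
  rw [lintegral_eq_zero_iff (gap_m 1)] at gap_zero
  filter_upwards [gap_zero, ae_obsMeasure] with o ho hs
  have h2 := (mul_eq_zero.1 ho).resolve_right (cutoffMass_pos hn a b o.1 hs).ne'
  rw [ENNReal.ofReal_eq_zero] at h2
  have h3 : ‖δ o.1 o.2 - δ₀ o.1 o.2‖ = 0 := by
    have := norm_nonneg (δ o.1 o.2 - δ₀ o.1 o.2)
    nlinarith
  exact sub_eq_zero.1 (norm_eq_zero.1 h3)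

theorem risk_congr_ae (n : ℕ) {δ δ' : EuclideanSpace ℝ (Fin p) → ℝ → EuclideanSpace ℝ (Fin p)}
    (h : ∀ᵐ o ∂obsMeasure p, δ o.1 o.2 = δ' o.1 o.2) (θ : EuclideanSpace ℝ (Fin p)) (η : ℝ) :
    risk n δ θ η = risk n δ' θ η := by
  refine lintegral_congr_ae ?_
  filter_upwards [Measure.ae_ae_of_ae_prod h] with x hx
  refine lintegral_congr_ae ?_
  filter_upwards [hx] with s hs
  simp only [hs]

end

theorem theorem1 (p n : ℕ) (hn : 1 ≤ n) (a b : ℝ)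
    (hcase : (1 ≤ p ∧ max (-(p : ℝ) / 2 - 1) (-2) < a ∧ a ≤ -1 ∧ -1 < b) ∨
      (3 ≤ p ∧ a = -2 ∧ 0 ≤ b)) :
    GenBayesWellDefined n p a b ∧
      IsAdmissible n (genBayes n (jointPrior (p := p) a b)) := by
  -- both cases satisfy these conditions, which are all that the argument needs
  obtain ⟨hp, hb, h1, ha, ha'⟩ : 1 ≤ p ∧ -1 < b ∧ -a - 1 - (p : ℝ) / 2 < 0 ∧ -2 ≤ a ∧ a ≤ -1 := by
    rcases hcase with ⟨hp, hm, ha, hb⟩ | ⟨hp, ha, hb⟩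
    · obtain ⟨h2, h3⟩ := max_lt_iff.1 hm
      exact ⟨hp, hb, by linarith, h3.le, ha⟩
    · have : (3 : ℝ) ≤ p := by exact_mod_cast hp
      exact ⟨by omega, by linarith, by linarith, by linarith, by linarith⟩
  refine ⟨genBayesWellDefined hn hb h1, measurable_genBayes n a b, ?_⟩
  rintro ⟨δ, hδ, hle, θ, η, -, hlt⟩
  have := risk_congr_ae n (ae_eq_genBayes_of_risk_le hp hn hb h1 ha ha' hδ hle) θ η
  exact hlt.ne this
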